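/- For a complex number $q$ with $|q|<1$ and an integer $s\ge 1$ put $$\beta_q(s)=\sum_{k\ge 1}k^{s-1}\frac{q^k}{1+q^{2k}}.$$ For positive integers $r$ and $A$ put $$f(r;A)=\frac{4rA+A-4r^2}{\left(\frac{48}{\pi^2}+2\right)A+8r^2-\frac{16}{\pi^2}+\frac{16r}{3}},$$ and for every integer $A\ge 3$ put $$f(A)=\max_{r\in\mathbb{Z},\ 1\le r<A/2}f(r;A).$$ Theorem 1.1. Let $q$ be a nonzero number such that $1/q\in\mathbb{Z}\setminus\{-1,1\}$, and let $A\ge 3$ be an odd integer. Then the $\mathbb{Q}$-vector space spanned by $1$ and the numbers $\beta_q(s)$ with $s$ even, $2\le s\le A-1$, satisfies $$\dim_{\mathbb{Q}}\bigl(\mathbb{Q}+\mathbb{Q}\beta_q(2)+\mathbb{Q}\beta_q(4)+\dots+\mathbb{Q}\beta_q(A-1)\bigr)\ge f(A).$$ Moreover, as $A\to+\infty$, $$f(A)\sim\frac{\pi}{2\sqrt{\pi^2+24}}\,\sqrt{A}.$$ -/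

import Mathlib

/-- The `q`-analogue `β_q(s) = ∑_{k ≥ 1} k^(s-1) q^k / (1 + q^(2k))` of the value of Dirichlet's
beta function at the integer `s ≥ 1`, for complex `q` with `|q| < 1`. -/
noncomputable def qBeta (q : ℂ) (s : ℕ) : ℂ :=
  ∑' k : ℕ+, (k : ℂ) ^ (s - 1) * (q ^ (k : ℕ) / (1 + q ^ (2 * (k : ℕ))))

/-- The series defining `qBeta` converges absolutely for `|q| < 1`. -/
theorem summable_qBeta {q : ℂ} (hq : ‖q‖ < 1) (s : ℕ) :
    Summable fun k : ℕ+ => (k : ℂ) ^ (s - 1) * (q ^ (k : ℕ) / (1 + q ^ (2 * (k : ℕ)))) := by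
  have h0 : Summable fun n : ℕ => ‖((n : ℂ) ^ (s - 1) * q ^ n : ℂ)‖ * (1 - ‖q‖)⁻¹ :=
    (summable_norm_pow_mul_geometric_of_norm_lt_one (s - 1) hq).mul_right _
  have h1 := h0.comp_injective PNat.coe_injective
  refine Summable.of_norm_bounded h1 fun k => ?_
  have hpos : 0 < 1 - ‖q‖ := by linarith
  have hk : ‖q ^ (2 * (k : ℕ))‖ ≤ ‖q‖ := by
    rw [norm_pow]
    have : 2 * (k : ℕ) ≠ 0 := by have := k.pos; omega
    exact pow_le_of_le_one (norm_nonneg _) hq.le this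
  have hden : 1 - ‖q‖ ≤ ‖1 + q ^ (2 * (k : ℕ))‖ := by
    have h := norm_sub_norm_le (1 : ℂ) (-(q ^ (2 * (k : ℕ))))
    rw [norm_one, norm_neg, sub_neg_eq_add] at h
    linarith
  simp only [Function.comp_apply, ← mul_div_assoc]
  rw [norm_div, div_eq_mul_inv]
  gcongr

/-- The `ℚ`-subspace `ℚ + ℚ β_q(2) + ℚ β_q(4) + ⋯ + ℚ β_q(A-1)` of `ℂ`, for odd `A`. -/
noncomputable def qBetaSpace (q : ℂ) (A : ℕ) : Submodule ℚ ℂ :=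
  Submodule.span ℚ (insert 1 (qBeta q '' {s | Even s ∧ 2 ≤ s ∧ s ≤ A - 1}))

/-- The quantity `f(r; A)`. -/
noncomputable def boundTerm (r A : ℕ) : ℝ :=
  (4 * r * A + A - 4 * r ^ 2) /
    ((48 / Real.pi ^ 2 + 2) * A + 8 * r ^ 2 - 16 / Real.pi ^ 2 + 16 * r / 3)

/-- `f(A)`, the maximum of `f(r; A)` over the integers `r` with `1 ≤ r < A / 2`. -/
noncomputable def bound (A : ℕ) : ℝ :=
  sSup ((fun r : ℕ => boundTerm r A) '' {r | 1 ≤ r ∧ (r : ℝ) < (A : ℝ) / 2})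

/-- The supremum in the definition of `bound` is a maximum. -/
theorem bound_isGreatest {A : ℕ} (hA : 3 ≤ A) :
    IsGreatest ((fun r : ℕ => boundTerm r A) '' {r | 1 ≤ r ∧ (r : ℝ) < (A : ℝ) / 2})
      (bound A) := by
  have hfin : ({r : ℕ | 1 ≤ r ∧ (r : ℝ) < (A : ℝ) / 2}).Finite := by
    refine (Set.finite_Iio A).subset fun r hr => ?_
    have h2 : (r : ℝ) < (A : ℝ) / 2 := hr.2
    have h3 : (0 : ℝ) ≤ A := Nat.cast_nonneg A
    have : (r : ℝ) < A := by linarith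
    exact_mod_cast this
  have hne : ({r : ℕ | 1 ≤ r ∧ (r : ℝ) < (A : ℝ) / 2}).Nonempty := by
    refine ⟨1, le_rfl, ?_⟩
    have : (3 : ℝ) ≤ A := by exact_mod_cast hA
    push_cast
    linarith
  exact ⟨(hne.image _).csSup_mem (hfin.image _),
    fun x hx => le_csSup (hfin.image _).bddAbove hx⟩

/-! Write m = 1/q, an integer with |m| ≥ 2, and A = 2(r+b)+1. The lower bound rests on a
Nesterenko-type criterion, `finrank_ge_of_small_forms`: if integer linear forms in elements of V
have absolute value exp(-(α+o(1))N²) and coefficients at most exp((γ+o(1))N²), then dim V ≥ 1 + α/γ.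

The forms come from a rational function R (`formFun`) with poles of order A at m^(2j), 0 ≤ j ≤ 2N,
zeros at m^(-1), m^(-3), ..., m^(-(4rN-1)), a zero of high order at 0, and the symmetry R(m^(4N)/x)
= R(x) (`formFun_symm`). The alternating sum S of the values R(m^(-(2h+1))), h ≥ 0, has its first
2rN terms equal to 0, and the next term governs its size (`formSum_bounds`).

Partial fractions turn 2S into a combination of 1 and the numbers P_s = ∑ (-1)^h (T^s + U^s - 1),
where x = q^(2h+1), T = 1/(1-x) and U = 1/(1-1/x) = 1-T. The symmetry of R is what makes T^s and U^s
occur with the same coefficient. The coefficient of x^K in T^s + U^s - 1 is p(K) - p(-K) for a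
polynomial p, hence odd in K, so P_s involves only ∑ K^i q^K/(1+q^(2K)) with i odd, that is β_q at
even integers (`risingPoly_odd_part`, `factorial_mul_formPeriod`).

For integrality, the local expansions of R are handled as power series that become integral when the
variable is scaled by D, the product of Φ_d(m) for d ≤ 4N. Two savings matter: the numerator of R
contains many factors Φ_d(m) with d odd (`oddPartProd_pow_dvd`), and the finite sums left over
involve only odd exponents, so one of their denominators divides the product over odd d
(`cycProd_pow_mul_mem`). The sizes follow from log|Φ_d(m)| = φ(d) log|m| + O(1) and from averages of
φ over all d and over odd d.

In units of log|m|, γ is the denominator of f(r;A) and α + γ its numerator, so 1 + α/γ = f(r;A). For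
the asymptotics put r = t√A: then f is about √A · 4t/(c+8t²) with c = 48/π²+2, whose maximum, at t =
√(c/8), is √A/√(2c). -/

open Filter Topology
open scoped ArithmeticFunction.Moebius

/-! ### Linear independence criterion -/

/-- Dirichlet's theorem on simultaneous approximation. -/
theorem exists_simultaneous_approx (k : ℕ) (θ : Fin k → ℝ) (H : ℕ) (hH : 0 < H) :
    ∃ (Q : ℕ) (w : Fin k → ℤ), 0 < Q ∧ Q ≤ H ^ k ∧ ∀ i, |Q * θ i - w i| ≤ 1 / H := by
  have hH' : (0 : ℝ) < H := by exact_mod_cast hH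
  let F : ℕ → (Fin k → Fin H) := fun a i =>
    ⟨⌊Int.fract (a * θ i) * H⌋₊, by
      rw [Nat.floor_lt (by positivity)]
      calc Int.fract (a * θ i) * H < 1 * H := by
            gcongr; exact Int.fract_lt_one _
        _ = H := one_mul _⟩
  -- Pigeonhole: the H^k + 1 multiples a = 0, ..., H^k fall into the H^k boxes of side 1/H.
  obtain ⟨x, hx, y, hy, hxy, hF⟩ := Finset.exists_ne_map_eq_of_card_lt_of_maps_to
    (s := Finset.range (H ^ k + 1)) (t := (Finset.univ : Finset (Fin k → Fin H)))
    (by simp) (f := F) (fun _ _ => Finset.mem_univ _)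
  wlog hlt : x < y generalizing x y
  · exact this y hy x hx hxy.symm hF.symm (lt_of_le_of_ne (not_lt.mp hlt) hxy.symm)
  refine ⟨y - x, fun i => ⌊y * θ i⌋ - ⌊x * θ i⌋, by omega, ?_, fun i => ?_⟩
  · have := Finset.mem_range.mp hy; omega
  · have h1 : ⌊Int.fract (x * θ i) * H⌋₊ = ⌊Int.fract (y * θ i) * H⌋₊ := by
      have := congrFun hF i
      exact congrArg Fin.val this
    have e1 := Nat.floor_le (show 0 ≤ Int.fract (x * θ i) * H by positivity)
    have e2 := Nat.lt_floor_add_one (Int.fract (x * θ i) * H)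
    have e3 := Nat.floor_le (show 0 ≤ Int.fract (y * θ i) * H by positivity)
    have e4 := Nat.lt_floor_add_one (Int.fract (y * θ i) * H)
    rw [h1] at e1 e2
    have e5 : |(Int.fract (y * θ i) - Int.fract (x * θ i)) * H| ≤ 1 := by
      rw [abs_le]; constructor <;> linarith
    rw [abs_mul, abs_of_pos hH'] at e5
    rw [le_div_iff₀ hH']
    have e6 : ((y - x : ℕ) : ℝ) * θ i - ((⌊y * θ i⌋ - ⌊x * θ i⌋ : ℤ) : ℝ)
        = Int.fract (y * θ i) - Int.fract (x * θ i) := by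
      rw [Nat.cast_sub hlt.le]
      simp only [Int.fract]
      push_cast
      ring
    rw [e6]
    exact e5

theorem eventually_quadratic_lt {a b c e : ℝ} (h : a < b) :
    ∀ᶠ N : ℕ in atTop, a * N ^ 2 + c * N + e < b * N ^ 2 := by
  obtain ⟨n0, hn0⟩ := exists_nat_gt ((|c| + |e|) / (b - a))
  filter_upwards [eventually_ge_atTop (n0 + 1)] with N hN
  have hN1 : (1 : ℝ) ≤ N := by exact_mod_cast (by omega : 1 ≤ N)
  have hN2 : (n0 : ℝ) ≤ N := by exact_mod_cast (by omega : n0 ≤ N)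
  rw [div_lt_iff₀ (by linarith)] at hn0
  have h1 : |c| + |e| < (b - a) * N := by nlinarith
  have h2 : (|c| + |e|) * N < (b - a) * N * N := by
    apply mul_lt_mul_of_pos_right h1; linarith
  have h3 : e ≤ |e| * N := by nlinarith [le_abs_self e, abs_nonneg e]
  have h4 : c * N ≤ |c| * N := by nlinarith [le_abs_self c]
  nlinarith

set_option maxHeartbeats 800000 in
/-- A linear independence criterion in the spirit of Nesterenko: small linear forms with integer
coefficients at points of a finite dimensional `ℚ`-subspace of `ℝ` force its dimension to be
large. -/
theorem finrank_ge_of_small_forms {ι : Type*} [Fintype ι] (V : Submodule ℚ ℝ)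
    [FiniteDimensional ℚ V] (ξ : ι → ℝ) (hξ : ∀ i, ξ i ∈ V) (p : ℕ → ι → ℤ) {α γ : ℝ}
    (hα : 0 < α) (hγ : 0 < γ)
    (hform : Tendsto (fun N : ℕ => Real.log |∑ i, p N i * ξ i| / (N : ℝ) ^ 2) atTop (𝓝 (-α)))
    (hcoef : ∀ ε > 0, ∀ᶠ N : ℕ in atTop, ∀ i, |(p N i : ℝ)| ≤ Real.exp ((γ + ε) * (N : ℝ) ^ 2)) :
    1 + α / γ ≤ Module.finrank ℚ V := by
  by_contra! hlt
  -- nonvanishing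
  have hne : ∀ᶠ N : ℕ in atTop, ∑ i, p N i * ξ i ≠ 0 := by
    filter_upwards [hform.eventually (gt_mem_nhds (show -α < 0 by linarith))] with N hN h0
    simp [h0] at hN
  obtain ⟨k, hk⟩ : ∃ k, Module.finrank ℚ V = k + 1 := by
    rcases Nat.eq_zero_or_pos (Module.finrank ℚ V) with h | h
    · exfalso
      rw [Module.finrank_zero_iff] at h
      obtain ⟨N, hN⟩ := hne.exists
      apply hN
      apply Finset.sum_eq_zero
      intro i _
      have : (⟨ξ i, hξ i⟩ : V) = 0 := Subsingleton.elim _ _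
      have : ξ i = 0 := congrArg Subtype.val this
      simp [this]
    · exact ⟨_, (Nat.succ_pred_eq_of_pos h).symm⟩
  rw [hk] at hlt
  have hkγ : k * γ < α := by
    push_cast at hlt
    have : (k : ℝ) < α / γ := by linarith
    rwa [lt_div_iff₀ hγ] at this
  let b := (Module.finBasisOfFinrankEq ℚ V hk)
  have hb0 : ((b 0 : V) : ℝ) ≠ 0 := by
    simpa using b.ne_zero 0
  set v : ℝ := ((b 0 : V) : ℝ) with hv
  -- integer coordinates
  obtain ⟨⟨Dn, hDn⟩, hD⟩ := IsLocalization.exist_integer_multiples_of_finite (nonZeroDivisors ℤ)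
    (fun x : ι × Fin (k + 1) => b.repr ⟨ξ x.1, hξ x.1⟩ x.2)
  have hDn0 : Dn ≠ 0 := nonZeroDivisors.ne_zero hDn
  choose z hz using hD
  have hz' : ∀ i l, ((z (i, l) : ℤ) : ℚ) = Dn * b.repr ⟨ξ i, hξ i⟩ l := by
    intro i l
    have := hz (i, l)
    simpa [Submonoid.smul_def] using this
  have hξb : ∀ i, (Dn : ℝ) * ξ i = ∑ l, (z (i, l) : ℝ) * ((b l : V) : ℝ) := by
    intro i
    have h1 := congrArg (Subtype.val : V → ℝ) (b.sum_repr ⟨ξ i, hξ i⟩)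
    simp only [Submodule.coe_sum, Submodule.coe_smul] at h1
    rw [← h1, Finset.mul_sum]
    refine Finset.sum_congr rfl fun l _ => ?_
    have h2 : ((z (i, l) : ℤ) : ℝ) = ((Dn * b.repr ⟨ξ i, hξ i⟩ l : ℚ) : ℝ) := by
      rw [← hz']; simp
    rw [h2, Rat.smul_def]
    push_cast
    ring
  let P : ℕ → Fin (k + 1) → ℤ := fun N l => ∑ i, p N i * z (i, l)
  let lam : ℕ → ℝ := fun N => |∑ i, p N i * ξ i| * (|(Dn : ℝ)| / |v|)
  let θ : Fin (k + 1) → ℝ := fun l => ((b l : V) : ℝ) / v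
  have hDv : 0 < |(Dn : ℝ)| / |v| := by
    have : (Dn : ℝ) ≠ 0 := by exact_mod_cast hDn0
    positivity
  have hlam : ∀ N, |∑ l, (P N l : ℝ) * θ l| = lam N := by
    intro N
    have : ∑ l, (P N l : ℝ) * θ l = (∑ i, p N i * ξ i) * (Dn / v) := by
      simp only [P, θ]
      push_cast
      simp only [Finset.sum_mul]
      rw [Finset.sum_comm]
      refine Finset.sum_congr rfl fun i _ => ?_
      have := hξb i
      calc _ = (p N i : ℝ) * (∑ l, (z (i, l) : ℝ) * ((b l : V) : ℝ)) / v := by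
            rw [Finset.mul_sum, Finset.sum_div]
            refine Finset.sum_congr rfl fun l _ => by ring
        _ = _ := by rw [← this]; ring
    rw [this, abs_mul, abs_div]
  obtain ⟨Cz, hCz0, hCz⟩ : ∃ C : ℝ, 0 < C ∧ ∀ l, ∑ i, |(z (i, l) : ℝ)| ≤ C := by
    refine ⟨1 + ∑ l, ∑ i, |(z (i, l) : ℝ)|, by positivity, fun l => ?_⟩
    have := Finset.single_le_sum (f := fun l => ∑ i, |(z (i, l) : ℝ)|)
      (fun l _ => by positivity) (Finset.mem_univ l)
    linarith
  -- choice of ε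
  obtain ⟨ε, hε0, hε⟩ : ∃ ε > 0, k * (γ + 3 * ε) < α - ε := by
    refine ⟨(α - k * γ) / (2 * (3 * k + 1)), by
      apply div_pos <;> [linarith; positivity], ?_⟩
    have h3 : (0 : ℝ) < 3 * k + 1 := by positivity
    have : (α - k * γ) / (2 * (3 * k + 1)) * (3 * k + 1) = (α - k * γ) / 2 := by
      field_simp
    nlinarith
  have hεα : ε < α := by
    have : (0 : ℝ) ≤ k * (γ + 3 * ε) := by positivity
    linarith
  set Cl : ℝ := Real.log ((k + 1) * Cz) with hCl
  have hCpos : (0 : ℝ) < (k + 1) * Cz := by positivity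
  -- asymptotics of lam
  have hlam0 : ∀ᶠ N : ℕ in atTop, 0 < lam N := by
    filter_upwards [hne] with N hN
    exact mul_pos (abs_pos.mpr hN) hDv
  have hloglam : Tendsto (fun N : ℕ => Real.log (lam N) / (N : ℝ) ^ 2) atTop (𝓝 (-α)) := by
    have h2 : Tendsto (fun N : ℕ => Real.log (|(Dn : ℝ)| / |v|) / (N : ℝ) ^ 2) atTop (𝓝 0) :=
      Tendsto.const_div_atTop
        ((tendsto_pow_atTop two_ne_zero).comp tendsto_natCast_atTop_atTop) _
    have h3 := hform.add h2
    rw [add_zero] at h3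
    refine h3.congr' ?_
    filter_upwards [hne] with N hN
    simp only [lam]
    rw [Real.log_mul (abs_ne_zero.mpr hN) hDv.ne', add_div]
  have hlo : ∀ᶠ N : ℕ in atTop, -(α + ε) * (N : ℝ) ^ 2 ≤ Real.log (lam N) := by
    filter_upwards [hloglam.eventually (lt_mem_nhds (show -(α + ε) < -α by linarith)),
      eventually_ge_atTop 1] with N hN hN1
    have : (0 : ℝ) < (N : ℝ) ^ 2 := by
      have : 0 < N := hN1
      positivity
    rw [lt_div_iff₀ this] at hN
    exact hN.le
  have hup : ∀ᶠ N : ℕ in atTop, Real.log (lam N) ≤ -(α - ε) * (N : ℝ) ^ 2 := by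
    filter_upwards [hloglam.eventually (gt_mem_nhds (show -α < -(α - ε) by linarith)),
      eventually_ge_atTop 1] with N hN hN1
    have : (0 : ℝ) < (N : ℝ) ^ 2 := by
      have : 0 < N := hN1
      positivity
    rw [div_lt_iff₀ this] at hN
    exact hN.le
  have hP : ∀ᶠ N : ℕ in atTop, ∀ l, |(P N l : ℝ)| ≤ Cz * Real.exp ((γ + ε) * (N : ℝ) ^ 2) := by
    filter_upwards [hcoef ε hε0] with N hN l
    simp only [P]
    push_cast
    calc |∑ i, (p N i : ℝ) * (z (i, l) : ℝ)| ≤ ∑ i, |(p N i : ℝ) * (z (i, l) : ℝ)| :=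
          Finset.abs_sum_le_sum_abs _ _
      _ ≤ ∑ i, Real.exp ((γ + ε) * (N : ℝ) ^ 2) * |(z (i, l) : ℝ)| := by
          refine Finset.sum_le_sum fun i _ => ?_
          rw [abs_mul]
          gcongr
          exact hN i
      _ = (∑ i, |(z (i, l) : ℝ)|) * Real.exp ((γ + ε) * (N : ℝ) ^ 2) := by
          rw [← Finset.mul_sum, mul_comm]
      _ ≤ _ := by gcongr; exact hCz l
  have hhalf : ∀ᶠ N : ℕ in atTop, lam N < 1 / 2 := by
    filter_upwards [hup, hlam0, eventually_quadratic_lt (a := 0) (b := α - ε) (c := 0)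
      (e := Real.log 2) (by linarith)] with N h1 h2 h3
    rw [← Real.log_lt_log_iff h2 (by norm_num), one_div, Real.log_inv]
    linarith
  -- In (γ + 3ε), one ε is the slack on the coefficients and the other two are the gap between the
  -- exponents α + ε and α - ε in the bounds on `lam`; the linear terms come from replacing N by N -
  -- 1 below.
  have hq1 := eventually_quadratic_lt (a := k * (γ + 3 * ε)) (b := α - ε)
    (c := k * (2 * α) + 2 * (α - ε))
    (e := k * (Cl + Real.log 2) + Real.log 2) hε
  obtain ⟨N0, hN0⟩ := eventually_atTop.mp
    (hlam0.and (hlo.and (hup.and (hP.and (hhalf.and hq1)))))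
  -- choice of H, Q, N
  obtain ⟨H, hH⟩ := exists_nat_gt
    ((k + 1) * Cz * Real.exp ((γ + ε) * (N0 : ℝ) ^ 2) / lam N0)
  have hlamN0 : 0 < lam N0 := (hN0 N0 le_rfl).1
  have hH0 : 0 < H := by
    have : (0 : ℝ) < H := lt_of_le_of_lt (by positivity) hH
    exact_mod_cast this
  have hHr : (0 : ℝ) < H := by exact_mod_cast hH0
  obtain ⟨Q, w, hQ0, hQH, hw⟩ := exists_simultaneous_approx k (fun i => θ i.succ) H hH0
  have hQr : (1 : ℝ) ≤ Q := by exact_mod_cast hQ0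
  have hex : ∃ N, N0 ≤ N ∧ Q * lam N < 1 / 2 := by
    have : ∀ᶠ N : ℕ in atTop, Q * lam N < 1 / 2 := by
      filter_upwards [eventually_quadratic_lt (a := 0) (b := α - ε) (c := 0)
        (e := Real.log 2 + Real.log Q) (by linarith), eventually_ge_atTop N0] with N h3 hN
      have h1 := (hN0 N hN).2.2.1
      have h2 := (hN0 N hN).1
      rw [← Real.log_lt_log_iff (by positivity) (by norm_num), one_div, Real.log_inv,
        Real.log_mul (by positivity) h2.ne']
      linarith
    obtain ⟨N, h1, h2⟩ := (this.and (eventually_ge_atTop N0)).exists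
    exact ⟨N, h2, h1⟩
  classical
  -- Q is chosen before N. Minimality of N gives Q ≥ 1/(2 `lam (N - 1)`), so Q `lam N` is small
  -- enough for the contradiction but not much smaller.
  obtain ⟨N, ⟨hNN0, hNQ⟩, hmin⟩ : ∃ N, (N0 ≤ N ∧ Q * lam N < 1 / 2) ∧
      ∀ N' < N, ¬ (N0 ≤ N' ∧ Q * lam N' < 1 / 2) :=
    ⟨Nat.find hex, Nat.find_spec hex, fun N' h => Nat.find_min hex h⟩
  obtain ⟨hl0, hlo', hup', hP', hhalf', hq'⟩ := hN0 N hNN0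
  -- The rounding error must stay below the form itself. For N = N0 this is the choice of H;
  -- otherwise the lower bound on Q from minimality, together with Q ≤ H^k, forces H to be large.
  have herr : (k + 1) * Cz * Real.exp ((γ + ε) * (N : ℝ) ^ 2) / H < Q * lam N := by
    rcases eq_or_lt_of_le hNN0 with rfl | hlt'
    · rw [div_lt_iff₀ hlamN0] at hH
      rw [div_lt_iff₀ hHr]
      nlinarith [mul_pos hlamN0 hHr]
    · have hprev := hmin (N - 1) (by omega)
      have hN1 : N0 ≤ N - 1 := by omega
      have hge : 1 / 2 ≤ Q * lam (N - 1) := by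
        by_contra! hc
        exact hprev ⟨hN1, hc⟩
      obtain ⟨hl1, -, hup1, -, -, -⟩ := hN0 (N - 1) hN1
      have hcast : ((N - 1 : ℕ) : ℝ) = N - 1 := by
        rw [Nat.cast_sub (by omega)]; simp
      have hlogQ : (α - ε) * ((N : ℝ) - 1) ^ 2 - Real.log 2 ≤ Real.log Q := by
        have := Real.log_le_log (by norm_num) hge
        rw [Real.log_mul (by positivity) hl1.ne', one_div, Real.log_inv] at this
        rw [hcast] at hup1
        linarith
      have hlogH : Real.log Q ≤ k * Real.log H := by
        rw [← Real.log_pow]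
        apply Real.log_le_log (by positivity)
        exact_mod_cast hQH
      have hmain : k * (Cl + Real.log 2 + (γ + 3 * ε) * (N : ℝ) ^ 2 + 2 * α * N)
          < k * Real.log H := by
        linarith
      have hmain' := lt_of_mul_lt_mul_left hmain (Nat.cast_nonneg k)
      have hNr : (0 : ℝ) ≤ N := Nat.cast_nonneg N
      rw [← Real.log_lt_log_iff (by positivity) (by positivity),
        Real.log_div (by positivity) (by positivity),
        Real.log_mul (by positivity) (by positivity), Real.log_exp,
        Real.log_mul (by positivity) hl0.ne']
      have h5 : 0 ≤ ε * N := by positivity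
      linarith
  -- the contradiction
  let w' : Fin (k + 1) → ℤ := Fin.cons (Q : ℤ) w
  have hZ : |((∑ l, P N l * w' l : ℤ) : ℝ) - Q * ∑ l, (P N l : ℝ) * θ l|
      ≤ (k + 1) * Cz * Real.exp ((γ + ε) * (N : ℝ) ^ 2) / H := by
    push_cast
    rw [Finset.mul_sum, ← Finset.sum_sub_distrib]
    refine (Finset.abs_sum_le_sum_abs _ _).trans ?_
    have : ∀ l ∈ (Finset.univ : Finset (Fin (k + 1))),
        |(P N l : ℝ) * (w' l : ℝ) - Q * ((P N l : ℝ) * θ l)|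
          ≤ Cz * Real.exp ((γ + ε) * (N : ℝ) ^ 2) / H := by
      intro l _
      have h1 : |Q * θ l - w' l| ≤ 1 / H := by
        refine Fin.cases ?_ (fun i => ?_) l
        · have : θ 0 = 1 := div_self hb0
          simp [w', this]
        · simpa [w'] using hw i
      have h2 : (P N l : ℝ) * (w' l : ℝ) - Q * ((P N l : ℝ) * θ l)
          = -(P N l * (Q * θ l - w' l)) := by ring
      rw [h2, abs_neg, abs_mul, div_eq_mul_one_div]
      exact mul_le_mul (hP' l) h1 (abs_nonneg _) (by positivity)
    refine (Finset.sum_le_card_nsmul _ _ _ this).trans (le_of_eq ?_)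
    simp
    ring
  have hQl : |Q * ∑ l, (P N l : ℝ) * θ l| = Q * lam N := by
    rw [abs_mul, hlam, abs_of_nonneg (by positivity)]
  generalize (∑ l, P N l * w' l) = Z at hZ
  have hlt1 := lt_of_le_of_lt hZ herr
  -- Z lies within less than Q `lam N` of a number of absolute value Q `lam N` < 1/2, so 0 < |Z| <
  -- 1.
  have hZ0 : Z ≠ 0 := by
    rintro rfl
    rw [Int.cast_zero, zero_sub, abs_neg, hQl] at hlt1
    exact lt_irrefl _ hlt1
  have hZ1 : |(Z : ℝ)| < 1 := by
    have h3 := abs_sub_abs_le_abs_sub (Z : ℝ) (Q * ∑ l, (P N l : ℝ) * θ l)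
    rw [hQl] at h3
    linarith
  have : |Z| < 1 := by exact_mod_cast hZ1
  exact hZ0 (Int.abs_lt_one_iff.mp this)

/-! ### Averages of Euler's totient over all integers and over odd integers -/

theorem totient_eq_sum_moebius {R : Type*} [CommRing R] {n : ℕ} (hn : 0 < n) :
    (Nat.totient n : R) = ∑ x ∈ n.divisorsAntidiagonal, (μ x.1 : R) * (x.2 : R) := by
  have h : ∀ n : ℕ, n > 0 → ∑ i ∈ n.divisors, (Nat.totient i : R) = (n : R) := by
    intro n _
    rw [← Nat.cast_sum, Nat.sum_totient]
  exact ((ArithmeticFunction.sum_eq_iff_sum_mul_moebius_eq.mp h) n hn).symm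

/-- Sums of `φ` twisted by a completely multiplicative weight, expressed with the Möbius
function. -/
theorem sum_weight_totient (χ : ℕ → ℝ) (hχ : ∀ a b, χ (a * b) = χ a * χ b) (N : ℕ) :
    ∑ d ∈ Finset.Ioc 0 N, χ d * Nat.totient d
      = ∑ a ∈ Finset.Ioc 0 N, χ a * μ a * ∑ b ∈ Finset.Ioc 0 (N / a), χ b * b := by
  let f : ArithmeticFunction ℝ := ⟨fun a => χ a * μ a, by simp⟩
  let g : ArithmeticFunction ℝ := ⟨fun b => χ b * b, by simp⟩
  have h := ArithmeticFunction.sum_Ioc_mul_eq_sum_sum f g N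
  refine Eq.trans (Finset.sum_congr rfl fun d hd => ?_) h
  rw [totient_eq_sum_moebius (Finset.mem_Ioc.mp hd).1, ArithmeticFunction.mul_apply, Finset.mul_sum]
  refine Finset.sum_congr rfl fun x hx => ?_
  rw [← (Nat.mem_divisorsAntidiagonal.mp hx).1, hχ]
  simp only [f, g, ArithmeticFunction.coe_mk]
  ring

/-- After the Möbius rearrangement the a-th term is χ(a) μ(a) S(⌊N/a⌋)/N², where S is the weighted
sum of b; it tends to κ χ(a) μ(a)/a² and is dominated by 1/a², so limit and sum can be exchanged. -/
theorem tendsto_sum_weight_totient (χ : ℕ → ℝ) (hχ : ∀ a b, χ (a * b) = χ a * χ b)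
    (h0 : ∀ a, 0 ≤ χ a) (h1 : ∀ a, χ a ≤ 1) {κ : ℝ}
    (hκ : Tendsto (fun x : ℕ => (∑ b ∈ Finset.Ioc 0 x, χ b * b) / (x : ℝ) ^ 2) atTop (𝓝 κ)) :
    Tendsto (fun N : ℕ => (∑ d ∈ Finset.Ioc 0 N, χ d * Nat.totient d) / (N : ℝ) ^ 2) atTop
      (𝓝 (κ * ∑' a : ℕ, χ a * (μ a / (a : ℝ) ^ 2))) := by
  set S : ℕ → ℝ := fun x => ∑ b ∈ Finset.Ioc 0 x, χ b * b with hS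
  have hS0 : ∀ x, 0 ≤ S x := fun x => Finset.sum_nonneg fun b _ => mul_nonneg (h0 b) (by positivity)
  have hSle : ∀ x, S x ≤ (x : ℝ) ^ 2 := by
    intro x
    calc S x ≤ ∑ b ∈ Finset.Ioc 0 x, (x : ℝ) := by
          refine Finset.sum_le_sum fun b hb => ?_
          have : (b : ℝ) ≤ x := by exact_mod_cast (Finset.mem_Ioc.mp hb).2
          calc χ b * b ≤ 1 * b := by gcongr; exact h1 b
            _ ≤ x := by linarith
      _ = (x : ℝ) ^ 2 := by simp [sq]
  have key : ∀ N : ℕ, (∑ d ∈ Finset.Ioc 0 N, χ d * Nat.totient d) / (N : ℝ) ^ 2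
      = ∑' a : ℕ, χ a * μ a * S (N / a) / (N : ℝ) ^ 2 := by
    intro N
    rw [sum_weight_totient χ hχ, Finset.sum_div]
    refine (tsum_eq_sum fun a ha => ?_).symm
    rw [Finset.mem_Ioc] at ha
    rcases Nat.eq_zero_or_pos a with rfl | hpos
    · simp
    · have : N / a = 0 := Nat.div_eq_of_lt (by omega)
      simp [this]
  simp_rw [key]
  rw [← tsum_mul_left]
  have hμ : ∀ a : ℕ, |((μ a : ℤ) : ℝ)| ≤ 1 := fun a => by
    exact_mod_cast ArithmeticFunction.abs_moebius_le_one
  refine tendsto_tsum_of_dominated_convergence (bound := fun a : ℕ => 1 / (a : ℝ) ^ 2)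
    (Real.summable_one_div_nat_pow.mpr one_lt_two) (fun a => ?_) ?_
  · rcases Nat.eq_zero_or_pos a with rfl | hpos
    · simp
    have ha : (0 : ℝ) < a := by exact_mod_cast hpos
    have hf : Tendsto (fun N : ℕ => ((N / a : ℕ) : ℝ) / N) atTop (𝓝 (1 / a)) := by
      have := (tendsto_nat_floor_mul_div_atTop (R := ℝ) (a := 1 / a) (by positivity)).comp
        tendsto_natCast_atTop_atTop
      refine this.congr fun N => ?_
      simp only [Function.comp]
      rw [one_div_mul_eq_div, Nat.floor_div_eq_div]
    have hd : Tendsto (fun N : ℕ => N / a) atTop atTop :=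
      Nat.tendsto_div_const_atTop hpos.ne'
    have := ((hκ.comp hd).mul (hf.pow 2)).const_mul (χ a * μ a)
    have e : κ * (χ a * (μ a / (a : ℝ) ^ 2)) = χ a * μ a * (κ * (1 / (a : ℝ)) ^ 2) := by
      field_simp
    rw [e]
    refine this.congr' ?_
    filter_upwards [eventually_ge_atTop a] with N hN
    have h3 : ((N / a : ℕ) : ℝ) ≠ 0 := by
      have : 0 < N / a := Nat.div_pos hN hpos
      positivity
    have h4 : (N : ℝ) ≠ 0 := by
      have : 0 < N := by omega
      positivity
    simp only [Function.comp, hS]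
    field_simp
  · filter_upwards [eventually_gt_atTop 0] with N hN a
    have hN' : (0 : ℝ) < N := by exact_mod_cast hN
    rcases Nat.eq_zero_or_pos a with rfl | hpos
    · simp
    have ha : (0 : ℝ) < a := by exact_mod_cast hpos
    rw [Real.norm_eq_abs, abs_div, abs_mul, abs_mul, abs_of_nonneg (h0 a), abs_of_nonneg (hS0 _),
      abs_of_pos (by positivity : (0 : ℝ) < (N : ℝ) ^ 2), div_le_div_iff₀ (by positivity) (by positivity)]
    have h5 : S (N / a) ≤ ((N : ℝ) / a) ^ 2 := by
      refine (hSle _).trans ?_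
      gcongr
      exact Nat.cast_div_le
    have h6 : χ a * |((μ a : ℤ) : ℝ)| ≤ 1 :=
      mul_le_one₀ (h1 a) (abs_nonneg _) (hμ a)
    calc χ a * |((μ a : ℤ) : ℝ)| * S (N / a) * (a : ℝ) ^ 2 ≤ 1 * ((N : ℝ) / a) ^ 2 * (a : ℝ) ^ 2 := by
          gcongr
          exact hS0 _
      _ = 1 * (N : ℝ) ^ 2 := by field_simp

theorem tsum_moebius_div_sq : ∑' a : ℕ, (μ a : ℝ) / (a : ℝ) ^ 2 = 6 / Real.pi ^ 2 := by
  have h := ArithmeticFunction.LSeries_zeta_mul_Lseries_moebius (s := 2) (by simp)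
  rw [ArithmeticFunction.LSeries_zeta_eq_riemannZeta (by simp), riemannZeta_two] at h
  have h2 : LSeries (fun n => ((μ n : ℤ) : ℂ)) 2
      = ((∑' a : ℕ, (μ a : ℝ) / (a : ℝ) ^ 2 : ℝ) : ℂ) := by
    rw [LSeries, Complex.ofReal_tsum]
    refine tsum_congr fun n => ?_
    rcases Nat.eq_zero_or_pos n with rfl | hn
    · simp
    · rw [LSeries.term_of_ne_zero hn.ne']
      push_cast
      norm_cast
  rw [h2] at h
  have h3 : Real.pi ^ 2 / 6 * ∑' a : ℕ, (μ a : ℝ) / (a : ℝ) ^ 2 = 1 := by exact_mod_cast h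
  have : Real.pi ≠ 0 := Real.pi_ne_zero
  field_simp at h3 ⊢
  linarith

theorem summable_moebius_div_sq : Summable fun a : ℕ => (μ a : ℝ) / (a : ℝ) ^ 2 := by
  refine Summable.of_norm_bounded (Real.summable_one_div_nat_pow.mpr one_lt_two) fun a => ?_
  rw [Real.norm_eq_abs, abs_div, abs_of_nonneg (by positivity : (0 : ℝ) ≤ (a : ℝ) ^ 2)]
  gcongr
  exact_mod_cast ArithmeticFunction.abs_moebius_le_one

/-- The indicator function of the odd numbers. -/
noncomputable def oddWeight (a : ℕ) : ℝ := if Odd a then 1 else 0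

theorem oddWeight_mul (a b : ℕ) : oddWeight (a * b) = oddWeight a * oddWeight b := by
  unfold oddWeight
  by_cases ha : Odd a <;> by_cases hb : Odd b <;> simp [Nat.odd_mul, ha, hb]

/-- Since μ(2k) is -μ(k) for k odd and 0 for k even, the even terms contribute -1/4 of the odd ones.
Hence 3/4 of the odd sum equals 6/π². -/
theorem tsum_oddWeight_moebius_div_sq :
    ∑' a : ℕ, oddWeight a * ((μ a : ℝ) / (a : ℝ) ^ 2) = 8 / Real.pi ^ 2 := by
  set f : ℕ → ℝ := fun a => (μ a : ℝ) / (a : ℝ) ^ 2 with hf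
  have hs : Summable f := summable_moebius_div_sq
  have hse : Summable fun k => f (2 * k) :=
    hs.comp_injective (fun a b h => by simpa using h)
  have hso : Summable fun k => f (2 * k + 1) :=
    hs.comp_injective (fun a b h => by simpa using h)
  have hsplit := tsum_even_add_odd hse hso
  have hso' : Summable fun a => oddWeight a * f a := by
    refine Summable.of_norm_bounded hs.norm fun a => ?_
    rw [norm_mul]
    refine mul_le_of_le_one_left (norm_nonneg _) ?_
    unfold oddWeight; split_ifs <;> simp
  have hX : ∑' a, oddWeight a * f a = ∑' k, f (2 * k + 1) := by
    rw [← tsum_even_add_odd (f := fun a => oddWeight a * f a)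
      (hso'.comp_injective (fun a b h => by simpa using h))
      (hso'.comp_injective (fun a b h => by simpa using h))]
    have h1 : ∀ k, oddWeight (2 * k) * f (2 * k) = 0 := fun k => by simp [oddWeight]
    have h2 : ∀ k, oddWeight (2 * k + 1) * f (2 * k + 1) = f (2 * k + 1) := fun k => by
      simp [oddWeight]
    simp_rw [h1, h2]
    simp
  have he : ∀ k, f (2 * k) = -(1 / 4) * (oddWeight k * f k) := by
    intro k
    simp only [hf, oddWeight]
    by_cases hk : Odd k
    · have hc : Nat.Coprime 2 k := (Nat.coprime_two_left).mpr hk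
      rw [ArithmeticFunction.isMultiplicative_moebius.map_mul_of_coprime hc,
        ArithmeticFunction.moebius_apply_prime Nat.prime_two]
      simp [hk]
      ring
    · have : μ (2 * k) = 0 := by
        apply ArithmeticFunction.moebius_eq_zero_of_not_squarefree
        intro hsq
        obtain ⟨l, hl⟩ := Nat.not_odd_iff_even.mp hk
        have := hsq 2 ⟨l, by rw [hl]; ring⟩
        simp at this
      simp [this, hk]
  simp_rw [he] at hsplit
  rw [tsum_mul_left, ← hX, show (∑' k, f k) = 6 / Real.pi ^ 2 from tsum_moebius_div_sq] at hsplit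
  have : (8 : ℝ) / Real.pi ^ 2 = 4 / 3 * (6 / Real.pi ^ 2) := by ring
  rw [this]
  linarith

theorem sum_Ioc_natCast (x : ℕ) : ∑ b ∈ Finset.Ioc 0 x, (b : ℝ) = x * (x + 1) / 2 := by
  induction x with
  | zero => simp
  | succ x ih =>
    rw [Finset.sum_Ioc_succ_top (by omega), ih]
    push_cast
    ring

theorem tendsto_sum_totient :
    Tendsto (fun N : ℕ => (∑ d ∈ Finset.Ioc 0 N, (Nat.totient d : ℝ)) / (N : ℝ) ^ 2) atTop
      (𝓝 (3 / Real.pi ^ 2)) := by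
  have h := tendsto_sum_weight_totient (fun _ => 1) (by simp) (by simp) (by simp) (κ := 1 / 2) ?_
  · simp only [one_mul] at h
    rw [tsum_moebius_div_sq] at h
    convert h using 2
    ring
  · have h1 : Tendsto (fun x : ℕ => (1 / 2 : ℝ) + 1 / 2 * (1 / (x : ℝ))) atTop
        (𝓝 (1 / 2 + 1 / 2 * 0)) :=
      tendsto_const_nhds.add (tendsto_one_div_atTop_nhds_zero_nat.const_mul _)
    simp only [mul_zero, add_zero] at h1
    refine h1.congr' ?_
    filter_upwards [eventually_gt_atTop 0] with x hx
    have : (x : ℝ) ≠ 0 := by positivity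
    simp only [one_mul]
    rw [sum_Ioc_natCast]
    field_simp

theorem sum_Ioc_oddWeight (x : ℕ) :
    ∑ b ∈ Finset.Ioc 0 x, oddWeight b * b = (((x + 1) / 2 : ℕ) : ℝ) ^ 2 := by
  induction x with
  | zero => simp
  | succ x ih =>
    rw [Finset.sum_Ioc_succ_top (by omega), ih]
    rcases Nat.even_or_odd' x with ⟨k, rfl | rfl⟩
    · rw [show (2 * k + 1) / 2 = k by omega, show (2 * k + 1 + 1) / 2 = k + 1 by omega]
      simp [oddWeight]
      ring
    · rw [show (2 * k + 1 + 1) / 2 = k + 1 by omega, show (2 * k + 1 + 1 + 1) / 2 = k + 1 by omega]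
      have : ¬ Odd (2 * k + 1 + 1) := by
        rw [Nat.not_odd_iff_even]; exact ⟨k + 1, by ring⟩
      simp [oddWeight, this]

theorem tendsto_sum_totient_odd :
    Tendsto (fun N : ℕ => (∑ d ∈ (Finset.Ioc 0 N).filter Odd, (Nat.totient d : ℝ)) / (N : ℝ) ^ 2)
      atTop (𝓝 (2 / Real.pi ^ 2)) := by
  have h := tendsto_sum_weight_totient oddWeight oddWeight_mul
    (fun a => by unfold oddWeight; split_ifs <;> simp)
    (fun a => by unfold oddWeight; split_ifs <;> simp) (κ := 1 / 4) ?_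
  · rw [tsum_oddWeight_moebius_div_sq] at h
    refine (h.congr fun N => ?_).trans_eq (by congr 1; ring)
    rw [Finset.sum_filter]
    congr 1
    refine Finset.sum_congr rfl fun d _ => ?_
    unfold oddWeight; split_ifs <;> simp
  · have hf : Tendsto (fun x : ℕ => (((x + 1) / 2 : ℕ) : ℝ) / x) atTop (𝓝 (1 / 2)) := by
      have h1 : Tendsto (fun x : ℕ => (1 / 2 : ℝ) + 1 / 2 * (1 / (x : ℝ))) atTop
          (𝓝 (1 / 2 + 1 / 2 * 0)) :=
        tendsto_const_nhds.add (tendsto_one_div_atTop_nhds_zero_nat.const_mul _)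
      simp only [mul_zero, add_zero] at h1
      refine tendsto_of_tendsto_of_tendsto_of_le_of_le' tendsto_const_nhds h1 ?_ ?_
      · filter_upwards [eventually_gt_atTop 0] with x hx
        have hx' : (0 : ℝ) < x := by exact_mod_cast hx
        rw [div_le_div_iff₀ (by norm_num) hx']
        have : x ≤ (x + 1) / 2 * 2 := by omega
        have : (x : ℝ) ≤ ((x + 1) / 2 : ℕ) * 2 := by exact_mod_cast this
        linarith
      · filter_upwards [eventually_gt_atTop 0] with x hx
        have hx' : (0 : ℝ) < x := by exact_mod_cast hx
        rw [div_le_iff₀ hx']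
        have : (x + 1) / 2 * 2 ≤ x + 1 := by omega
        have : (((x + 1) / 2 : ℕ) : ℝ) * 2 ≤ x + 1 := by exact_mod_cast this
        field_simp
        linarith
    refine ((hf.pow 2).congr fun x => ?_).trans_eq (by norm_num)
    rw [sum_Ioc_oddWeight, div_pow]

/-! ### Size of cyclotomic values -/

theorem abs_log_one_sub_le {u : ℝ} (hu : |u| ≤ 1 / 2) : |(Real.log |1 - u|)| ≤ 2 * |u| := by
  have h := abs_le.mp hu
  have hpos : 0 < 1 - u := by linarith
  rw [abs_of_pos hpos]
  have h1 := Real.one_sub_inv_le_log_of_pos hpos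
  have h2 := Real.log_le_sub_one_of_pos hpos
  have h3 : 1 - (1 - u)⁻¹ = -u / (1 - u) := by field_simp; ring
  have h4 : -(2 * |u|) ≤ -u / (1 - u) := by
    rw [le_div_iff₀ hpos]
    nlinarith [le_abs_self u, neg_abs_le u, abs_nonneg u]
  rw [abs_le]
  constructor
  · linarith
  · linarith [neg_abs_le u, abs_nonneg u]

theorem two_le_abs_cast {m : ℤ} (hm : 2 ≤ |m|) : (2 : ℝ) ≤ |(m : ℝ)| := by exact_mod_cast hm

theorem cast_ne_zero_of_two_le_abs {m : ℤ} (hm : 2 ≤ |m|) : (m : ℝ) ≠ 0 := by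
  have := two_le_abs_cast hm
  intro h
  simp [h] at this
  linarith

theorem abs_inv_pow_le {m : ℤ} (hm : 2 ≤ |m|) (e : ℕ) : |((m : ℝ)⁻¹) ^ e| ≤ (1 / 2) ^ e := by
  rw [abs_pow, abs_inv]
  have := two_le_abs_cast hm
  gcongr
  rw [one_div]
  gcongr

theorem pow_sub_one_ne_zero {m : ℤ} (hm : 2 ≤ |m|) {e : ℕ} (he : e ≠ 0) : m ^ e - 1 ≠ 0 := by
  intro h
  have h1 : |m| ^ e = 1 := by rw [← abs_pow, sub_eq_zero.mp h, abs_one]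
  have h2 : |m| ≤ |m| ^ e := le_self_pow₀ (by linarith) he
  linarith

theorem abs_log_pow_sub_one_sub_le {m : ℤ} (hm : 2 ≤ |m|) {e : ℕ} (he : e ≠ 0) :
    |Real.log |((m ^ e - 1 : ℤ) : ℝ)| - e * (Real.log |(m : ℝ)|)| ≤ 2 * (1 / 2) ^ e := by
  have hm0 := cast_ne_zero_of_two_le_abs hm
  have hu := abs_inv_pow_le hm e
  have hu2 : |((m : ℝ)⁻¹) ^ e| ≤ 1 / 2 :=
    hu.trans (pow_le_of_le_one (by norm_num) (by norm_num) he)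
  have h := abs_log_one_sub_le hu2
  have hne : 1 - ((m : ℝ)⁻¹) ^ e ≠ 0 := by
    have := (abs_le.mp hu2).2
    intro h; linarith
  have e1 : ((m ^ e - 1 : ℤ) : ℝ) = (m : ℝ) ^ e * (1 - ((m : ℝ)⁻¹) ^ e) := by
    push_cast
    rw [mul_sub, ← mul_pow, mul_inv_cancel₀ hm0]
    simp
  rw [e1, abs_mul, Real.log_mul (by positivity) (abs_ne_zero.mpr hne), abs_pow, Real.log_pow,
    add_sub_cancel_left]
  linarith

theorem prod_cyclotomic_eval {a : ℕ} (ha : 0 < a) (m : ℤ) :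
    ∏ d ∈ a.divisors, (Polynomial.cyclotomic d ℤ).eval m = m ^ a - 1 := by
  rw [← Polynomial.eval_prod, Polynomial.prod_cyclotomic_eq_X_pow_sub_one ha]
  simp

theorem cyclotomic_eval_ne_zero {m : ℤ} (hm : 2 ≤ |m|) {d : ℕ} (hd : 0 < d) :
    (Polynomial.cyclotomic d ℤ).eval m ≠ 0 := by
  intro h
  have h1 := prod_cyclotomic_eval hd m
  rw [Finset.prod_eq_zero (Nat.mem_divisors_self d hd.ne') h] at h1
  exact pow_sub_one_ne_zero hm hd.ne' h1.symm

/-- Möbius inversion of log|m^a - 1| = ∑ log|Φ_d(m)| over d ∣ a: each divisor e contributes an error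
at most 2·2^(-e), and these errors sum to at most 2 independently of d. -/
theorem abs_log_cyclotomic_sub_le {m : ℤ} (hm : 2 ≤ |m|) {d : ℕ} (hd : 0 < d) :
    |Real.log |(((Polynomial.cyclotomic d ℤ).eval m : ℤ) : ℝ)|
      - Nat.totient d * (Real.log |(m : ℝ)|)| ≤ 2 := by
  have h : ∀ a : ℕ, a > 0 → ∑ d ∈ a.divisors,
      Real.log |(((Polynomial.cyclotomic d ℤ).eval m : ℤ) : ℝ)|
        = Real.log |((m ^ a - 1 : ℤ) : ℝ)| := by
    intro a ha
    rw [← prod_cyclotomic_eval ha, Int.cast_prod, Finset.abs_prod, Real.log_prod]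
    intro d hd
    rw [abs_ne_zero, Int.cast_ne_zero]
    exact cyclotomic_eval_ne_zero hm (Nat.pos_of_mem_divisors hd)
  rw [← (ArithmeticFunction.sum_eq_iff_sum_mul_moebius_eq.mp h) d hd,
    totient_eq_sum_moebius hd, Finset.sum_mul, ← Finset.sum_sub_distrib]
  calc _ ≤ ∑ x ∈ d.divisorsAntidiagonal, 2 * (1 / 2 : ℝ) ^ x.2 := by
        refine (Finset.abs_sum_le_sum_abs _ _).trans (Finset.sum_le_sum fun x hx => ?_)
        have hx2 : x.2 ≠ 0 := by
          intro h0
          have := (Nat.mem_divisorsAntidiagonal.mp hx).1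
          rw [h0] at this; omega
        rw [mul_assoc, ← mul_sub, abs_mul]
        have hμ : |((μ x.1 : ℤ) : ℝ)| ≤ 1 := by
          exact_mod_cast ArithmeticFunction.abs_moebius_le_one
        calc _ ≤ 1 * (2 * (1 / 2 : ℝ) ^ x.2) := by
              gcongr
              exact abs_log_pow_sub_one_sub_le hm hx2
          _ = _ := one_mul _
    _ = ∑ e ∈ d.divisors, 2 * (1 / 2 : ℝ) ^ e := by
        rw [← Nat.sum_divisorsAntidiagonal' (f := fun _ e => 2 * (1 / 2 : ℝ) ^ e)]
    _ ≤ ∑ e ∈ (Finset.range d).image (· + 1), 2 * (1 / 2 : ℝ) ^ e := by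
        apply Finset.sum_le_sum_of_subset_of_nonneg
        · intro e he
          have h1 := Nat.pos_of_mem_divisors he
          have h2 := Nat.divisor_le he
          exact Finset.mem_image.mpr ⟨e - 1, Finset.mem_range.mpr (by omega), by omega⟩
        · intros; positivity
    _ = ∑ e ∈ Finset.range d, (1 / 2 : ℝ) ^ e := by
        rw [Finset.sum_image (by intro a _ b _ h; simpa using h)]
        refine Finset.sum_congr rfl fun e _ => by rw [pow_succ]; ring
    _ ≤ 2 := by
        have := summable_geometric_two.sum_le_tsum (Finset.range d) (fun _ _ => by positivity)
        rw [tsum_geometric_two] at this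
        exact this

/-- If each `f d` is within a bounded distance of `g d`, then their sums over a subset of `[1, N]`
have the same quadratic growth. -/
theorem tendsto_sum_div_sq_of_abs_sub_le (f g : ℕ → ℝ) (s : ℕ → Finset ℕ)
    (hs : ∀ N, s N ⊆ Finset.Ioc 0 N) {C l : ℝ} (hfg : ∀ d, 0 < d → |f d - g d| ≤ C)
    (hg : Tendsto (fun N : ℕ => (∑ d ∈ s N, g d) / (N : ℝ) ^ 2) atTop (𝓝 l)) :
    Tendsto (fun N : ℕ => (∑ d ∈ s N, f d) / (N : ℝ) ^ 2) atTop (𝓝 l) := by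
  have h0 : Tendsto (fun N : ℕ => C * (1 / (N : ℝ))) atTop (𝓝 (C * 0)) :=
    tendsto_one_div_atTop_nhds_zero_nat.const_mul _
  rw [mul_zero] at h0
  have h1 : Tendsto (fun N : ℕ => (∑ d ∈ s N, f d) / (N : ℝ) ^ 2
      - (∑ d ∈ s N, g d) / (N : ℝ) ^ 2) atTop (𝓝 0) := by
    refine squeeze_zero_norm' ?_ h0
    filter_upwards [eventually_gt_atTop 0] with N hN
    have hN' : (0 : ℝ) < N := by exact_mod_cast hN
    have hC : 0 ≤ C := (abs_nonneg _).trans (hfg 1 one_pos)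
    rw [← sub_div, ← Finset.sum_sub_distrib, Real.norm_eq_abs, abs_div,
      abs_of_pos (by positivity : (0 : ℝ) < (N : ℝ) ^ 2), div_le_iff₀ (by positivity)]
    calc _ ≤ ∑ d ∈ s N, |f d - g d| := Finset.abs_sum_le_sum_abs _ _
      _ ≤ ∑ d ∈ Finset.Ioc 0 N, |f d - g d| :=
          Finset.sum_le_sum_of_subset_of_nonneg (hs N) fun _ _ _ => abs_nonneg _
      _ ≤ ∑ d ∈ Finset.Ioc 0 N, C :=
          Finset.sum_le_sum fun d hd => hfg d (Finset.mem_Ioc.mp hd).1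
      _ = C * (1 / N) * (N : ℝ) ^ 2 := by
          simp
          field_simp
  have := h1.add hg
  simpa using this

theorem tendsto_log_prod_cyclotomic {m : ℤ} (hm : 2 ≤ |m|) (s : ℕ → Finset ℕ)
    (hs : ∀ N, s N ⊆ Finset.Ioc 0 N) {l : ℝ}
    (hl : Tendsto (fun N : ℕ => (∑ d ∈ s N, (Nat.totient d : ℝ)) / (N : ℝ) ^ 2) atTop (𝓝 l)) :
    Tendsto (fun N : ℕ => Real.log
      |((∏ d ∈ s N, (Polynomial.cyclotomic d ℤ).eval m : ℤ) : ℝ)| / (N : ℝ) ^ 2) atTop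
      (𝓝 (l * Real.log |(m : ℝ)|)) := by
  have h := tendsto_sum_div_sq_of_abs_sub_le
    (fun d => Real.log |(((Polynomial.cyclotomic d ℤ).eval m : ℤ) : ℝ)|)
    (fun d => Nat.totient d * Real.log |(m : ℝ)|) s hs (C := 2)
    (fun d hd => abs_log_cyclotomic_sub_le hm hd) (l := l * Real.log |(m : ℝ)|) ?_
  · refine h.congr fun N => ?_
    rw [Int.cast_prod, Finset.abs_prod, Real.log_prod]
    intro d hd
    rw [abs_ne_zero, Int.cast_ne_zero]
    exact cyclotomic_eval_ne_zero hm (Finset.mem_Ioc.mp (hs N hd)).1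
  · refine (hl.mul_const _).congr fun N => ?_
    rw [← Finset.sum_mul, div_mul_eq_mul_div]

/-! ### Products of cyclotomic values and their divisibility -/

/-- The value at `m` of the `d`-th cyclotomic polynomial. -/
noncomputable def cyc (m : ℤ) (d : ℕ) : ℤ := (Polynomial.cyclotomic d ℤ).eval m

/-- The product of the `cyc m d` with `d ≤ 2 n`. -/
noncomputable def cycProd (m : ℤ) (n : ℕ) : ℤ := ∏ d ∈ Finset.Ioc 0 (2 * n), cyc m d

/-- The product of the `cyc m d` with `d ≤ 2 n` odd. -/
noncomputable def cycProdOdd (m : ℤ) (n : ℕ) : ℤ := ∏ d ∈ (Finset.Ioc 0 (2 * n)).filter Odd, cyc m d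

/-- The product of the `m ^ i - 1` with `i ≤ 2 n` even and positive. -/
def evenProd (m : ℤ) (n : ℕ) : ℤ := ∏ i ∈ Finset.range n, (m ^ (2 * i + 2) - 1)

/-- The part of `evenProd m n` made of the `cyc m d` with `d` odd. -/
noncomputable def oddPartProd (m : ℤ) (n : ℕ) : ℤ :=
  ∏ d ∈ (Finset.Ioc 0 n).filter Odd, cyc m d ^ (n / d)

theorem pow_sub_one_dvd_cycProd (m : ℤ) {a n : ℕ} (ha : 0 < a) (han : a ≤ 2 * n) :
    m ^ a - 1 ∣ cycProd m n := by
  rw [← prod_cyclotomic_eval ha]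
  apply Finset.prod_dvd_prod_of_subset
  intro d hd
  have h1 := Nat.pos_of_mem_divisors hd
  have h2 := Nat.divisor_le hd
  exact Finset.mem_Ioc.mpr ⟨h1, h2.trans han⟩

theorem pow_sub_one_dvd_cycProdOdd (m : ℤ) {a n : ℕ} (ha : Odd a) (han : a ≤ 2 * n) :
    m ^ a - 1 ∣ cycProdOdd m n := by
  rw [← prod_cyclotomic_eval ha.pos]
  apply Finset.prod_dvd_prod_of_subset
  intro d hd
  have h1 := Nat.pos_of_mem_divisors hd
  have h2 := Nat.divisor_le hd
  rw [Finset.mem_filter]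
  exact ⟨Finset.mem_Ioc.mpr ⟨h1, h2.trans han⟩, Odd.of_dvd_nat ha (Nat.dvd_of_mem_divisors hd)⟩

theorem cycProdOdd_dvd_cycProd (m : ℤ) (n : ℕ) : cycProdOdd m n ∣ cycProd m n :=
  Finset.prod_dvd_prod_of_subset _ _ _ (Finset.filter_subset _ _)

/-- Integrality of Gaussian binomials, by the q-Pascal rule: the last factor x^(a+b) - 1 is (x^a -
1) + x^a (x^b - 1). -/
theorem prod_pow_sub_one_mul_dvd {R : Type*} [CommRing R] (x : R) (a b : ℕ) :
    (∏ i ∈ Finset.range a, (x ^ (i + 1) - 1)) * ∏ i ∈ Finset.range b, (x ^ (i + 1) - 1) ∣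
      ∏ i ∈ Finset.range (a + b), (x ^ (i + 1) - 1) := by
  induction h : a + b generalizing a b with
  | zero =>
    obtain ⟨rfl, rfl⟩ : a = 0 ∧ b = 0 := by omega
    simp
  | succ c ih =>
    rcases a with _ | a
    · obtain rfl : b = c + 1 := by omega
      simp
    rcases b with _ | b
    · obtain rfl : a = c := by omega
      simp
    obtain rfl : c = a + b + 1 := by omega
    have h1 := ih a (b + 1) (by ring)
    have h2 := ih (a + 1) b (by ring)
    rw [Finset.prod_range_succ _ (a + b + 1)]
    have e : x ^ (a + b + 1 + 1) - 1 = (x ^ (a + 1) - 1) + (x ^ (b + 1) - 1) * x ^ (a + 1) := by ring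
    rw [e, mul_add]
    apply dvd_add
    · rw [Finset.prod_range_succ _ a, mul_right_comm]
      exact mul_dvd_mul_right h1 _
    · rw [Finset.prod_range_succ _ b, ← mul_assoc, ← mul_assoc]
      exact (mul_dvd_mul_right h2 _).mul_right _

theorem evenProd_mul_dvd (m : ℤ) {j n : ℕ} (hj : j ≤ n) :
    evenProd m j * evenProd m (n - j) ∣ evenProd m n := by
  have h := prod_pow_sub_one_mul_dvd (m ^ 2) j (n - j)
  rw [Nat.add_sub_cancel' hj] at h
  have e : ∀ i : ℕ, (m ^ 2) ^ (i + 1) - 1 = m ^ (2 * i + 2) - 1 := fun i => by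
    rw [← pow_mul]; ring
  simp only [e] at h
  exact h

/-- The part of `m ^ a - 1` made of the `cyc m d` with `d ≤ n` odd. -/
noncomputable def smallPart (m : ℤ) (n a : ℕ) : ℤ :=
  ∏ d ∈ ((Finset.Ioc 0 n).filter Odd).filter (· ∣ a), cyc m d

theorem smallPart_dvd_pow_sub_one (m : ℤ) (n : ℕ) {a : ℕ} (ha : 0 < a) :
    smallPart m n a ∣ m ^ a - 1 := by
  rw [← prod_cyclotomic_eval ha]
  apply Finset.prod_dvd_prod_of_subset
  intro d hd
  exact Nat.mem_divisors.mpr ⟨(Finset.mem_filter.mp hd).2, ha.ne'⟩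

theorem smallPart_dvd_cycProd (m : ℤ) (n a : ℕ) : smallPart m n a ∣ cycProd m n := by
  apply Finset.prod_dvd_prod_of_subset
  intro d hd
  have := Finset.mem_Ioc.mp (Finset.mem_filter.mp (Finset.mem_filter.mp hd).1).1
  exact Finset.mem_Ioc.mpr ⟨this.1, by omega⟩

/-- As d is odd, 2 is invertible modulo d, so the solutions i contain a full residue class, which
meets every window of d consecutive integers. -/
theorem div_le_card_filter_dvd {d : ℕ} (hd : Odd d) (L c : ℕ) :
    L / d ≤ ((Finset.range L).filter fun i => d ∣ 2 * i + c).card := by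
  obtain ⟨v, hv⟩ : ∃ v, d ∣ 2 * v + c := by
    obtain ⟨k, rfl⟩ := hd
    refine ⟨k * c, c, by ring⟩
  have hpos := hd.pos
  rw [← Finset.card_range (L / d)]
  refine Finset.card_le_card_of_injOn (fun k => v % d + d * k) ?_ ?_
  · intro k hk
    have hk' : k < L / d := Finset.mem_range.mp hk
    simp only [Finset.coe_filter, Finset.mem_range, Set.mem_ofPred_eq]
    constructor
    · calc v % d + d * k < d + d * k := by
            have := Nat.mod_lt v hpos; omega
        _ = d * (k + 1) := by ring
        _ ≤ d * (L / d) := Nat.mul_le_mul_left _ hk'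
        _ ≤ L := Nat.mul_div_le L d
    · have h1 : d ∣ 2 * (v % d) + c := by
        have e : 2 * v + c = 2 * (v % d) + c + d * (2 * (v / d)) := by
          have := Nat.mod_add_div v d
          nlinarith
        rw [e] at hv
        exact (Nat.dvd_add_left (Dvd.intro _ rfl)).mp hv
      have e : 2 * (v % d + d * k) + c = 2 * (v % d) + c + d * (2 * k) := by ring
      rw [e]
      exact dvd_add h1 (Dvd.intro _ rfl)
  · intro k _ k' _ h
    have : d * k = d * k' := by simpa using h
    exact Nat.eq_of_mul_eq_mul_left hpos this

/-- Compare the exponents of each `cyc m d`: among rn consecutive terms of an arithmetic progression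
of difference 2, at least ⌊rn/d⌋ ≥ r⌊n/d⌋ are divisible by d. This is the divisor gained from the
numerator of `formFun`. -/
theorem oddPartProd_pow_dvd (m : ℤ) (n r c : ℕ) :
    oddPartProd m n ^ r ∣ ∏ i ∈ Finset.range (r * n), smallPart m n (2 * i + c) := by
  have e : ∏ i ∈ Finset.range (r * n), smallPart m n (2 * i + c)
      = ∏ d ∈ (Finset.Ioc 0 n).filter Odd,
          cyc m d ^ ((Finset.range (r * n)).filter fun i => d ∣ 2 * i + c).card := by
    simp only [smallPart, Finset.prod_filter (p := fun d => d ∣ _)]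
    rw [Finset.prod_comm]
    refine Finset.prod_congr rfl fun d _ => ?_
    rw [← Finset.prod_filter, Finset.prod_const]
  rw [e, oddPartProd, ← Finset.prod_pow]
  refine Finset.prod_dvd_prod_of_dvd _ _ fun d hd => ?_
  rw [← pow_mul]
  apply pow_dvd_pow
  have hd' := (Finset.mem_filter.mp hd).2
  refine le_trans ?_ (div_le_card_filter_dvd hd' (r * n) c)
  rw [mul_comm]
  exact Nat.mul_div_le_mul_div_assoc _ _ _

/-- An odd d divides j exactly when it divides the odd part of j. In this form the growth is read
off from the sum of the odd parts. -/
theorem oddPartProd_eq (m : ℤ) (n : ℕ) :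
    oddPartProd m n = ∏ j ∈ Finset.Ioc 0 n, (m ^ (ordCompl[2] j) - 1) := by
  have e : ∀ j ∈ Finset.Ioc 0 n, m ^ (ordCompl[2] j) - 1
      = ∏ d ∈ ((Finset.Ioc 0 n).filter Odd).filter (· ∣ j), cyc m d := by
    intro j hj
    have hj' := Finset.mem_Ioc.mp hj
    rw [← prod_cyclotomic_eval (Nat.ordCompl_pos 2 hj'.1.ne')]
    refine Finset.prod_congr ?_ fun _ _ => rfl
    ext d
    have hodd : Odd (ordCompl[2] j) := by
      rw [← Nat.coprime_two_left]
      exact Nat.coprime_ordCompl Nat.prime_two hj'.1.ne'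
    simp only [Nat.mem_divisors, Finset.mem_filter, Finset.mem_Ioc]
    constructor
    · rintro ⟨h1, h2⟩
      have h3 : d ∣ j := h1.trans (Nat.ordCompl_dvd j 2)
      exact ⟨⟨⟨Nat.pos_of_dvd_of_pos h3 hj'.1, (Nat.le_of_dvd hj'.1 h3).trans hj'.2⟩,
        Odd.of_dvd_nat hodd h1⟩, h3⟩
    · rintro ⟨⟨-, h2⟩, h3⟩
      refine ⟨?_, hodd.pos.ne'⟩
      have hc : Nat.Coprime d (ordProj[2] j) :=
        Nat.Coprime.pow_right _ (Nat.coprime_two_right.mpr h2)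
      rw [← Nat.ordProj_mul_ordCompl_eq_self j 2] at h3
      exact hc.dvd_of_dvd_mul_left h3
  rw [Finset.prod_congr rfl e]
  simp only [Finset.prod_filter (p := fun d => d ∣ _)]
  rw [Finset.prod_comm, oddPartProd]
  refine Finset.prod_congr rfl fun d _ => ?_
  rw [← Finset.prod_filter, Finset.prod_const, Nat.Ioc_filter_dvd_card_eq_div]

theorem ordCompl_two_mul (j : ℕ) : ordCompl[2] (2 * j) = ordCompl[2] j := by
  have := Nat.ordCompl_mul 2 j 2
  rw [this]
  simp [Nat.Prime.factorization_self Nat.prime_two]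

theorem ordCompl_two_of_odd {j : ℕ} (hj : Odd j) : ordCompl[2] j = j := by
  have h : ¬ 2 ∣ j := by
    rw [Nat.two_dvd_ne_zero]
    exact Nat.odd_iff.mp hj
  rw [Nat.factorization_eq_zero_of_not_dvd h]
  simp

/-- Halving an even index does not change its odd part, and the k odd indices add up to k². -/
theorem sum_ordCompl_two_mul (k : ℕ) :
    ∑ j ∈ Finset.Ioc 0 (2 * k), ordCompl[2] j = ∑ j ∈ Finset.Ioc 0 k, ordCompl[2] j + k ^ 2 := by
  induction k with
  | zero => simp
  | succ k ih =>
    rw [show 2 * (k + 1) = 2 * k + 1 + 1 by ring, Finset.sum_Ioc_succ_top (by omega),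
      Finset.sum_Ioc_succ_top (by omega), ih, Finset.sum_Ioc_succ_top (by omega),
      ordCompl_two_of_odd ⟨k, rfl⟩, show 2 * k + 1 + 1 = 2 * (k + 1) by ring,
      ordCompl_two_mul]
    ring

/-- The recursion S(2k) = S(k) + k² has the solution n²/3 up to a linear term. -/
theorem sum_ordCompl_two_bounds (n : ℕ) :
    n ^ 2 ≤ 3 * ∑ j ∈ Finset.Ioc 0 n, ordCompl[2] j ∧
      3 * ∑ j ∈ Finset.Ioc 0 n, ordCompl[2] j ≤ n ^ 2 + 3 * n := by
  induction n using Nat.strong_induction_on with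
  | _ n ih =>
    rcases Nat.even_or_odd' n with ⟨k, rfl | rfl⟩
    · rcases Nat.eq_zero_or_pos k with rfl | hk
      · simp
      · have := ih k (by omega)
        rw [sum_ordCompl_two_mul]
        constructor <;> nlinarith
    · have := ih k (by omega)
      rw [Finset.sum_Ioc_succ_top (by omega), sum_ordCompl_two_mul, ordCompl_two_of_odd ⟨k, rfl⟩]
      constructor <;> nlinarith

/-! ### Partial fractions from local expansions -/

open Polynomial in
/-- The partial fraction expansion of a proper rational function all of whose poles have order at
most `A`, with coefficients read off from the local expansions at the poles. -/
theorem partial_fractions {K : Type*} [Field K] {A n : ℕ} (hA : 0 < A) (a : ℕ → K)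
    (ha : Set.InjOn a (Finset.range (n + 1))) (ha0 : ∀ j ∈ Finset.range (n + 1), a j ≠ 0)
    (Num : K[X]) (hdeg : Num.natDegree < A * (n + 1)) (g : ℕ → PowerSeries K)
    (hg : ∀ j ∈ Finset.range (n + 1), ((Num.comp (C (a j) * (1 - X)) : K[X]) : PowerSeries K)
      = g j * ((C (a j ^ A) * ∏ i ∈ (Finset.range (n + 1)).erase j,
          (C (a i) - C (a j) * (1 - X)) ^ A : K[X]) : PowerSeries K))
    (x : K) (hx : ∀ j ∈ Finset.range (n + 1), x ≠ a j) :
    Num.eval x / ∏ j ∈ Finset.range (n + 1), (a j - x) ^ A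
      = ∑ j ∈ Finset.range (n + 1), ∑ k ∈ Finset.range A,
          PowerSeries.coeff k (g j) * (1 / (1 - x / a j)) ^ (A - k) := by
  set s := Finset.range (n + 1) with hs
  let τ : ℕ → K[X] := fun j => 1 - C (a j)⁻¹ * X
  let G : ℕ → K[X] := fun j => PowerSeries.trunc A (g j)
  let B : ℕ → K[X] := fun j => ∏ i ∈ s.erase j, (C (a i) - X) ^ A
  have hτ : ∀ j ∈ s, C (a j) * (1 - τ j) = X := by
    intro j hj
    simp only [τ]
    rw [sub_sub_cancel, ← mul_assoc, ← C_mul, mul_inv_cancel₀ (ha0 j hj)]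
    simp
  have hτ2 : ∀ j ∈ s, X - C (a j) = C (-(a j)) * τ j := by
    intro j hj
    simp only [τ]
    rw [mul_sub, ← mul_assoc, ← C_mul, neg_mul, mul_inv_cancel₀ (ha0 j hj)]
    simp
    ring
  have hGdeg : ∀ j, (G j).natDegree < A := by
    intro j
    obtain ⟨A', rfl⟩ := Nat.exists_eq_succ_of_ne_zero hA.ne'
    exact PowerSeries.natDegree_trunc_lt (g j) A'
  have hlocal : ∀ j ∈ s, (X - C (a j)) ^ A ∣ Num - (G j).comp (τ j) * (C (a j ^ A) * B j) := by
    intro j hj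
    let Q : K[X] := C (a j ^ A) * ∏ i ∈ s.erase j, (C (a i) - C (a j) * (1 - X)) ^ A
    -- In the local parameter t, the numerator and the truncation of g_j times the remaining
    -- denominator agree modulo t^A; substituting t = 1 - x/a_j gives the same congruence at the
    -- pole.
    have h1 : X ^ A ∣ Num.comp (C (a j) * (1 - X)) - G j * Q := by
      rw [X_pow_dvd_iff]
      intro d hd
      have h2 : ((Num.comp (C (a j) * (1 - X)) - G j * Q : K[X]) : PowerSeries K)
          = (g j - (G j : PowerSeries K)) * (Q : PowerSeries K) := by
        rw [coe_sub, hg j hj, coe_mul (G j), sub_mul]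
      rw [← coeff_coe, h2, PowerSeries.coeff_mul]
      refine Finset.sum_eq_zero fun y hy => ?_
      have hy' : y.1 < A := by
        have := Finset.HasAntidiagonal.mem_antidiagonal.mp hy; omega
      rw [map_sub, coeff_coe, PowerSeries.coeff_trunc, if_pos hy']
      simp
    have h3 : (Num.comp (C (a j) * (1 - X)) - G j * Q).comp (τ j)
        = Num - (G j).comp (τ j) * (C (a j ^ A) * B j) := by
      have e : (C (a j) * (1 - X) : K[X]).comp (τ j) = X := by
        simp only [mul_comp, C_comp, sub_comp, one_comp, X_comp]
        exact hτ j hj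
      rw [sub_comp, comp_assoc, e, comp_X, mul_comp]
      congr 2
      simp only [Q, B, mul_comp, C_comp, prod_comp, pow_comp, sub_comp, one_comp, X_comp, hτ j hj]
    rw [← h3]
    obtain ⟨W, hW⟩ := h1
    rw [hW, mul_comp, pow_comp, X_comp, hτ2 j hj, mul_pow]
    refine Dvd.dvd.mul_right ?_ _
    rw [← C_pow]
    have hu : IsUnit (C ((-(a j)) ^ A) : K[X]) := by
      rw [isUnit_C]
      exact (isUnit_iff_ne_zero.mpr (neg_ne_zero.mpr (ha0 j hj))).pow A
    exact (hu.mul_left_dvd).mpr dvd_rfl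
  set F : K[X] := Num - ∑ j ∈ s, (G j).comp (τ j) * (C (a j ^ A) * B j) with hF
  have hdvd : ∀ j ∈ s, (X - C (a j)) ^ A ∣ F := by
    intro j hj
    rw [hF, ← Finset.add_sum_erase s _ hj, ← sub_sub]
    refine dvd_sub (hlocal j hj) (Finset.dvd_sum fun i hi => ?_)
    refine Dvd.dvd.mul_left (Dvd.dvd.mul_left ?_ _) _
    have hji : j ∈ s.erase i :=
      Finset.mem_erase.mpr ⟨(Finset.ne_of_mem_erase hi).symm, hj⟩
    refine dvd_trans ?_ (Finset.dvd_prod_of_mem _ hji)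
    apply pow_dvd_pow_of_dvd
    exact ⟨-1, by ring⟩
  have hprod : ∏ j ∈ s, (X - C (a j)) ^ A ∣ F := by
    refine Finset.prod_dvd_of_coprime (fun i hi j hj hij => ?_) hdvd
    refine IsCoprime.pow ?_
    apply isCoprime_X_sub_C_of_isUnit_sub
    rw [isUnit_iff_ne_zero, sub_ne_zero]
    exact fun h => hij (ha hi hj h)
  have hBdeg : ∀ j ∈ s, (B j).natDegree ≤ A * n := by
    intro j hj
    refine (natDegree_prod_le _ _).trans ?_
    refine (Finset.sum_le_card_nsmul _ _ A fun i _ => ?_).trans ?_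
    · refine natDegree_pow_le.trans ?_
      have : (C (a i) - X : K[X]).natDegree ≤ 1 := by
        refine (natDegree_sub_le _ _).trans ?_
        simp
      nlinarith
    · rw [Finset.card_erase_of_mem hj, hs, Finset.card_range]
      simp [mul_comm]
  -- The difference between the numerator and the candidate expansion over a common denominator is
  -- divisible by a product of degree A(n+1), but has smaller degree.
  have hF0 : F = 0 := by
    apply eq_zero_of_dvd_of_natDegree_lt hprod
    have hd1 : (∏ j ∈ s, (X - C (a j)) ^ A).natDegree = A * (n + 1) := by
      rw [natDegree_prod_of_monic _ _ fun j _ => (monic_X_sub_C _).pow A]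
      simp [hs, mul_comm]
    rw [hd1]
    have hd2 : F.natDegree ≤ A * (n + 1) - 1 := by
      rw [hF]
      refine (natDegree_sub_le _ _).trans (max_le (by omega) ?_)
      refine natDegree_sum_le_of_forall_le _ _ fun j hj => ?_
      refine natDegree_mul_le.trans ?_
      have h4 : ((G j).comp (τ j)).natDegree ≤ A - 1 := by
        refine natDegree_comp_le.trans ?_
        have h5 : (G j).natDegree < A := hGdeg j
        have h6 : (τ j).natDegree ≤ 1 := by
          simp only [τ]
          refine (natDegree_sub_le _ _).trans ?_
          simp only [natDegree_one, zero_le, sup_of_le_right]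
          exact (natDegree_C_mul_le _ _).trans natDegree_X_le
        calc _ ≤ (G j).natDegree * 1 := Nat.mul_le_mul_left _ h6
          _ ≤ A - 1 := by omega
      have h7 : (C (a j ^ A) * B j).natDegree ≤ A * n :=
        (natDegree_C_mul_le _ _).trans (hBdeg j hj)
      rw [mul_add, mul_one]
      omega
    have : 0 < A * (n + 1) := by positivity
    omega
  have hNum : Num = ∑ j ∈ s, (G j).comp (τ j) * (C (a j ^ A) * B j) := sub_eq_zero.mp hF0
  have hxj : ∀ j ∈ s, a j - x ≠ 0 := fun j hj => sub_ne_zero.mpr (hx j hj).symm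
  have hτe : ∀ j ∈ s, a j * (1 - x / a j) = a j - x := by
    intro j hj
    have := ha0 j hj
    field_simp
  conv_lhs => rw [hNum]
  rw [eval_finsetSum, Finset.sum_div]
  refine Finset.sum_congr rfl fun j hj => ?_
  have hne : 1 - x / a j ≠ 0 := by
    intro h
    have := hτe j hj
    rw [h, mul_zero] at this
    exact hxj j hj this.symm
  have hBne : (B j).eval x ≠ 0 := by
    simp only [B, eval_prod, eval_pow, eval_sub, eval_C, eval_X]
    exact Finset.prod_ne_zero_iff.mpr fun i hi => pow_ne_zero _ (hxj i (Finset.mem_of_mem_erase hi))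
  have hden : ∏ j ∈ s, (a j - x) ^ A = (a j * (1 - x / a j)) ^ A * (B j).eval x := by
    rw [← Finset.mul_prod_erase s _ hj, hτe j hj]
    simp [B, eval_prod]
  have hGe : ((G j).comp (τ j)).eval x
      = ∑ k ∈ Finset.range A, PowerSeries.coeff k (g j) * (1 - x / a j) ^ k := by
    rw [eval_comp, eval_eq_sum_range' (hGdeg j)]
    refine Finset.sum_congr rfl fun k hk => ?_
    simp only [G, τ]
    rw [PowerSeries.coeff_trunc, if_pos (Finset.mem_range.mp hk)]
    congr 2
    simp
    ring
  rw [hden, eval_mul, eval_mul, eval_C, hGe, mul_pow,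
    show ∀ u v w z : K, u * (v * w) / (v * z * w) = u * (v * w) / (z * (v * w)) from
      fun u v w z => by ring_nf,
    mul_div_mul_right _ _ (mul_ne_zero (pow_ne_zero _ (ha0 j hj)) hBne), Finset.sum_div]
  refine Finset.sum_congr rfl fun k hk => ?_
  have hkA := Finset.mem_range.mp hk
  rw [one_div, inv_pow, mul_div_assoc]
  congr 1
  rw [div_eq_iff (pow_ne_zero _ hne), eq_comm, inv_mul_eq_iff_eq_mul₀ (pow_ne_zero _ hne),
    ← pow_add]
  congr 1
  omega

/-! ### The well-poised rational function and its local expansions -/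

/-- The order `A = 2 (r + b) + 1` of the poles. -/
def poleOrder (r b : ℕ) : ℕ := 2 * (r + b) + 1

/-- The order of vanishing at the origin of the rational function below. -/
def zeroOrder (r b N : ℕ) : ℕ := (2 * b + 1) * N + r + b

/-- Balance of degrees: the degree of `formNum` plus its order at 0 equals the degree of the
denominator. Thus `formFun` vanishes to the same order at 0 and at infinity, as its symmetry
requires. -/
theorem two_mul_zeroOrder (r b N : ℕ) :
    2 * zeroOrder r b N + 2 * (r * (2 * N)) + 1 = poleOrder r b * (2 * N + 1) := by
  simp only [zeroOrder, poleOrder]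
  ring

open Polynomial in
/-- The numerator of the rational function `formFun`. -/
noncomputable def formNum (m : ℤ) (r b N : ℕ) : ℝ[X] :=
  C ((m : ℝ) ^ (poleOrder r b * N ^ 2 + 2 * N)) * X ^ zeroOrder r b N * (C ((m : ℝ) ^ (2 * N)) - X) *
    (∏ i ∈ Finset.range (r * (2 * N)), (1 - C ((m : ℝ) ^ (2 * i + 1)) * X)) *
    ∏ i ∈ Finset.range (r * (2 * N)), (C ((m : ℝ) ^ (4 * N + 2 * i + 1)) - X)

/-- The well-poised rational function whose values at odd powers of `1 / m` are summed. -/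
noncomputable def formFun (m : ℤ) (r b N : ℕ) (x : ℝ) : ℝ :=
  (formNum m r b N).eval x /
    ∏ j ∈ Finset.range (2 * N + 1), ((m : ℝ) ^ (2 * j) - x) ^ poleOrder r b

/-- The exponent of the power of `m` in the expansion at the pole `m ^ (2 j)`. -/
def localExp (r b N j : ℕ) : ℕ := poleOrder r b * ((N : ℤ) - j).natAbs ^ 2 + (2 * N - j)

/-- Bookkeeping of the powers of m released by x = m^(2j)(1 - t): on the right those of the
numerator, on the left those of the denominator and the surplus. The prefactor of `formNum` makes
the surplus nonnegative at every pole. -/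
theorem localExp_add (r b N j : ℕ) (hj : j ≤ 2 * N) :
    localExp r b N j + poleOrder r b * (2 * j + (j * (j - 1) + 2 * j * (2 * N - j)))
      = poleOrder r b * N ^ 2 + 2 * N + 2 * j * zeroOrder r b N + 2 * j * (r * (2 * N)) := by
  have h := two_mul_zeroOrder r b N
  have h1 : j * (j - 1) + j = j ^ 2 := by
    rcases j with _ | j
    · simp
    · simp; ring
  have h2 : (((N : ℤ) - j).natAbs : ℤ) ^ 2 = ((N : ℤ) - j) ^ 2 := Int.natAbs_sq _
  obtain ⟨k, hk⟩ := Nat.exists_eq_add_of_le hj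
  have h3 : 2 * N - j = k := by omega
  rw [localExp, h3]
  generalize zeroOrder r b N = e at *
  generalize poleOrder r b = A at *
  zify at h h1 hk ⊢
  rw [← Int.natCast_natAbs, h2]
  push_cast at *
  have hN : (k : ℤ) = 2 * N - j := by linarith
  rw [hN]
  generalize ((j - 1 : ℕ) : ℤ) = j' at *
  have h4 : (j : ℤ) * j' = j ^ 2 - j := by linarith
  rw [h4]
  linear_combination (-(j : ℤ)) * h

/-- The product of `formFun` and `t ^ A`, with `t = 1 - x / m ^ (2 j)` the local parameter at the pole
`m ^ (2 j)`, as a power series in `t`. -/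
noncomputable def localSeries (m : ℤ) (r b N j : ℕ) : PowerSeries ℝ :=
  PowerSeries.C ((m : ℝ) ^ localExp r b N j) * (1 - PowerSeries.X) ^ zeroOrder r b N *
    (PowerSeries.C ((m : ℝ) ^ (2 * N)) - PowerSeries.C ((m : ℝ) ^ (2 * j)) * (1 - PowerSeries.X)) *
    (∏ i ∈ Finset.range (r * (2 * N)),
      (1 - PowerSeries.C ((m : ℝ) ^ (2 * i + (2 * j + 1))) * (1 - PowerSeries.X))) *
    (∏ i ∈ Finset.range (r * (2 * N)),
      (PowerSeries.C ((m : ℝ) ^ (2 * i + (2 * (2 * N - j) + 1))) - (1 - PowerSeries.X))) *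
    ((∏ i ∈ Finset.range j, (1 - PowerSeries.C ((m : ℝ) ^ (2 * i + 2)) * (1 - PowerSeries.X))⁻¹) *
      ∏ i ∈ Finset.range (2 * N - j),
        (PowerSeries.C ((m : ℝ) ^ (2 * i + 2)) - (1 - PowerSeries.X))⁻¹) ^ poleOrder r b

theorem prod_erase_pow_sub {S : Type*} [CommRing S] (c y : S) {n j : ℕ} (hj : j ≤ n) :
    ∏ i ∈ (Finset.range (n + 1)).erase j, (c ^ (2 * i) - c ^ (2 * j) * y)
      = c ^ (j * (j - 1) + 2 * j * (n - j)) * ((∏ i ∈ Finset.range j, (1 - c ^ (2 * i + 2) * y)) *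
          ∏ i ∈ Finset.range (n - j), (c ^ (2 * i + 2) - y)) := by
  have hset : (Finset.range (n + 1)).erase j
      = Finset.range j ∪ (Finset.range (n - j)).image (fun i => j + 1 + i) := by
    ext i
    simp only [Finset.mem_erase, Finset.mem_range, Finset.mem_union, Finset.mem_image]
    constructor
    · rintro ⟨h1, h2⟩
      rcases lt_or_gt_of_ne h1 with h | h
      · exact Or.inl h
      · exact Or.inr ⟨i - (j + 1), by omega, by omega⟩
    · rintro (h | ⟨k, h1, h2⟩) <;> constructor <;> omega
  rw [hset, Finset.prod_union, Finset.prod_image (by intro a _ b _ h; simpa using h)]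
  · have e1 : ∏ i ∈ Finset.range j, (c ^ (2 * i) - c ^ (2 * j) * y)
        = c ^ (j * (j - 1)) * ∏ i ∈ Finset.range j, (1 - c ^ (2 * i + 2) * y) := by
      rw [← Finset.prod_range_reflect (fun i => 1 - c ^ (2 * i + 2) * y), ← Finset.sum_range_id_mul_two,
        Finset.sum_mul, ← Finset.prod_pow_eq_pow_sum, ← Finset.prod_mul_distrib]
      refine Finset.prod_congr rfl fun i hi => ?_
      have hi' := Finset.mem_range.mp hi
      have h2 : i * 2 + (2 * (j - 1 - i) + 2) = 2 * j := by omega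
      rw [mul_sub, ← mul_assoc, ← pow_add, mul_one, h2, mul_comm i 2]
    have e2 : ∏ i ∈ Finset.range (n - j), (c ^ (2 * (j + 1 + i)) - c ^ (2 * j) * y)
        = c ^ (2 * j * (n - j)) * ∏ i ∈ Finset.range (n - j), (c ^ (2 * i + 2) - y) := by
      have : c ^ (2 * j * (n - j)) = ∏ i ∈ Finset.range (n - j), c ^ (2 * j) := by
        simp [pow_mul]
      rw [this, ← Finset.prod_mul_distrib]
      refine Finset.prod_congr rfl fun i _ => ?_
      ring
    rw [e1, e2, pow_add]
    ring
  · rw [Finset.disjoint_left]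
    intro i hi hi'
    obtain ⟨k, -, rfl⟩ := Finset.mem_image.mp hi'
    have := Finset.mem_range.mp hi
    omega

theorem one_sub_pow_ne_zero {m : ℤ} (hm : 2 ≤ |m|) {e : ℕ} (he : e ≠ 0) : (m : ℝ) ^ e - 1 ≠ 0 := by
  exact_mod_cast pow_sub_one_ne_zero hm he

/-- Identifies `localSeries` as numerator over the denominator stripped of its j-th pole, in the
form needed by `partial_fractions`. The inverses exist because the constant terms ±(m^(2i+2) - 1)
are nonzero. -/
theorem coe_formNum_comp {m : ℤ} (hm : 2 ≤ |m|) (r b N j : ℕ) (hj : j ≤ 2 * N) :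
    (((formNum m r b N).comp (Polynomial.C ((m : ℝ) ^ (2 * j)) * (1 - Polynomial.X)) :
        Polynomial ℝ) : PowerSeries ℝ)
      = localSeries m r b N j * ((Polynomial.C (((m : ℝ) ^ (2 * j)) ^ poleOrder r b) *
          ∏ i ∈ (Finset.range (2 * N + 1)).erase j, (Polynomial.C ((m : ℝ) ^ (2 * i))
            - Polynomial.C ((m : ℝ) ^ (2 * j)) * (1 - Polynomial.X)) ^ poleOrder r b :
          Polynomial ℝ) : PowerSeries ℝ) := by
  have hcoe : ∀ p : Polynomial ℝ, (p : PowerSeries ℝ) = Polynomial.coeToPowerSeries.ringHom p :=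
    fun p => rfl
  set c : PowerSeries ℝ := PowerSeries.C (m : ℝ) with hc
  set y : PowerSeries ℝ := 1 - PowerSeries.X with hy
  have hC : ∀ k : ℕ, PowerSeries.C ((m : ℝ) ^ k) = c ^ k := fun k => by rw [hc, map_pow]
  have hC' : ∀ u : ℝ, Polynomial.coeToPowerSeries.ringHom (Polynomial.C u) = PowerSeries.C u :=
    fun u => Polynomial.coe_C u
  have hX' : Polynomial.coeToPowerSeries.ringHom (Polynomial.X : Polynomial ℝ) = PowerSeries.X :=
    Polynomial.coe_X
  set P1 : PowerSeries ℝ := ∏ i ∈ Finset.range j, (1 - c ^ (2 * i + 2) * y) with hP1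
  set P2 : PowerSeries ℝ := ∏ i ∈ Finset.range (2 * N - j), (c ^ (2 * i + 2) - y) with hP2
  set I1 : PowerSeries ℝ := ∏ i ∈ Finset.range j, (1 - c ^ (2 * i + 2) * y)⁻¹ with hI1
  set I2 : PowerSeries ℝ := ∏ i ∈ Finset.range (2 * N - j), (c ^ (2 * i + 2) - y)⁻¹ with hI2
  have hinv1 : I1 * P1 = 1 := by
    rw [hI1, hP1, ← Finset.prod_mul_distrib]
    refine Finset.prod_eq_one fun i _ => PowerSeries.inv_mul_cancel _ ?_
    have := one_sub_pow_ne_zero hm (e := 2 * i + 2) (by omega)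
    simp only [hc, hy, map_sub, map_mul, map_pow, map_one, PowerSeries.constantCoeff_C,
      PowerSeries.constantCoeff_X, sub_zero, mul_one]
    intro h
    apply this
    linarith
  have hinv2 : I2 * P2 = 1 := by
    rw [hI2, hP2, ← Finset.prod_mul_distrib]
    refine Finset.prod_eq_one fun i _ => PowerSeries.inv_mul_cancel _ ?_
    have := one_sub_pow_ne_zero hm (e := 2 * i + 2) (by omega)
    simpa [hc, hy] using this
  have hinv : (I1 * I2) ^ poleOrder r b * (P1 * P2) ^ poleOrder r b = 1 := by
    rw [← mul_pow, mul_mul_mul_comm, hinv1, hinv2, one_mul, one_pow]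
  rw [hcoe, hcoe, formNum, localSeries]
  simp only [Polynomial.mul_comp, Polynomial.C_comp, Polynomial.pow_comp, Polynomial.X_comp,
    Polynomial.sub_comp, Polynomial.one_comp, Polynomial.prod_comp, map_mul, map_prod, map_sub,
    map_one, hC', hX', map_pow, ← hc, ← hy]
  rw [Finset.prod_pow, prod_erase_pow_sub c y hj, ← hP1, ← hP2, ← hI1, ← hI2]
  have f1 : ∏ i ∈ Finset.range (r * (2 * N)), (1 - c ^ (2 * i + 1) * (c ^ (2 * j) * y))
      = ∏ i ∈ Finset.range (r * (2 * N)), (1 - c ^ (2 * i + (2 * j + 1)) * y) := by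
    refine Finset.prod_congr rfl fun i _ => ?_
    ring
  have f2 : ∏ i ∈ Finset.range (r * (2 * N)), (c ^ (4 * N + 2 * i + 1) - c ^ (2 * j) * y)
      = c ^ (2 * j * (r * (2 * N))) * ∏ i ∈ Finset.range (r * (2 * N)),
          (c ^ (2 * i + (2 * (2 * N - j) + 1)) - y) := by
    have : c ^ (2 * j * (r * (2 * N))) = ∏ i ∈ Finset.range (r * (2 * N)), c ^ (2 * j) := by
      simp [pow_mul]
    rw [this, ← Finset.prod_mul_distrib]
    refine Finset.prod_congr rfl fun i _ => ?_
    rw [show 4 * N + 2 * i + 1 = 2 * j + (2 * i + (2 * (2 * N - j) + 1)) by omega, pow_add]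
    ring
  rw [f1, f2]
  generalize ∏ i ∈ Finset.range (r * (2 * N)), (1 - c ^ (2 * i + (2 * j + 1)) * y) = F1
  generalize ∏ i ∈ Finset.range (r * (2 * N)),
          (c ^ (2 * i + (2 * (2 * N - j) + 1)) - y) = F2
  have hexp := localExp_add r b N j hj
  have hpow : c ^ localExp r b N j * ((c ^ (2 * j)) ^ poleOrder r b *
      (c ^ (j * (j - 1) + 2 * j * (2 * N - j))) ^ poleOrder r b)
      = c ^ (poleOrder r b * N ^ 2 + 2 * N) * (c ^ (2 * j)) ^ zeroOrder r b N *
        c ^ (2 * j * (r * (2 * N))) := by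
    rw [← pow_mul, ← pow_mul, ← pow_mul, ← pow_add, ← pow_add, ← pow_add, ← pow_add]
    congr 1
    rw [← hexp]
    ring
  calc _ = (c ^ (poleOrder r b * N ^ 2 + 2 * N) * (c ^ (2 * j)) ^ zeroOrder r b N *
        c ^ (2 * j * (r * (2 * N)))) * (y ^ zeroOrder r b N * (c ^ (2 * N) - c ^ (2 * j) * y)
          * F1 * F2) * 1 := by rw [mul_pow]; ring
    _ = _ := by
      rw [← hpow, ← hinv, mul_pow (c ^ (j * (j - 1) + 2 * j * (2 * N - j)))]
      ring

theorem natDegree_formNum_lt (m : ℤ) {r : ℕ} (hr : 1 ≤ r) (b N : ℕ) :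
    (formNum m r b N).natDegree < poleOrder r b * (2 * N + 1) := by
  have h1 : ∀ s : Finset ℕ, (∏ i ∈ s,
      (1 - Polynomial.C ((m : ℝ) ^ (2 * i + 1)) * Polynomial.X)).natDegree ≤ s.card := by
    intro s
    refine (Polynomial.natDegree_prod_le _ _).trans ?_
    refine (Finset.sum_le_card_nsmul _ _ 1 fun i _ => ?_).trans (by simp)
    refine (Polynomial.natDegree_sub_le _ _).trans (max_le (by simp) ?_)
    exact (Polynomial.natDegree_C_mul_le _ _).trans Polynomial.natDegree_X_le
  have h2 : ∀ s : Finset ℕ, (∏ i ∈ s,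
      (Polynomial.C ((m : ℝ) ^ (4 * N + 2 * i + 1)) - Polynomial.X)).natDegree ≤ s.card := by
    intro s
    refine (Polynomial.natDegree_prod_le _ _).trans ?_
    refine (Finset.sum_le_card_nsmul _ _ 1 fun i _ => ?_).trans (by simp)
    exact (Polynomial.natDegree_sub_le _ _).trans (max_le (by simp) Polynomial.natDegree_X_le)
  have h3 : (Polynomial.C ((m : ℝ) ^ (2 * N)) - Polynomial.X).natDegree ≤ 1 :=
    (Polynomial.natDegree_sub_le _ _).trans (max_le (by simp) Polynomial.natDegree_X_le)
  have h4 : (formNum m r b N).natDegree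
      ≤ 0 + zeroOrder r b N + 1 + r * (2 * N) + r * (2 * N) := by
    unfold formNum
    refine Polynomial.natDegree_mul_le_of_le (Polynomial.natDegree_mul_le_of_le
      (Polynomial.natDegree_mul_le_of_le (Polynomial.natDegree_mul_le_of_le ?_ ?_) h3)
      ((h1 _).trans (by simp))) ((h2 _).trans (by simp))
    · simp
    · exact Polynomial.natDegree_X_pow_le _
  have h5 := two_mul_zeroOrder r b N
  have h6 : 1 ≤ zeroOrder r b N := by
    unfold zeroOrder; omega
  omega

theorem pow_injective_of_two_le {m : ℤ} (hm : 2 ≤ |m|) :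
    Function.Injective fun k : ℕ => (m : ℝ) ^ k := by
  intro k l h
  have h2 := two_le_abs_cast hm
  have : |(m : ℝ)| ^ k = |(m : ℝ)| ^ l := by rw [← abs_pow, ← abs_pow]; exact congrArg _ h
  exact pow_right_injective₀ (by linarith) (by linarith) this

/-- The partial fraction expansion of `formFun`. -/
theorem formFun_eq_sum {m : ℤ} (hm : 2 ≤ |m|) {r : ℕ} (hr : 1 ≤ r) (b N : ℕ) {x : ℝ}
    (hx : ∀ j ∈ Finset.range (2 * N + 1), x ≠ (m : ℝ) ^ (2 * j)) :
    formFun m r b N x = ∑ j ∈ Finset.range (2 * N + 1), ∑ k ∈ Finset.range (poleOrder r b),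
      PowerSeries.coeff k (localSeries m r b N j) *
        (1 / (1 - x / (m : ℝ) ^ (2 * j))) ^ (poleOrder r b - k) := by
  refine partial_fractions (by unfold poleOrder; omega) (fun j => (m : ℝ) ^ (2 * j)) ?_ ?_
    (formNum m r b N) (natDegree_formNum_lt m hr b N) (localSeries m r b N) ?_ x hx
  · intro i _ j _ h
    have := pow_injective_of_two_le hm h
    omega
  · intro j _
    exact pow_ne_zero _ (cast_ne_zero_of_two_le_abs hm)
  · intro j hj
    exact coe_formNum_comp hm r b N j (by have := Finset.mem_range.mp hj; omega)

theorem formFun_zero (m : ℤ) {r : ℕ} (hr : 1 ≤ r) (b N : ℕ) : formFun m r b N 0 = 0 := by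
  have : zeroOrder r b N ≠ 0 := by unfold zeroOrder; omega
  simp [formFun, formNum, this]

/-- Evaluate the expansion at x = 0, where every local parameter is 1 and `formFun` vanishes. This
relation permits replacing T^s by T^s - 1, whose alternating series converges. -/
theorem sum_coeff_localSeries {m : ℤ} (hm : 2 ≤ |m|) {r : ℕ} (hr : 1 ≤ r) (b N : ℕ) :
    ∑ j ∈ Finset.range (2 * N + 1), ∑ k ∈ Finset.range (poleOrder r b),
      PowerSeries.coeff k (localSeries m r b N j) = 0 := by
  have h := formFun_eq_sum hm hr b N (x := 0)
    (fun j _ => (pow_ne_zero _ (cast_ne_zero_of_two_le_abs hm)).symm)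
  rw [formFun_zero m hr] at h
  simpa using h.symm

/-- The substitution exchanges the two products of the numerator and reverses the poles; the
monomials cancel by `two_mul_zeroOrder`. As (2N+1)A is odd the denominator changes sign, and the
factor m^(2N) - x compensates for it. -/
theorem formFun_symm {m : ℤ} (hm : 2 ≤ |m|) (r b N : ℕ) {x : ℝ} (hx : x ≠ 0) :
    formFun m r b N ((m : ℝ) ^ (4 * N) / x) = formFun m r b N x := by
  have hm0 := cast_ne_zero_of_two_le_abs hm
  set c : ℝ := (m : ℝ)
  have hden : ∏ j ∈ Finset.range (2 * N + 1), (c ^ (2 * j) - c ^ (4 * N) / x)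
      = (-1 / x) ^ (2 * N + 1) * (c ^ (2 * N)) ^ (2 * N + 1) *
        ∏ j ∈ Finset.range (2 * N + 1), (c ^ (2 * j) - x) := by
    have e1 : (c ^ (2 * N)) ^ (2 * N + 1) = ∏ j ∈ Finset.range (2 * N + 1), c ^ (2 * j) := by
      rw [Finset.prod_pow_eq_pow_sum, ← pow_mul]
      congr 1
      rw [← Finset.mul_sum, mul_comm 2 (Finset.sum _ _), Finset.sum_range_id_mul_two]
      simp [mul_comm]
    rw [e1, ← Finset.prod_range_reflect (fun j => c ^ (2 * j) - x),
      ← Finset.card_range (2 * N + 1), ← Finset.prod_const, Finset.card_range,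
      ← Finset.prod_mul_distrib, ← Finset.prod_mul_distrib]
    refine Finset.prod_congr rfl fun j hj => ?_
    have hj' := Finset.mem_range.mp hj
    have e2 : c ^ (4 * N) = c ^ (2 * j) * c ^ (2 * (2 * N + 1 - 1 - j)) := by
      rw [← pow_add]; congr 1; omega
    rw [e2]
    field_simp
    ring
  have hn1 : ∏ i ∈ Finset.range (r * (2 * N)), (1 - c ^ (2 * i + 1) * (c ^ (4 * N) / x))
      = (-1 / x) ^ (r * (2 * N)) *
        ∏ i ∈ Finset.range (r * (2 * N)), (c ^ (4 * N + 2 * i + 1) - x) := by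
    rw [← Finset.card_range (r * (2 * N)), ← Finset.prod_const, Finset.card_range,
      ← Finset.prod_mul_distrib]
    refine Finset.prod_congr rfl fun i _ => ?_
    rw [show 4 * N + 2 * i + 1 = (2 * i + 1) + 4 * N by ring, pow_add c (2 * i + 1)]
    field_simp
    ring
  have hn2 : ∏ i ∈ Finset.range (r * (2 * N)), (c ^ (4 * N + 2 * i + 1) - c ^ (4 * N) / x)
      = (-(c ^ (2 * N)) ^ 2 / x) ^ (r * (2 * N)) *
        ∏ i ∈ Finset.range (r * (2 * N)), (1 - c ^ (2 * i + 1) * x) := by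
    rw [← Finset.card_range (r * (2 * N)), ← Finset.prod_const, Finset.card_range,
      ← Finset.prod_mul_distrib]
    refine Finset.prod_congr rfl fun i _ => ?_
    rw [show 4 * N + 2 * i + 1 = (2 * i + 1) + 4 * N by ring, pow_add c (2 * i + 1), ← pow_mul,
      show 2 * N * 2 = 4 * N by ring]
    field_simp
    ring
  have hn3 : c ^ (2 * N) - c ^ (4 * N) / x = -(c ^ (2 * N)) / x * (c ^ (2 * N) - x) := by
    rw [show 4 * N = 2 * N + 2 * N by ring, pow_add]
    field_simp
    ring
  have hn4 : c ^ (4 * N) / x = (c ^ (2 * N)) ^ 2 / x := by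
    rw [← pow_mul, show 2 * N * 2 = 4 * N by ring]
  unfold formFun formNum
  simp only [Polynomial.eval_mul, Polynomial.eval_C, Polynomial.eval_pow, Polynomial.eval_X,
    Polynomial.eval_sub, Polynomial.eval_prod, Polynomial.eval_one]
  rw [Finset.prod_pow, Finset.prod_pow, hden, hn1, hn2, hn3, hn4]
  generalize ∏ i ∈ Finset.range (r * (2 * N)), (1 - c ^ (2 * i + 1) * x) = F1
  generalize ∏ i ∈ Finset.range (r * (2 * N)), (c ^ (4 * N + 2 * i + 1) - x) = F2
  generalize ∏ j ∈ Finset.range (2 * N + 1), (c ^ (2 * j) - x) = G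
  have hz : c ^ (2 * N) ≠ 0 := pow_ne_zero _ hm0
  generalize c ^ (2 * N) = z at *
  have hodd : Odd ((2 * N + 1) * poleOrder r b) :=
    (odd_two_mul_add_one N).mul (odd_two_mul_add_one (r + b))
  have hA := two_mul_zeroOrder r b N
  have hfac : ((-1 / x) ^ (2 * N + 1) * z ^ (2 * N + 1)) ^ poleOrder r b * x ^ zeroOrder r b N
      = (z ^ 2 / x) ^ zeroOrder r b N * (-z / x) * (-1 / x) ^ (r * (2 * N)) *
        (-z ^ 2 / x) ^ (r * (2 * N)) := by
    have e1 : ((-1 / x) ^ (2 * N + 1) * z ^ (2 * N + 1)) ^ poleOrder r b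
        = -(z / x) ^ (2 * zeroOrder r b N + 2 * (r * (2 * N)) + 1) := by
      rw [hA, ← mul_pow, ← pow_mul, show -1 / x * z = -(z / x) by ring, hodd.neg_pow, mul_comm (poleOrder r b)]
    rw [e1, mul_assoc _ ((-1 / x) ^ _), ← mul_pow, show -1 / x * (-z ^ 2 / x) = (z / x) ^ 2 by ring,
      show z ^ 2 / x = (z / x) ^ 2 * x by field_simp, mul_pow, pow_add, pow_add, pow_mul, pow_mul]
    ring
  have hzz : ((-1 / x) ^ (2 * N + 1) * z ^ (2 * N + 1)) ^ poleOrder r b ≠ 0 := by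
    apply pow_ne_zero
    apply mul_ne_zero <;> apply pow_ne_zero
    · exact div_ne_zero (by norm_num) hx
    · exact hz
  rw [mul_pow, ← mul_div_mul_left _ (G ^ poleOrder r b) hzz]
  congr 1
  linear_combination (-(c ^ (poleOrder r b * N ^ 2 + 2 * N) * (z - x) * F1 * F2)) * hfac

/-! ### Integrality of the local expansions -/

theorem inv_linear_series {α : ℝ} (hα : α ≠ 0) (β : ℝ) :
    (PowerSeries.C α + PowerSeries.C β * PowerSeries.X)⁻¹
      = PowerSeries.mk fun k => α⁻¹ * (-(β / α)) ^ k := by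
  have h0 : PowerSeries.constantCoeff (PowerSeries.C α + PowerSeries.C β * PowerSeries.X) ≠ 0 := by
    simpa using hα
  rw [eq_comm, PowerSeries.eq_inv_iff_mul_eq_one h0]
  ext k
  rw [mul_add, map_add, mul_comm _ (PowerSeries.C α), PowerSeries.coeff_C_mul, mul_left_comm,
    PowerSeries.coeff_C_mul]
  rcases k with _ | k
  · simp [hα]
  · rw [PowerSeries.coeff_succ_mul_X, PowerSeries.coeff_mk, PowerSeries.coeff_mk,
      PowerSeries.coeff_one, if_neg (by omega), pow_succ]
    field_simp
    ring

/-- The ring of real power series that become integral when the variable is multiplied by `D`. -/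
noncomputable def integralSeries (D : ℤ) : Subring (PowerSeries ℝ) :=
  ((PowerSeries.map (Int.castRingHom ℝ)).range).comap (PowerSeries.rescale (D : ℝ))

theorem mem_integralSeries {D : ℤ} {g : PowerSeries ℝ} :
    g ∈ integralSeries D ↔ ∀ k, ∃ z : ℤ, (z : ℝ) = (D : ℝ) ^ k * PowerSeries.coeff k g := by
  unfold integralSeries
  rw [Subring.mem_comap, RingHom.mem_range]
  constructor
  · rintro ⟨h, hh⟩ k
    refine ⟨PowerSeries.coeff k h, ?_⟩
    have := congrArg (PowerSeries.coeff k) hh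
    rw [PowerSeries.coeff_map, PowerSeries.coeff_rescale] at this
    simpa using this
  · intro h
    choose z hz using h
    refine ⟨PowerSeries.mk z, ?_⟩
    ext k
    rw [PowerSeries.coeff_map, PowerSeries.coeff_rescale, PowerSeries.coeff_mk]
    simpa using hz k

theorem C_mem_integralSeries (D z : ℤ) : PowerSeries.C (z : ℝ) ∈ integralSeries D := by
  rw [mem_integralSeries]
  intro k
  rw [PowerSeries.coeff_C]
  split_ifs with h
  · exact ⟨z, by simp [h]⟩
  · exact ⟨0, by simp⟩

theorem linear_mem_integralSeries {D : ℤ} {α β : ℝ} (hα : ∃ z : ℤ, (z : ℝ) = α)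
    (hβ : ∃ z : ℤ, (z : ℝ) = D * β) :
    PowerSeries.C α + PowerSeries.C β * PowerSeries.X ∈ integralSeries D := by
  obtain ⟨z, rfl⟩ := hα
  refine Subring.add_mem _ (C_mem_integralSeries D z) ?_
  obtain ⟨w, hw⟩ := hβ
  rw [mem_integralSeries]
  rintro (_ | _ | k)
  · exact ⟨0, by simp⟩
  · exact ⟨w, by simp [hw]⟩
  · refine ⟨0, ?_⟩
    rw [PowerSeries.coeff_C_mul, PowerSeries.coeff_X, if_neg (by omega)]
    simp

/-- Normalised by its constant term, the inverse is the geometric series in -(β/α) X, so only D β/α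
needs to be an integer. -/
theorem C_mul_inv_linear_mem_integralSeries {D : ℤ} {α β : ℝ} (hα : α ≠ 0)
    (hβ : ∃ z : ℤ, (z : ℝ) = D * (β / α)) :
    PowerSeries.C α * (PowerSeries.C α + PowerSeries.C β * PowerSeries.X)⁻¹ ∈ integralSeries D := by
  obtain ⟨w, hw⟩ := hβ
  rw [mem_integralSeries]
  intro k
  refine ⟨(-w) ^ k, ?_⟩
  rw [inv_linear_series hα, PowerSeries.coeff_C_mul, PowerSeries.coeff_mk, mul_inv_cancel_left₀ hα,
    ← mul_pow, mul_neg, ← hw]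
  push_cast
  ring

theorem linear_of_one_sub (u : ℝ) : (1 : PowerSeries ℝ) - PowerSeries.C u * (1 - PowerSeries.X)
    = PowerSeries.C (1 - u) + PowerSeries.C u * PowerSeries.X := by
  rw [map_sub, map_one]
  ring

theorem linear_of_sub_one_sub (u : ℝ) : PowerSeries.C u - (1 - PowerSeries.X)
    = PowerSeries.C (u - 1) + PowerSeries.C 1 * PowerSeries.X := by
  rw [map_sub, map_one]
  ring

theorem exists_int_eq_mul_div {D z w : ℤ} (hw : w ≠ 0) (h : w ∣ D) :
    ∃ t : ℤ, (t : ℝ) = D * ((z : ℝ) / w) := by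
  obtain ⟨v, rfl⟩ := h
  have : (w : ℝ) ≠ 0 := by exact_mod_cast hw
  refine ⟨v * z, ?_⟩
  push_cast
  field_simp

theorem one_sub_inv_series_mem {m : ℤ} (hm : 2 ≤ |m|) {n a : ℕ} (ha : 0 < a) (han : a ≤ 2 * n) :
    PowerSeries.C (1 - (m : ℝ) ^ a) *
      (1 - PowerSeries.C ((m : ℝ) ^ a) * (1 - PowerSeries.X))⁻¹ ∈ integralSeries (cycProd m n) := by
  have h0 := pow_sub_one_ne_zero hm ha.ne'
  have h1 := one_sub_pow_ne_zero hm ha.ne'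
  rw [linear_of_one_sub]
  apply C_mul_inv_linear_mem_integralSeries
  · intro h; apply h1; linarith
  · obtain ⟨t, ht⟩ := exists_int_eq_mul_div (z := -m ^ a) h0 (pow_sub_one_dvd_cycProd m ha han)
    refine ⟨t, ?_⟩
    rw [ht]
    push_cast
    rw [neg_div, ← div_neg, neg_sub]

theorem sub_one_inv_series_mem {m : ℤ} (hm : 2 ≤ |m|) {n a : ℕ} (ha : 0 < a) (han : a ≤ 2 * n) :
    PowerSeries.C ((m : ℝ) ^ a - 1) *
      (PowerSeries.C ((m : ℝ) ^ a) - (1 - PowerSeries.X))⁻¹ ∈ integralSeries (cycProd m n) := by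
  have h0 := pow_sub_one_ne_zero hm ha.ne'
  rw [linear_of_sub_one_sub]
  apply C_mul_inv_linear_mem_integralSeries (one_sub_pow_ne_zero hm ha.ne')
  obtain ⟨t, ht⟩ := exists_int_eq_mul_div (z := 1) h0 (pow_sub_one_dvd_cycProd m ha han)
  refine ⟨t, ?_⟩
  rw [ht]
  push_cast
  rfl

theorem smallPart_ne_zero {m : ℤ} (hm : 2 ≤ |m|) (n a : ℕ) : smallPart m n a ≠ 0 := by
  refine Finset.prod_ne_zero_iff.mpr fun d hd => cyclotomic_eval_ne_zero hm ?_
  exact (Finset.mem_Ioc.mp (Finset.mem_filter.mp (Finset.mem_filter.mp hd).1).1).1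

theorem oddPartProd_ne_zero {m : ℤ} (hm : 2 ≤ |m|) (n : ℕ) : oddPartProd m n ≠ 0 := by
  refine Finset.prod_ne_zero_iff.mpr fun d hd => pow_ne_zero _ (cyclotomic_eval_ne_zero hm ?_)
  exact (Finset.mem_Ioc.mp (Finset.mem_filter.mp hd).1).1

theorem evenProd_ne_zero {m : ℤ} (hm : 2 ≤ |m|) (n : ℕ) : evenProd m n ≠ 0 :=
  Finset.prod_ne_zero_iff.mpr fun _ _ => pow_sub_one_ne_zero hm (by omega)

theorem exists_int_eq_div {z w : ℤ} (h : w ∣ z) : ∃ t : ℤ, (t : ℝ) = (z : ℝ) / w :=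
  ⟨z / w, Int.cast_div_charZero h⟩

/-- A product of linear series, each divisible by the corresponding `smallPart`, is divisible by
`oddPartProd`. -/
theorem C_inv_mul_prod_mem {m : ℤ} (hm : 2 ≤ |m|) (n r c : ℕ) (α β : ℕ → ℤ)
    (hα : ∀ i, smallPart m n (2 * i + c) ∣ α i) :
    PowerSeries.C (((oddPartProd m n : ℤ) : ℝ) ^ r)⁻¹ * ∏ i ∈ Finset.range (r * n),
      (PowerSeries.C (α i : ℝ) + PowerSeries.C (β i : ℝ) * PowerSeries.X)
      ∈ integralSeries (cycProd m n) := by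
  set w : ℕ → ℤ := fun i => smallPart m n (2 * i + c) with hw
  have hw0 : ∀ i, (w i : ℝ) ≠ 0 := fun i => by exact_mod_cast smallPart_ne_zero hm n _
  -- Divide each factor by w_i = `smallPart`. The constant term stays integral; the coefficient of X
  -- need not, but w_i divides D, so scaling X by D repairs it.
  have h1 : ∏ i ∈ Finset.range (r * n),
      (PowerSeries.C (α i : ℝ) + PowerSeries.C (β i : ℝ) * PowerSeries.X)
      = PowerSeries.C ((∏ i ∈ Finset.range (r * n), w i : ℤ) : ℝ) * ∏ i ∈ Finset.range (r * n),
        (PowerSeries.C ((α i : ℝ) / w i) + PowerSeries.C ((β i : ℝ) / w i) * PowerSeries.X) := by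
    rw [Int.cast_prod, map_prod, ← Finset.prod_mul_distrib]
    refine Finset.prod_congr rfl fun i _ => ?_
    rw [mul_add, ← mul_assoc, ← map_mul, ← map_mul, mul_div_cancel₀ _ (hw0 i),
      mul_div_cancel₀ _ (hw0 i)]
  obtain ⟨t, ht⟩ := exists_int_eq_div (oddPartProd_pow_dvd m n r c)
  rw [h1, ← mul_assoc, ← map_mul]
  have h2 : ((((oddPartProd m n : ℤ) : ℝ) ^ r)⁻¹ *
      ((∏ i ∈ Finset.range (r * n), w i : ℤ) : ℝ)) = t := by
    rw [ht]
    push_cast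
    rw [div_eq_inv_mul]
  rw [h2]
  refine Subring.mul_mem _ (C_mem_integralSeries _ _) (Subring.prod_mem _ fun i _ => ?_)
  exact linear_mem_integralSeries (exists_int_eq_div (hα i))
    (exists_int_eq_mul_div (smallPart_ne_zero hm n _) (smallPart_dvd_cycProd m n _))

/-- Each of the two numerator products is divisible by `oddPartProd` to the power r. Each inverse
factor costs its constant term, and at every pole these costs divide `evenProd m (2 * N)` by the
Gaussian binomial divisibility. -/
theorem C_mul_localSeries_mem {m : ℤ} (hm : 2 ≤ |m|) (r b N j : ℕ) (hj : j ≤ 2 * N) :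
    PowerSeries.C (((evenProd m (2 * N) : ℤ) : ℝ) ^ poleOrder r b /
        ((oddPartProd m (2 * N) : ℤ) : ℝ) ^ (2 * r)) * localSeries m r b N j
      ∈ integralSeries (cycProd m (2 * N)) := by
  set D := cycProd m (2 * N)
  set V : ℝ := ((oddPartProd m (2 * N) : ℤ) : ℝ)
  have hone : (1 : PowerSeries ℝ) - PowerSeries.X ∈ integralSeries D := by
    have := linear_mem_integralSeries (D := D) (α := 1) (β := -1) ⟨1, by simp⟩ ⟨-D, by simp⟩
    simpa [sub_eq_add_neg] using this
  have hpow : ∀ k : ℕ, PowerSeries.C ((m : ℝ) ^ k) ∈ integralSeries D := fun k => by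
    have := C_mem_integralSeries D (m ^ k)
    push_cast at this
    exact this
  -- the numerator
  have hnum1 : PowerSeries.C (V ^ r)⁻¹ * ∏ i ∈ Finset.range (r * (2 * N)),
      (1 - PowerSeries.C ((m : ℝ) ^ (2 * i + (2 * j + 1))) * (1 - PowerSeries.X))
      ∈ integralSeries D := by
    have := C_inv_mul_prod_mem hm (2 * N) r (2 * j + 1)
      (fun i => -(m ^ (2 * i + (2 * j + 1)) - 1)) (fun i => m ^ (2 * i + (2 * j + 1)))
      (fun i => (dvd_neg).mpr (smallPart_dvd_pow_sub_one m _ (by omega)))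
    push_cast at this
    simpa only [linear_of_one_sub, neg_sub] using this
  have hnum2 : PowerSeries.C (V ^ r)⁻¹ * ∏ i ∈ Finset.range (r * (2 * N)),
      (PowerSeries.C ((m : ℝ) ^ (2 * i + (2 * (2 * N - j) + 1))) - (1 - PowerSeries.X))
      ∈ integralSeries D := by
    have := C_inv_mul_prod_mem hm (2 * N) r (2 * (2 * N - j) + 1)
      (fun i => (m ^ (2 * i + (2 * (2 * N - j) + 1)) - 1)) (fun i => 1)
      (fun i => (smallPart_dvd_pow_sub_one m _ (by omega)))
    push_cast at this
    simpa only [linear_of_sub_one_sub] using this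
  -- the denominator
  obtain ⟨Q, hQ⟩ := evenProd_mul_dvd m hj
  have hden1 : PowerSeries.C ((evenProd m j : ℤ) : ℝ) * ∏ i ∈ Finset.range j,
      (1 - PowerSeries.C ((m : ℝ) ^ (2 * i + 2)) * (1 - PowerSeries.X))⁻¹ ∈ integralSeries D := by
    have e : PowerSeries.C ((evenProd m j : ℤ) : ℝ) * ∏ i ∈ Finset.range j,
        (1 - PowerSeries.C ((m : ℝ) ^ (2 * i + 2)) * (1 - PowerSeries.X))⁻¹
        = ∏ i ∈ Finset.range j, (-(PowerSeries.C (1 - (m : ℝ) ^ (2 * i + 2)) *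
          (1 - PowerSeries.C ((m : ℝ) ^ (2 * i + 2)) * (1 - PowerSeries.X))⁻¹)) := by
      rw [evenProd, Int.cast_prod, map_prod, ← Finset.prod_mul_distrib]
      refine Finset.prod_congr rfl fun i _ => ?_
      push_cast
      rw [← neg_mul, ← map_neg, neg_sub]
    rw [e]
    refine Subring.prod_mem _ fun i hi => Subring.neg_mem _ ?_
    exact one_sub_inv_series_mem hm (by omega) (by have := Finset.mem_range.mp hi; omega)
  have hden2 : PowerSeries.C ((evenProd m (2 * N - j) : ℤ) : ℝ) * ∏ i ∈ Finset.range (2 * N - j),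
      (PowerSeries.C ((m : ℝ) ^ (2 * i + 2)) - (1 - PowerSeries.X))⁻¹ ∈ integralSeries D := by
    rw [evenProd, Int.cast_prod, map_prod, ← Finset.prod_mul_distrib]
    refine Subring.prod_mem _ fun i hi => ?_
    push_cast
    exact sub_one_inv_series_mem hm (by omega) (by have := Finset.mem_range.mp hi; omega)
  have hmid : PowerSeries.C ((m : ℝ) ^ localExp r b N j) * (1 - PowerSeries.X) ^ zeroOrder r b N *
      (PowerSeries.C ((m : ℝ) ^ (2 * N))
        - PowerSeries.C ((m : ℝ) ^ (2 * j)) * (1 - PowerSeries.X)) ∈ integralSeries D :=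
    Subring.mul_mem _ (Subring.mul_mem _ (hpow _) (Subring.pow_mem _ hone _))
      (Subring.sub_mem _ (hpow _) (Subring.mul_mem _ (hpow _) hone))
  have hall := Subring.mul_mem _ (Subring.mul_mem _ (Subring.mul_mem _ hmid hnum1) hnum2)
    (Subring.pow_mem _ (Subring.mul_mem _ (C_mem_integralSeries D Q)
      (Subring.mul_mem _ hden1 hden2)) (poleOrder r b))
  convert hall using 1
  have hQ' : ((evenProd m (2 * N) : ℤ) : ℝ)
      = ((evenProd m j : ℤ) : ℝ) * ((evenProd m (2 * N - j) : ℤ) : ℝ) * Q := by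
    rw [hQ]; push_cast; ring
  rw [localSeries, hQ', div_eq_mul_inv, two_mul r, pow_add, mul_inv]
  simp only [map_mul, map_pow]
  ring

/-! ### Size of the local expansions -/

/-- The sum of the absolute values of the first `A` coefficients. -/
noncomputable def seriesNorm (A : ℕ) (g : PowerSeries ℝ) : ℝ :=
  ∑ k ∈ Finset.range A, |PowerSeries.coeff k g|

theorem seriesNorm_nonneg (A : ℕ) (g : PowerSeries ℝ) : 0 ≤ seriesNorm A g :=
  Finset.sum_nonneg fun _ _ => abs_nonneg _

theorem abs_coeff_le_seriesNorm {A k : ℕ} (hk : k < A) (g : PowerSeries ℝ) :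
    |PowerSeries.coeff k g| ≤ seriesNorm A g :=
  Finset.single_le_sum (f := fun k => |PowerSeries.coeff k g|) (fun _ _ => abs_nonneg _)
    (Finset.mem_range.mpr hk)

theorem seriesNorm_mul_le (A : ℕ) (f g : PowerSeries ℝ) :
    seriesNorm A (f * g) ≤ seriesNorm A f * seriesNorm A g := by
  unfold seriesNorm
  rw [Finset.sum_mul_sum, ← Finset.sum_product']
  calc _ ≤ ∑ k ∈ Finset.range A, ∑ p ∈ Finset.range A ×ˢ Finset.range A with p.1 + p.2 = k,
        |PowerSeries.coeff p.1 f| * |PowerSeries.coeff p.2 g| := by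
        refine Finset.sum_le_sum fun k hk => ?_
        rw [PowerSeries.coeff_mul]
        refine (Finset.abs_sum_le_sum_abs _ _).trans ?_
        simp only [abs_mul]
        refine Finset.sum_le_sum_of_subset_of_nonneg ?_ fun _ _ _ => by positivity
        intro p hp
        have h1 := Finset.HasAntidiagonal.mem_antidiagonal.mp hp
        have h2 := Finset.mem_range.mp hk
        simp only [Finset.mem_filter, Finset.mem_product, Finset.mem_range]
        omega
    _ ≤ _ := Finset.sum_fiberwise_le_sum_of_sum_fiber_nonneg
        fun _ _ => Finset.sum_nonneg fun _ _ => by positivity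

theorem seriesNorm_C_le (A : ℕ) (u : ℝ) : seriesNorm A (PowerSeries.C u) ≤ |u| := by
  unfold seriesNorm
  rcases A with _ | A
  · simp
  · rw [Finset.sum_range_succ']
    simp [PowerSeries.coeff_C]

theorem seriesNorm_linear_le (A : ℕ) (u v : ℝ) :
    seriesNorm A (PowerSeries.C u + PowerSeries.C v * PowerSeries.X) ≤ |u| + |v| := by
  unfold seriesNorm
  rcases A with _ | _ | A
  · simp; positivity
  · simp
  · rw [Finset.sum_range_succ', Finset.sum_range_succ']
    have : ∀ k ∈ Finset.range A, |PowerSeries.coeff (k + 1 + 1)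
        (PowerSeries.C u + PowerSeries.C v * PowerSeries.X)| = 0 := by
      intro k _
      simp
    rw [Finset.sum_eq_zero this]
    simp [PowerSeries.coeff_C, add_comm]

theorem seriesNorm_inv_linear_le (A : ℕ) {u v : ℝ} (hu : u ≠ 0) (hv : |v / u| ≤ 2) :
    seriesNorm A (PowerSeries.C u + PowerSeries.C v * PowerSeries.X)⁻¹ ≤ |u|⁻¹ * 2 ^ A := by
  unfold seriesNorm
  rw [inv_linear_series hu]
  calc _ ≤ ∑ k ∈ Finset.range A, |u|⁻¹ * 2 ^ k := by
        refine Finset.sum_le_sum fun k _ => ?_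
        rw [PowerSeries.coeff_mk, abs_mul, abs_inv, abs_pow, abs_neg]
        gcongr
    _ ≤ |u|⁻¹ * 2 ^ A := by
        rw [← Finset.mul_sum, geom_sum_eq (by norm_num)]
        gcongr
        linarith

theorem seriesNorm_prod_le {ι : Type*} (A : ℕ) (s : Finset ι) (f : ι → PowerSeries ℝ) :
    seriesNorm A (∏ i ∈ s, f i) ≤ ∏ i ∈ s, seriesNorm A (f i) := by
  classical
  induction s using Finset.induction_on with
  | empty =>
    have := seriesNorm_C_le A 1
    simpa using this
  | insert i s hi ih =>
    rw [Finset.prod_insert hi, Finset.prod_insert hi]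
    exact (seriesNorm_mul_le _ _ _).trans
      (mul_le_mul_of_nonneg_left ih (seriesNorm_nonneg _ _))

theorem seriesNorm_pow_le (A : ℕ) (f : PowerSeries ℝ) (k : ℕ) :
    seriesNorm A (f ^ k) ≤ seriesNorm A f ^ k := by
  have := seriesNorm_prod_le A (Finset.range k) (fun _ => f)
  simpa using this

theorem abs_pow_sub_one_ge {m : ℤ} (hm : 2 ≤ |m|) {a : ℕ} (ha : 0 < a) :
    |(m : ℝ)| ^ a / 2 ≤ |(m : ℝ) ^ a - 1| := by
  have h1 : 2 ≤ |(m : ℝ)| ^ a := (two_le_abs_cast hm).trans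
    (le_self_pow₀ (by linarith [two_le_abs_cast hm]) ha.ne')
  have h2 := abs_sub_abs_le_abs_sub ((m : ℝ) ^ a) 1
  rw [abs_one, abs_pow] at h2
  linarith

theorem sum_two_mul_add (R c : ℕ) :
    ∑ i ∈ Finset.range R, (2 * i + (2 * c + 1)) = R ^ 2 + 2 * c * R := by
  induction R with
  | zero => simp
  | succ R ih => rw [Finset.sum_range_succ, ih]; ring

theorem sum_two_mul_add_two (R : ℕ) :
    ∑ i ∈ Finset.range R, (2 * i + 2) = R ^ 2 + R := by
  induction R with
  | zero => simp
  | succ R ih => rw [Finset.sum_range_succ, ih]; ring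

theorem prod_const_mul_pow {S : Type*} [CommMonoid S] (u x : S) (R : ℕ) (f : ℕ → ℕ) :
    ∏ i ∈ Finset.range R, (u * x ^ f i) = u ^ R * x ^ (∑ i ∈ Finset.range R, f i) := by
  rw [Finset.prod_mul_distrib, Finset.prod_pow_eq_pow_sum]
  simp

theorem seriesNorm_numerator_one_le {m : ℤ} (hm : 2 ≤ |m|) (A R j : ℕ) :
    seriesNorm A (∏ i ∈ Finset.range R,
      (1 - PowerSeries.C ((m : ℝ) ^ (2 * i + (2 * j + 1))) * (1 - PowerSeries.X)))
      ≤ 3 ^ R * |(m : ℝ)| ^ (R ^ 2 + 2 * j * R) := by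
  rw [← sum_two_mul_add, ← prod_const_mul_pow]
  refine (seriesNorm_prod_le _ _ _).trans (Finset.prod_le_prod (fun _ _ => seriesNorm_nonneg _ _)
    fun i _ => ?_)
  rw [linear_of_one_sub]
  refine (seriesNorm_linear_le _ _ _).trans ?_
  have h1 : 1 ≤ |(m : ℝ)| ^ (2 * i + (2 * j + 1)) :=
    one_le_pow₀ (by linarith [two_le_abs_cast hm])
  have h2 := abs_sub 1 ((m : ℝ) ^ (2 * i + (2 * j + 1)))
  rw [abs_one] at h2
  rw [abs_pow] at *
  linarith

theorem seriesNorm_numerator_two_le {m : ℤ} (hm : 2 ≤ |m|) (A R j : ℕ) :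
    seriesNorm A (∏ i ∈ Finset.range R,
      (PowerSeries.C ((m : ℝ) ^ (2 * i + (2 * j + 1))) - (1 - PowerSeries.X)))
      ≤ 3 ^ R * |(m : ℝ)| ^ (R ^ 2 + 2 * j * R) := by
  rw [← sum_two_mul_add, ← prod_const_mul_pow]
  refine (seriesNorm_prod_le _ _ _).trans (Finset.prod_le_prod (fun _ _ => seriesNorm_nonneg _ _)
    fun i _ => ?_)
  rw [linear_of_sub_one_sub]
  refine (seriesNorm_linear_le _ _ _).trans ?_
  have h1 : 1 ≤ |(m : ℝ)| ^ (2 * i + (2 * j + 1)) :=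
    one_le_pow₀ (by linarith [two_le_abs_cast hm])
  have h2 := abs_sub ((m : ℝ) ^ (2 * i + (2 * j + 1))) 1
  rw [abs_one] at *
  rw [abs_pow] at *
  linarith

theorem inv_abs_le_of_pow {m : ℤ} (hm : 2 ≤ |m|) {a : ℕ} (ha : 0 < a) :
    |(m : ℝ) ^ a - 1|⁻¹ ≤ 2 * |(m : ℝ)|⁻¹ ^ a := by
  have h1 := abs_pow_sub_one_ge hm ha
  have h2 : 0 < |(m : ℝ)| ^ a := by
    have := two_le_abs_cast hm
    positivity
  calc |(m : ℝ) ^ a - 1|⁻¹ ≤ (|(m : ℝ)| ^ a / 2)⁻¹ := by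
        gcongr
    _ = 2 * |(m : ℝ)|⁻¹ ^ a := by rw [inv_div, inv_pow]; ring

theorem seriesNorm_denominator_one_le {m : ℤ} (hm : 2 ≤ |m|) (A R : ℕ) :
    seriesNorm A (∏ i ∈ Finset.range R,
      (1 - PowerSeries.C ((m : ℝ) ^ (2 * i + 2)) * (1 - PowerSeries.X))⁻¹)
      ≤ (2 * 2 ^ A) ^ R * |(m : ℝ)|⁻¹ ^ (R ^ 2 + R) := by
  rw [← sum_two_mul_add_two, ← prod_const_mul_pow]
  refine (seriesNorm_prod_le _ _ _).trans (Finset.prod_le_prod (fun _ _ => seriesNorm_nonneg _ _)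
    fun i _ => ?_)
  have ha : 0 < 2 * i + 2 := by omega
  generalize 2 * i + 2 = a at ha
  have h1 := inv_abs_le_of_pow hm ha
  have h2 : 1 - (m : ℝ) ^ a ≠ 0 := by
    intro h; apply one_sub_pow_ne_zero hm ha.ne'; linarith
  rw [linear_of_one_sub]
  refine (seriesNorm_inv_linear_le _ h2 ?_).trans ?_
  · rw [abs_div, abs_sub_comm, div_le_iff₀ (abs_pos.mpr (one_sub_pow_ne_zero hm ha.ne')), abs_pow]
    have := abs_pow_sub_one_ge hm ha
    linarith
  · rw [abs_sub_comm]
    calc _ ≤ 2 * |(m : ℝ)|⁻¹ ^ a * 2 ^ A := by gcongr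
      _ = _ := by ring

theorem seriesNorm_denominator_two_le {m : ℤ} (hm : 2 ≤ |m|) (A R : ℕ) :
    seriesNorm A (∏ i ∈ Finset.range R,
      (PowerSeries.C ((m : ℝ) ^ (2 * i + 2)) - (1 - PowerSeries.X))⁻¹)
      ≤ (2 * 2 ^ A) ^ R * |(m : ℝ)|⁻¹ ^ (R ^ 2 + R) := by
  rw [← sum_two_mul_add_two, ← prod_const_mul_pow]
  refine (seriesNorm_prod_le _ _ _).trans (Finset.prod_le_prod (fun _ _ => seriesNorm_nonneg _ _)
    fun i _ => ?_)
  have ha : 0 < 2 * i + 2 := by omega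
  generalize 2 * i + 2 = a at ha
  have h1 := inv_abs_le_of_pow hm ha
  have h2 := one_sub_pow_ne_zero hm ha.ne'
  rw [linear_of_sub_one_sub]
  refine (seriesNorm_inv_linear_le _ h2 ?_).trans ?_
  · have h3 := abs_pow_sub_one_ge hm ha
    have h4 : 2 ≤ |(m : ℝ)| ^ a := (two_le_abs_cast hm).trans
      (le_self_pow₀ (by linarith [two_le_abs_cast hm]) ha.ne')
    rw [abs_div, abs_one, div_le_iff₀ (abs_pos.mpr h2)]
    linarith
  · calc _ ≤ 2 * |(m : ℝ)|⁻¹ ^ a * 2 ^ A := by gcongr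
      _ = _ := by ring

/-- With k = 2N - j one has j² + k² = 2N² + 2(N-j)², so the denominators outweigh A(N-j)² by at
least 2AN². -/
theorem localExp_le (r b N j : ℕ) (hj : j ≤ 2 * N) :
    localExp r b N j + 2 * poleOrder r b * N ^ 2
      ≤ 2 * N + poleOrder r b * ((j ^ 2 + j) + ((2 * N - j) ^ 2 + (2 * N - j))) := by
  obtain ⟨k, hk⟩ := Nat.exists_eq_add_of_le hj
  have h3 : 2 * N - j = k := by omega
  rw [localExp, h3]
  generalize poleOrder r b = A
  have h2 : (((N : ℤ) - j).natAbs : ℤ) ^ 2 = ((N : ℤ) - j) ^ 2 := Int.natAbs_sq _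
  have h5 : ((N : ℤ) - j).natAbs ^ 2 + 2 * N ^ 2 ≤ j ^ 2 + j + (k ^ 2 + k) := by
    zify at hk ⊢
    rw [← Int.natCast_natAbs, h2]
    have hkk : (k : ℤ) = 2 * N - j := by linarith
    rw [hkk]
    have : (0 : ℤ) ≤ N := by positivity
    nlinarith [sq_nonneg ((N : ℤ) - j)]
  have h6 := Nat.mul_le_mul_left A h5
  have h7 : k ≤ 2 * N := by omega
  calc _ = A * (((N : ℤ) - j).natAbs ^ 2 + 2 * N ^ 2) + k := by ring
    _ ≤ A * (j ^ 2 + j + (k ^ 2 + k)) + 2 * N := by gcongr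
    _ = _ := by ring

/-- Up to a factor exponential in N, every coefficient is at most |m|^((8r²+8r-2A)N²), uniformly in
the pole; the negative part of the exponent is moved to the left to keep exponents natural. The term
8r²+8r comes from the two numerator products, whose exponents add up independently of j. -/
theorem seriesNorm_localSeries_le {m : ℤ} (hm : 2 ≤ |m|) (r b N j : ℕ) (hj : j ≤ 2 * N) :
    seriesNorm (poleOrder r b) (localSeries m r b N j)
      * |(m : ℝ)| ^ (2 * poleOrder r b * N ^ 2)
      ≤ (2 ^ (3 * b + r + 1) * 3 ^ (4 * r + 1) * (2 * 2 ^ poleOrder r b) ^ (2 * poleOrder r b)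
          * |(m : ℝ)| ^ 6) ^ (N + 1) * |(m : ℝ)| ^ ((8 * r ^ 2 + 8 * r) * N ^ 2) := by
  set A := poleOrder r b with hA
  set M := |(m : ℝ)| with hM
  have hM2 : 2 ≤ M := two_le_abs_cast hm
  have hM1 : 1 ≤ M := by linarith
  have hM0 : 0 < M := by linarith
  set R := r * (2 * N) with hR
  have b1 : seriesNorm A (PowerSeries.C ((m : ℝ) ^ localExp r b N j)) ≤ M ^ localExp r b N j := by
    refine (seriesNorm_C_le _ _).trans ?_
    rw [abs_pow]
  have b2 : seriesNorm A ((1 - PowerSeries.X) ^ zeroOrder r b N) ≤ 2 ^ zeroOrder r b N := by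
    refine (seriesNorm_pow_le _ _ _).trans ?_
    have := seriesNorm_linear_le A 1 (-1)
    have e : (PowerSeries.C (1 : ℝ) + PowerSeries.C (-1) * PowerSeries.X) = 1 - PowerSeries.X := by
      simp [sub_eq_add_neg]
    rw [e] at this
    apply pow_le_pow_left₀ (seriesNorm_nonneg _ _)
    refine this.trans ?_
    norm_num
  have b3 : seriesNorm A (PowerSeries.C ((m : ℝ) ^ (2 * N))
      - PowerSeries.C ((m : ℝ) ^ (2 * j)) * (1 - PowerSeries.X)) ≤ 3 * M ^ (4 * N) := by
    have e : PowerSeries.C ((m : ℝ) ^ (2 * N))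
        - PowerSeries.C ((m : ℝ) ^ (2 * j)) * (1 - PowerSeries.X)
        = PowerSeries.C ((m : ℝ) ^ (2 * N) - (m : ℝ) ^ (2 * j))
          + PowerSeries.C ((m : ℝ) ^ (2 * j)) * PowerSeries.X := by
      rw [map_sub]; ring
    rw [e]
    refine (seriesNorm_linear_le _ _ _).trans ?_
    have h1 := abs_sub ((m : ℝ) ^ (2 * N)) ((m : ℝ) ^ (2 * j))
    rw [abs_pow (m : ℝ) (2 * N), abs_pow (m : ℝ) (2 * j)] at h1
    rw [abs_pow (m : ℝ) (2 * j)]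
    have h2 : M ^ (2 * N) ≤ M ^ (4 * N) := pow_le_pow_right₀ hM1 (by omega)
    have h3 : M ^ (2 * j) ≤ M ^ (4 * N) := pow_le_pow_right₀ hM1 (by omega)
    linarith
  have b4 := seriesNorm_numerator_one_le hm A R j
  have b5 := seriesNorm_numerator_two_le hm A R (2 * N - j)
  have b6 := seriesNorm_denominator_one_le hm A j
  have b7 := seriesNorm_denominator_two_le hm A (2 * N - j)
  have b8 := (seriesNorm_pow_le A _ A).trans (pow_le_pow_left₀ (seriesNorm_nonneg _ _)
    ((seriesNorm_mul_le A _ _).trans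
      (mul_le_mul b6 b7 (seriesNorm_nonneg _ _) (by positivity))) A)
  have ball : seriesNorm A (localSeries m r b N j) ≤ M ^ localExp r b N j * 2 ^ zeroOrder r b N *
      (3 * M ^ (4 * N)) * (3 ^ R * M ^ (R ^ 2 + 2 * j * R)) *
      (3 ^ R * M ^ (R ^ 2 + 2 * (2 * N - j) * R)) *
      ((2 * 2 ^ A) ^ j * M⁻¹ ^ (j ^ 2 + j) *
        ((2 * 2 ^ A) ^ (2 * N - j) * M⁻¹ ^ ((2 * N - j) ^ 2 + (2 * N - j)))) ^ A := by
    unfold localSeries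
    refine (seriesNorm_mul_le A _ _).trans (mul_le_mul ?_ b8 (seriesNorm_nonneg _ _) (by positivity))
    refine (seriesNorm_mul_le A _ _).trans (mul_le_mul ?_ b5 (seriesNorm_nonneg _ _) (by positivity))
    refine (seriesNorm_mul_le A _ _).trans (mul_le_mul ?_ b4 (seriesNorm_nonneg _ _) (by positivity))
    refine (seriesNorm_mul_le A _ _).trans (mul_le_mul ?_ b3 (seriesNorm_nonneg _ _) (by positivity))
    exact (seriesNorm_mul_le A _ _).trans (mul_le_mul b1 b2 (seriesNorm_nonneg _ _) (by positivity))
  have hexp := localExp_le r b N j hj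
  rw [← hA] at hexp
  set k := 2 * N - j with hk
  have hjk : j + k = 2 * N := by omega
  have e1 : ((2 * 2 ^ A) ^ j * M⁻¹ ^ (j ^ 2 + j) * ((2 * 2 ^ A) ^ k * M⁻¹ ^ (k ^ 2 + k))) ^ A
      = (2 * 2 ^ A) ^ (2 * A * N) * M⁻¹ ^ (A * ((j ^ 2 + j) + (k ^ 2 + k))) := by
    have : (2 * 2 ^ A : ℝ) ^ (2 * A * N) = ((2 * 2 ^ A) ^ j * (2 * 2 ^ A) ^ k) ^ A := by
      rw [← pow_add, hjk, ← pow_mul]; congr 1; ring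
    rw [this, mul_comm A (_ + _), pow_mul, pow_add, mul_pow, mul_pow, mul_pow, mul_pow, mul_pow]
    ring
  have e2 : M ^ (R ^ 2 + 2 * j * R) * M ^ (R ^ 2 + 2 * k * R) = M ^ ((8 * r ^ 2 + 8 * r) * N ^ 2) := by
    rw [← pow_add]
    congr 1
    have : R ^ 2 + 2 * j * R + (R ^ 2 + 2 * k * R) = 2 * R ^ 2 + 2 * (j + k) * R := by ring
    rw [this, hjk, hR]
    ring
  have e3 : M ^ localExp r b N j * M ^ (2 * A * N ^ 2)
      * M⁻¹ ^ (A * ((j ^ 2 + j) + (k ^ 2 + k))) ≤ M ^ (2 * N) := by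
    rw [← pow_add, inv_pow, ← div_eq_mul_inv, div_le_iff₀ (by positivity), ← pow_add]
    exact pow_le_pow_right₀ hM1 hexp
  have e4 : (2 : ℝ) ^ zeroOrder r b N ≤ (2 ^ (3 * b + r + 1)) ^ (N + 1) := by
    rw [← pow_mul]
    apply pow_le_pow_right₀ (by norm_num)
    unfold zeroOrder
    nlinarith [Nat.zero_le (b * N), Nat.zero_le (r * N)]
  have e5 : (3 : ℝ) * 3 ^ R * 3 ^ R ≤ (3 ^ (4 * r + 1)) ^ (N + 1) := by
    rw [← pow_mul, ← pow_succ', ← pow_add]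
    apply pow_le_pow_right₀ (by norm_num)
    rw [hR]
    nlinarith [Nat.zero_le (r * N)]
  have e6 : (2 * 2 ^ A : ℝ) ^ (2 * A * N) ≤ ((2 * 2 ^ A) ^ (2 * A)) ^ (N + 1) := by
    rw [← pow_mul]
    apply pow_le_pow_right₀
    · have : (1 : ℝ) ≤ 2 ^ A := one_le_pow₀ (by norm_num)
      linarith
    · nlinarith
  have e7 : M ^ (2 * N) * M ^ (4 * N) ≤ (M ^ 6) ^ (N + 1) := by
    rw [← pow_mul, ← pow_add]
    apply pow_le_pow_right₀ hM1
    omega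
  calc _ ≤ _ := mul_le_mul_of_nonneg_right ball (by positivity)
    _ = 2 ^ zeroOrder r b N * (3 * 3 ^ R * 3 ^ R) * (2 * 2 ^ A) ^ (2 * A * N) *
        ((M ^ localExp r b N j * M ^ (2 * A * N ^ 2)
          * M⁻¹ ^ (A * ((j ^ 2 + j) + (k ^ 2 + k)))) * M ^ (4 * N)) *
        (M ^ (R ^ 2 + 2 * j * R) * M ^ (R ^ 2 + 2 * k * R)) := by
        rw [e1]; ring
    _ ≤ (2 ^ (3 * b + r + 1)) ^ (N + 1) * (3 ^ (4 * r + 1)) ^ (N + 1) *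
        ((2 * 2 ^ A) ^ (2 * A)) ^ (N + 1) * (M ^ 6) ^ (N + 1) *
        M ^ ((8 * r ^ 2 + 8 * r) * N ^ 2) := by
        rw [e2]
        have e8 : (M ^ localExp r b N j * M ^ (2 * A * N ^ 2)
          * M⁻¹ ^ (A * ((j ^ 2 + j) + (k ^ 2 + k)))) * M ^ (4 * N) ≤ (M ^ 6) ^ (N + 1) :=
          (mul_le_mul_of_nonneg_right e3 (by positivity)).trans e7
        gcongr
    _ = _ := by rw [← mul_pow, ← mul_pow, ← mul_pow]

/-! ### The alternating sum as a linear form -/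

/-- `1 / (1 - q ^ a)` with `q = 1 / m`. -/
noncomputable def geoT (m : ℤ) (a : ℕ) : ℝ := 1 / (1 - ((m : ℝ)⁻¹) ^ a)

/-- `1 / (1 - q ^ (-a))` with `q = 1 / m`. -/
noncomputable def geoU (m : ℤ) (a : ℕ) : ℝ := 1 / (1 - (m : ℝ) ^ a)

theorem one_sub_inv_pow_ge {m : ℤ} (hm : 2 ≤ |m|) {a : ℕ} (ha : 0 < a) :
    1 / 2 ≤ 1 - ((m : ℝ)⁻¹) ^ a := by
  have h := (le_abs_self _).trans (abs_inv_pow_le hm a)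
  have h2 : (1 / 2 : ℝ) ^ a ≤ 1 / 2 := pow_le_of_le_one (by norm_num) (by norm_num) ha.ne'
  linarith

theorem geoU_eq {m : ℤ} (hm : 2 ≤ |m|) {a : ℕ} (ha : 0 < a) :
    geoU m a = -(((m : ℝ)⁻¹) ^ a * geoT m a) := by
  have h1 := one_sub_inv_pow_ge hm ha
  have h2 := one_sub_pow_ne_zero hm ha.ne'
  have h3 : (m : ℝ) ^ a ≠ 0 := pow_ne_zero _ (cast_ne_zero_of_two_le_abs hm)
  have h4 : 1 - (m : ℝ) ^ a ≠ 0 := fun h => h2 (by linarith)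
  unfold geoU geoT
  rw [inv_pow] at *
  have h5 : (1 : ℝ) - ((m : ℝ) ^ a)⁻¹ = ((m : ℝ) ^ a - 1) / (m : ℝ) ^ a := by field_simp
  rw [h5]
  field_simp
  ring

theorem geoU_eq_one_sub {m : ℤ} (hm : 2 ≤ |m|) {a : ℕ} (ha : 0 < a) : geoU m a = 1 - geoT m a := by
  rw [geoU_eq hm ha, geoT]
  have h1 := one_sub_inv_pow_ge hm ha
  have : 1 - ((m : ℝ)⁻¹) ^ a ≠ 0 := by linarith
  generalize ((m : ℝ)⁻¹) ^ a = u at *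
  field_simp
  ring

theorem abs_geoT_le {m : ℤ} (hm : 2 ≤ |m|) {a : ℕ} (ha : 0 < a) : |geoT m a| ≤ 2 := by
  have h1 := one_sub_inv_pow_ge hm ha
  unfold geoT
  rw [abs_of_nonneg (by apply div_nonneg <;> linarith), div_le_iff₀ (by linarith)]
  linarith

theorem abs_geoU_le {m : ℤ} (hm : 2 ≤ |m|) {a : ℕ} (ha : 0 < a) :
    |geoU m a| ≤ 2 * (1 / 2) ^ a := by
  rw [geoU_eq hm ha, abs_neg, abs_mul, mul_comm]
  exact mul_le_mul (abs_geoT_le hm ha) (abs_inv_pow_le hm a) (abs_nonneg _) (by norm_num)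

theorem abs_geoU_le_one {m : ℤ} (hm : 2 ≤ |m|) {a : ℕ} (ha : 0 < a) : |geoU m a| ≤ 1 := by
  refine (abs_geoU_le hm ha).trans ?_
  have h2 : (1 / 2 : ℝ) ^ a ≤ 1 / 2 := pow_le_of_le_one (by norm_num) (by norm_num) ha.ne'
  linarith

theorem abs_geoT_pow_sub_one_le {m : ℤ} (hm : 2 ≤ |m|) {a : ℕ} (ha : 0 < a) (s : ℕ) :
    |geoT m a ^ s - 1| ≤ (s * 2 ^ s * 2) * (1 / 2) ^ a := by
  rw [← geom_sum_mul, abs_mul]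
  have h1 : |∑ i ∈ Finset.range s, geoT m a ^ i| ≤ s * 2 ^ s := by
    refine (Finset.abs_sum_le_sum_abs _ _).trans ?_
    calc _ ≤ ∑ i ∈ Finset.range s, (2 : ℝ) ^ s := by
          refine Finset.sum_le_sum fun i hi => ?_
          rw [abs_pow]
          calc |geoT m a| ^ i ≤ 2 ^ i := pow_le_pow_left₀ (abs_nonneg _) (abs_geoT_le hm ha) _
            _ ≤ 2 ^ s := pow_le_pow_right₀ (by norm_num) (Finset.mem_range.mp hi).le
      _ = _ := by simp
  have h2 : |geoT m a - 1| ≤ 2 * (1 / 2) ^ a := by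
    rw [abs_sub_comm, ← geoU_eq_one_sub hm ha]
    exact abs_geoU_le hm ha
  calc _ ≤ (s * 2 ^ s) * (2 * (1 / 2 : ℝ) ^ a) :=
        mul_le_mul h1 h2 (abs_nonneg _) (by positivity)
    _ = _ := by ring

theorem summable_of_abs_le_half_pow {f : ℕ → ℝ} {C : ℝ}
    (hf : ∀ h, |f h| ≤ C * (1 / 2) ^ (2 * h + 1)) : Summable fun h => (-1 : ℝ) ^ h * f h := by
  have hC : 0 ≤ C := by
    have := (abs_nonneg _).trans (hf 0)
    simp at this
    linarith
  refine Summable.of_norm_bounded (summable_geometric_two.mul_left C) fun h => ?_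
  rw [norm_mul, norm_pow, norm_neg, norm_one, one_pow, one_mul, Real.norm_eq_abs]
  refine (hf h).trans ?_
  gcongr _ * ?_
  exact pow_le_pow_of_le_one (by norm_num) (by norm_num) (by omega)

theorem summable_geoT {m : ℤ} (hm : 2 ≤ |m|) (s : ℕ) :
    Summable fun h : ℕ => (-1 : ℝ) ^ h * (geoT m (2 * h + 1) ^ s - 1) :=
  summable_of_abs_le_half_pow fun h => abs_geoT_pow_sub_one_le hm (by omega) s

theorem summable_geoU {m : ℤ} (hm : 2 ≤ |m|) {s : ℕ} (hs : 1 ≤ s) :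
    Summable fun h : ℕ => (-1 : ℝ) ^ h * geoU m (2 * h + 1) ^ s := by
  refine summable_of_abs_le_half_pow (C := 2) fun h => ?_
  rw [abs_pow]
  exact (pow_le_of_le_one (abs_nonneg _) (abs_geoU_le_one hm (by omega)) (by omega)).trans
    (abs_geoU_le hm (by omega))

theorem tsum_alternating_shift {f : ℕ → ℝ} (hf : Summable fun h => (-1 : ℝ) ^ h * f h) (j : ℕ) :
    ∑' h, (-1 : ℝ) ^ h * f (h + j)
      = (-1) ^ j * (∑' h, (-1 : ℝ) ^ h * f h - ∑ h ∈ Finset.range j, (-1 : ℝ) ^ h * f h) := by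
  rw [← hf.sum_add_tsum_nat_add j, add_sub_cancel_left, ← tsum_mul_left]
  refine tsum_congr fun h => ?_
  have : (-1 : ℝ) ^ j * (-1) ^ j = 1 := by rw [← mul_pow]; simp
  rw [pow_add]
  linear_combination (-(-1 : ℝ) ^ h * f (h + j)) * this

theorem summable_alternating_shift {f : ℕ → ℝ} (hf : Summable fun h => (-1 : ℝ) ^ h * f h) (j : ℕ) :
    Summable fun h => (-1 : ℝ) ^ h * f (h + j) := by
  have h1 := ((summable_nat_add_iff j).mpr hf).mul_left ((-1 : ℝ) ^ j)
  refine h1.congr fun h => ?_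
  have : (-1 : ℝ) ^ j * (-1) ^ j = 1 := by rw [← mul_pow]; simp
  rw [pow_add]
  linear_combination ((-1 : ℝ) ^ h * f (h + j)) * this

/-- The numbers in which the linear forms are expressed. -/
noncomputable def formPeriod (m : ℤ) (s : ℕ) : ℝ :=
  ∑' h : ℕ, (-1 : ℝ) ^ h * (geoT m (2 * h + 1) ^ s + geoU m (2 * h + 1) ^ s - 1)

/-- The finite sums that occur in the constant terms of the linear forms. -/
noncomputable def formTail (m : ℤ) (N j s : ℕ) : ℝ :=
  ∑ h ∈ Finset.range j, (-1 : ℝ) ^ h * (geoT m (2 * h + 1) ^ s - 1)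
    + ∑ h ∈ Finset.range (2 * N - j), (-1 : ℝ) ^ h * geoU m (2 * h + 1) ^ s

/-- The small quantity: an alternating sum of values of `formFun`. -/
noncomputable def formSum (m : ℤ) (r b N : ℕ) : ℝ :=
  ∑' h : ℕ, (-1 : ℝ) ^ h * formFun m r b N (((m : ℝ)⁻¹) ^ (2 * h + 1))

theorem inv_pow_ne_pow {m : ℤ} (hm : 2 ≤ |m|) {a : ℕ} (ha : 0 < a) (k : ℕ) :
    ((m : ℝ)⁻¹) ^ a ≠ (m : ℝ) ^ k := by
  have h0 := cast_ne_zero_of_two_le_abs hm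
  intro h
  have h1 : (m : ℝ) ^ (a + k) = 1 := by
    rw [pow_add, ← h, inv_pow, mul_inv_cancel₀ (pow_ne_zero _ h0)]
  exact one_sub_pow_ne_zero hm (e := a + k) (by omega) (by rw [h1]; ring)

/-- Add the partial fraction expansions at x and at m^(4N)/x, equal by symmetry, and subtract the
vanishing sum of the coefficients. The first gives powers of T, the second powers of U. -/
theorem two_mul_formFun {m : ℤ} (hm : 2 ≤ |m|) {r : ℕ} (hr : 1 ≤ r) (b N h : ℕ) :
    2 * formFun m r b N (((m : ℝ)⁻¹) ^ (2 * h + 1))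
      = ∑ j ∈ Finset.range (2 * N + 1), ∑ k ∈ Finset.range (poleOrder r b),
        PowerSeries.coeff k (localSeries m r b N j) *
          ((geoT m (2 * (h + j) + 1) ^ (poleOrder r b - k) - 1)
            + geoU m (2 * (h + (2 * N - j)) + 1) ^ (poleOrder r b - k)) := by
  have h0 := cast_ne_zero_of_two_le_abs hm
  set x : ℝ := ((m : ℝ)⁻¹) ^ (2 * h + 1) with hx
  have hx0 : x ≠ 0 := pow_ne_zero _ (inv_ne_zero h0)
  have h1 := formFun_eq_sum hm hr b N (x := x) (fun j _ => inv_pow_ne_pow hm (by omega) _)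
  have hx' : (m : ℝ) ^ (4 * N) / x = (m : ℝ) ^ (4 * N + (2 * h + 1)) := by
    rw [hx, inv_pow, div_inv_eq_mul, ← pow_add]
  have h2 := formFun_eq_sum hm hr b N (x := (m : ℝ) ^ (4 * N) / x) (fun j hj => by
    rw [hx']
    intro hc
    have := pow_injective_of_two_le hm hc
    have := Finset.mem_range.mp hj
    omega)
  rw [formFun_symm hm r b N hx0] at h2
  have h3 := sum_coeff_localSeries hm hr b N
  have hsum : 2 * formFun m r b N x = formFun m r b N x + formFun m r b N x
      - ∑ j ∈ Finset.range (2 * N + 1), ∑ k ∈ Finset.range (poleOrder r b),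
        PowerSeries.coeff k (localSeries m r b N j) := by rw [h3]; ring
  rw [hsum]
  nth_rewrite 1 [h1]
  rw [h2]
  rw [← Finset.sum_add_distrib, ← Finset.sum_sub_distrib]
  refine Finset.sum_congr rfl fun j hj => ?_
  rw [← Finset.sum_add_distrib, ← Finset.sum_sub_distrib]
  refine Finset.sum_congr rfl fun k _ => ?_
  have hj' := Finset.mem_range.mp hj
  have e1 : 1 / (1 - x / (m : ℝ) ^ (2 * j)) = geoT m (2 * (h + j) + 1) := by
    unfold geoT
    rw [hx, div_eq_mul_inv x, ← inv_pow, ← pow_add]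
    congr 3
    ring
  have e2 : 1 / (1 - (m : ℝ) ^ (4 * N) / x / (m : ℝ) ^ (2 * j))
      = geoU m (2 * (h + (2 * N - j)) + 1) := by
    unfold geoU
    rw [hx', show 4 * N + (2 * h + 1) = (2 * (h + (2 * N - j)) + 1) + 2 * j by omega, pow_add,
      mul_div_cancel_right₀ _ (pow_ne_zero _ h0)]
  rw [e1, e2]
  ring

theorem formPeriod_eq {m : ℤ} (hm : 2 ≤ |m|) {s : ℕ} (hs : 1 ≤ s) :
    formPeriod m s = ∑' h : ℕ, (-1 : ℝ) ^ h * (geoT m (2 * h + 1) ^ s - 1)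
      + ∑' h : ℕ, (-1 : ℝ) ^ h * geoU m (2 * h + 1) ^ s := by
  rw [← (summable_geoT hm s).tsum_add (summable_geoU hm hs), formPeriod]
  exact tsum_congr fun h => by ring

theorem two_mul_formSum {m : ℤ} (hm : 2 ≤ |m|) {r : ℕ} (hr : 1 ≤ r) (b N : ℕ) :
    2 * formSum m r b N = ∑ j ∈ Finset.range (2 * N + 1), ∑ k ∈ Finset.range (poleOrder r b),
      PowerSeries.coeff k (localSeries m r b N j) * ((-1) ^ j *
        (formPeriod m (poleOrder r b - k) - formTail m N j (poleOrder r b - k))) := by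
  unfold formSum
  rw [← tsum_mul_left]
  have hterm : ∀ h : ℕ, 2 * ((-1 : ℝ) ^ h * formFun m r b N (((m : ℝ)⁻¹) ^ (2 * h + 1)))
      = ∑ j ∈ Finset.range (2 * N + 1), ∑ k ∈ Finset.range (poleOrder r b),
        (PowerSeries.coeff k (localSeries m r b N j) *
          ((-1 : ℝ) ^ h * (geoT m (2 * (h + j) + 1) ^ (poleOrder r b - k) - 1)
            + (-1 : ℝ) ^ h * geoU m (2 * (h + (2 * N - j)) + 1) ^ (poleOrder r b - k))) := by
    intro h
    rw [mul_left_comm, two_mul_formFun hm hr, Finset.mul_sum]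
    refine Finset.sum_congr rfl fun j _ => ?_
    rw [Finset.mul_sum]
    refine Finset.sum_congr rfl fun k _ => ?_
    ring
  simp_rw [hterm]
  have hT : ∀ j k, Summable fun h : ℕ =>
      (-1 : ℝ) ^ h * (geoT m (2 * (h + j) + 1) ^ (poleOrder r b - k) - 1) := fun j k =>
    summable_alternating_shift (f := fun h => geoT m (2 * h + 1) ^ (poleOrder r b - k) - 1)
      (summable_geoT hm _) j
  have hU : ∀ j, ∀ k ∈ Finset.range (poleOrder r b), Summable fun h : ℕ =>
      (-1 : ℝ) ^ h * geoU m (2 * (h + (2 * N - j)) + 1) ^ (poleOrder r b - k) := fun j k hk =>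
    summable_alternating_shift (f := fun h => geoU m (2 * h + 1) ^ (poleOrder r b - k))
      (summable_geoU hm (by have := Finset.mem_range.mp hk; omega)) (2 * N - j)
  have hs : ∀ j, ∀ k ∈ Finset.range (poleOrder r b), Summable fun h : ℕ =>
      PowerSeries.coeff k (localSeries m r b N j) *
          ((-1 : ℝ) ^ h * (geoT m (2 * (h + j) + 1) ^ (poleOrder r b - k) - 1)
            + (-1 : ℝ) ^ h * geoU m (2 * (h + (2 * N - j)) + 1) ^ (poleOrder r b - k)) :=
    fun j k hk => ((hT j k).add (hU j k hk)).mul_left _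
  rw [Summable.tsum_finsetSum fun j _ => summable_sum fun k hk => hs j k hk]
  refine Finset.sum_congr rfl fun j hj => ?_
  rw [Summable.tsum_finsetSum fun k hk => hs j k hk]
  refine Finset.sum_congr rfl fun k hk => ?_
  have hj' := Finset.mem_range.mp hj
  have hk' : 1 ≤ poleOrder r b - k := by have := Finset.mem_range.mp hk; omega
  rw [tsum_mul_left, (hT j k).tsum_add (hU j k hk),
    tsum_alternating_shift (f := fun h => geoT m (2 * h + 1) ^ (poleOrder r b - k) - 1)
      (summable_geoT hm _) j,
    tsum_alternating_shift (f := fun h => geoU m (2 * h + 1) ^ (poleOrder r b - k))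
      (summable_geoU hm hk') (2 * N - j), formPeriod_eq hm hk', formTail]
  -- The shifts by j and by 2N - j carry the same sign because 2N is even; hence the T-series and
  -- the U-series merge into `formPeriod`.
  have hsign : (-1 : ℝ) ^ (2 * N - j) = (-1) ^ j := by
    have h1 : (-1 : ℝ) ^ (2 * N - j) * (-1) ^ j = 1 := by
      rw [← pow_add, Nat.sub_add_cancel (by omega), pow_mul]; simp
    have h2 : (-1 : ℝ) ^ j * (-1) ^ j = 1 := by rw [← mul_pow]; simp
    have h3 : (-1 : ℝ) ^ j ≠ 0 := pow_ne_zero _ (by norm_num)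
    exact mul_right_cancel₀ h3 (h1.trans h2.symm)
  rw [hsign]
  ring

/-! ### The periods as combinations of even beta values -/

/-- The real counterpart of `qBeta q (i + 1)`. -/
noncomputable def realBeta (q : ℝ) (i : ℕ) : ℝ := ∑' K : ℕ, (K : ℝ) ^ i * (q ^ K / (1 + q ^ (2 * K)))

theorem qBeta_ofReal (q : ℝ) {i : ℕ} (hi : 1 ≤ i) :
    qBeta (q : ℂ) (i + 1) = (realBeta q i : ℂ) := by
  unfold qBeta realBeta
  rw [Complex.ofReal_tsum]
  -- For i ≥ 1 the term K = 0 vanishes, so summing over all naturals changes nothing.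
  have h := PNat.coe_injective.tsum_eq
    (f := fun K : ℕ => (((K : ℝ) ^ i * (q ^ K / (1 + q ^ (2 * K))) : ℝ) : ℂ)) (by
      intro K hK
      rcases Nat.eq_zero_or_pos K with rfl | h
      · exfalso
        apply hK
        simp [show i ≠ 0 by omega]
      · exact ⟨⟨K, h⟩, rfl⟩)
  rw [← h]
  refine tsum_congr fun K => ?_
  push_cast
  simp

/-- The series `∑ K ^ i x ^ K`. -/
noncomputable def powSum (i : ℕ) (x : ℝ) : ℝ := ∑' K : ℕ, (K : ℝ) ^ i * x ^ K

theorem summable_powSum (i : ℕ) {x : ℝ} (hx : |x| < 1) :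
    Summable fun K : ℕ => (K : ℝ) ^ i * x ^ K :=
  summable_pow_mul_geometric_of_norm_lt_one i (by simpa using hx)

theorem summable_double {m : ℤ} (hm : 2 ≤ |m|) {i : ℕ} (hi : 1 ≤ i) :
    Summable fun p : ℕ × ℕ =>
      (-1 : ℝ) ^ p.1 * ((p.2 : ℝ) ^ i * (((m : ℝ)⁻¹) ^ (2 * p.1 + 1)) ^ p.2) := by
  have h1 : Summable fun K : ℕ => (K : ℝ) ^ i * (1 / 2 : ℝ) ^ K :=
    summable_powSum i (by rw [abs_of_pos] <;> norm_num)
  have h2 := summable_geometric_two.mul_of_nonneg h1 (fun _ => by positivity)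
    (fun _ => by positivity)
  refine Summable.of_norm_bounded h2 fun p => ?_
  obtain ⟨h, K⟩ := p
  simp only
  rcases Nat.eq_zero_or_pos K with rfl | hK
  · simp [show i ≠ 0 by omega]
  rw [norm_mul, norm_pow, norm_neg, norm_one, one_pow, one_mul, norm_mul, Real.norm_eq_abs,
    Real.norm_eq_abs, abs_of_nonneg (by positivity : (0 : ℝ) ≤ (K : ℝ) ^ i), ← pow_mul]
  have h3 := abs_inv_pow_le hm ((2 * h + 1) * K)
  have h4 : (1 / 2 : ℝ) ^ ((2 * h + 1) * K) ≤ (1 / 2) ^ (h + K) := by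
    apply pow_le_pow_of_le_one (by norm_num) (by norm_num)
    nlinarith
  calc _ ≤ (K : ℝ) ^ i * (1 / 2) ^ (h + K) := by gcongr; exact h3.trans h4
    _ = _ := by rw [pow_add]; ring

theorem tsum_alternating_pow {m : ℤ} (hm : 2 ≤ |m|) {K : ℕ} (hK : 0 < K) :
    ∑' h : ℕ, (-1 : ℝ) ^ h * (((m : ℝ)⁻¹) ^ (2 * h + 1)) ^ K
      = ((m : ℝ)⁻¹) ^ K / (1 + ((m : ℝ)⁻¹) ^ (2 * K)) := by
  set q := (m : ℝ)⁻¹ with hq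
  have e : ∀ h : ℕ, (-1 : ℝ) ^ h * (q ^ (2 * h + 1)) ^ K = q ^ K * (-(q ^ (2 * K))) ^ h := by
    intro h
    rw [neg_pow (q ^ (2 * K)), ← pow_mul, ← pow_mul]
    ring
  simp_rw [e]
  rw [tsum_mul_left, tsum_geometric_of_norm_lt_one, sub_neg_eq_add, div_eq_mul_inv]
  rw [norm_neg, Real.norm_eq_abs]
  refine (abs_inv_pow_le hm _).trans_lt ?_
  exact pow_lt_one₀ (by norm_num) (by norm_num) (by omega)

/-- Expand q^K/(1+q^(2K)) as the alternating geometric series of q^((2h+1)K) and exchange the two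
absolutely convergent sums. -/
theorem realBeta_eq {m : ℤ} (hm : 2 ≤ |m|) {i : ℕ} (hi : 1 ≤ i) :
    realBeta (m : ℝ)⁻¹ i
      = ∑' h : ℕ, (-1 : ℝ) ^ h * powSum i (((m : ℝ)⁻¹) ^ (2 * h + 1)) := by
  have hs := summable_double hm hi
  have hcomm := hs.tsum_comm (f := fun (h K : ℕ) =>
      (-1 : ℝ) ^ h * ((K : ℝ) ^ i * (((m : ℝ)⁻¹) ^ (2 * h + 1)) ^ K))
  unfold realBeta powSum
  simp_rw [← tsum_mul_left]
  rw [← hcomm]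
  refine tsum_congr fun K => ?_
  rcases Nat.eq_zero_or_pos K with rfl | hK
  · simp [show i ≠ 0 by omega]
  · rw [← tsum_alternating_pow hm hK, ← tsum_mul_left]
    exact tsum_congr fun h => by ring

theorem summable_powSum_alternating {m : ℤ} (hm : 2 ≤ |m|) {i : ℕ} (hi : 1 ≤ i) :
    Summable fun h : ℕ => (-1 : ℝ) ^ h * powSum i (((m : ℝ)⁻¹) ^ (2 * h + 1)) := by
  have := (summable_double hm hi).prod
  refine this.congr fun h => ?_
  rw [powSum, ← tsum_mul_left]

/-- The polynomial `(X + 1) (X + 2) ⋯ (X + s)`. -/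
noncomputable def risingPoly (s : ℕ) : Polynomial ℚ :=
  (ascPochhammer ℚ s).comp (Polynomial.X + 1)

theorem risingPoly_natDegree_le (s : ℕ) : (risingPoly s).natDegree < s + 1 := by
  unfold risingPoly
  refine Nat.lt_succ_of_le (Polynomial.natDegree_comp_le.trans ?_)
  have : (Polynomial.X + 1 : Polynomial ℚ).natDegree = 1 := Polynomial.natDegree_X_add_C 1
  rw [this, ascPochhammer_natDegree, mul_one]

theorem risingPoly_eval (s K : ℕ) :
    (risingPoly s).eval (K : ℚ) = s.factorial * (K + s).choose s := by
  unfold risingPoly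
  rw [Polynomial.eval_comp]
  have : (Polynomial.X + 1 : Polynomial ℚ).eval (K : ℚ) = ((K + 1 : ℕ) : ℚ) := by simp
  rw [this, ascPochhammer_nat_eq_natCast_ascFactorial, Nat.ascFactorial_eq_factorial_mul_choose]
  push_cast
  ring

theorem risingPoly_eval_neg (s K : ℕ) :
    (risingPoly s).eval (-((K + 1 : ℕ) : ℚ)) = (-1) ^ s * (s.factorial * K.choose s) := by
  unfold risingPoly
  rw [Polynomial.eval_comp]
  have : (Polynomial.X + 1 : Polynomial ℚ).eval (-((K + 1 : ℕ) : ℚ)) = -(K : ℚ) := by simp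
  rw [this, ascPochhammer_eval_neg_eq_descPochhammer, descPochhammer_eval_eq_descFactorial,
    Nat.descFactorial_eq_factorial_mul_choose]
  push_cast
  ring

/-- Both binomials come from one polynomial p = (X+1)⋯(X+s): p(K) is s! times the first and p(-K) is
(-1)^s s! times the second. So the left side is p(K) - p(-K), whose even coefficients vanish. -/
theorem risingPoly_odd_part (s K : ℕ) :
    ∑ i ∈ Finset.range (s + 1), ((risingPoly s).coeff i * (1 - (-1) ^ i) : ℚ) * (K : ℚ) ^ i
      = s.factorial * if K = 0 then 0 else
          (((K + s).choose s : ℚ) + (-1) ^ (s + 1) * ((K - 1).choose s : ℚ)) := by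
  have h1 : ∑ i ∈ Finset.range (s + 1), ((risingPoly s).coeff i * (1 - (-1) ^ i) : ℚ) * (K : ℚ) ^ i
      = (risingPoly s).eval (K : ℚ) - (risingPoly s).eval (-(K : ℚ)) := by
    rw [Polynomial.eval_eq_sum_range' (risingPoly_natDegree_le s),
      Polynomial.eval_eq_sum_range' (risingPoly_natDegree_le s), ← Finset.sum_sub_distrib]
    refine Finset.sum_congr rfl fun i _ => ?_
    rw [neg_pow (K : ℚ)]
    ring
  rw [h1]
  rcases K with _ | K
  · simp
  · rw [risingPoly_eval, risingPoly_eval_neg, if_neg (by omega), Nat.add_sub_cancel]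
    ring

theorem hasSum_geoT {m : ℤ} (hm : 2 ≤ |m|) {a : ℕ} (ha : 0 < a) (s : ℕ) :
    HasSum (fun K : ℕ => (if K = 0 then 0 else
        (((K + s).choose s : ℝ) + (-1) ^ (s + 1) * ((K - 1).choose s : ℝ))) *
          (((m : ℝ)⁻¹) ^ a) ^ K)
      (geoT m a ^ (s + 1) + geoU m a ^ (s + 1) - 1) := by
  set x : ℝ := ((m : ℝ)⁻¹) ^ a with hx
  have hx1 : ‖x‖ < 1 := by
    rw [Real.norm_eq_abs]
    exact (abs_inv_pow_le hm a).trans_lt (pow_lt_one₀ (by norm_num) (by norm_num) ha.ne')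
  have hT : HasSum (fun K : ℕ => ((K + s).choose s : ℝ) * x ^ K) (geoT m a ^ (s + 1)) := by
    have := hasSum_choose_mul_geometric_of_norm_lt_one s hx1
    unfold geoT
    rwa [div_pow, one_pow]
  have hone : HasSum (fun K : ℕ => if K = 0 then (1 : ℝ) else 0) 1 := by
    simpa using hasSum_ite_eq (0 : ℕ) (1 : ℝ)
  have hU : HasSum (fun K : ℕ => (if K = 0 then 0 else
      (-1 : ℝ) ^ (s + 1) * ((K - 1).choose s : ℝ)) * x ^ K) (geoU m a ^ (s + 1)) := by
    have h1 := hT.mul_left ((-1 : ℝ) ^ (s + 1) * x ^ (s + 1))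
    have e : (-1 : ℝ) ^ (s + 1) * x ^ (s + 1) * geoT m a ^ (s + 1) = geoU m a ^ (s + 1) := by
      rw [geoU_eq hm ha, ← hx, neg_pow (x * _), mul_pow]
      ring
    rw [e] at h1
    -- U = -xT, so the series of U^(s+1) starts at K = s + 1; for 0 < K ≤ s the binomial is 0. K = 0
    -- has to be excluded by hand because the truncated `0 - 1` would give 1 when s = 0.
    rw [← hasSum_nat_add_iff' (s + 1)]
    rw [Finset.sum_eq_zero, sub_zero]
    · refine h1.congr_fun fun K => ?_
      rw [if_neg (by omega), show K + (s + 1) - 1 = K + s by omega, pow_add x K]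
      ring
    · intro K hK
      have hK' := Finset.mem_range.mp hK
      split_ifs with h0
      · simp
      · rw [Nat.choose_eq_zero_of_lt (by omega)]
        simp
  have := (hT.add hU).sub hone
  refine this.congr_fun fun K => ?_
  split_ifs with h0
  · simp [h0]
  · ring

/-- Twice the odd part of `risingPoly s`: its coefficients, as real numbers. -/
noncomputable def oddCoeff (s i : ℕ) : ℚ := (risingPoly s).coeff i * (1 - (-1) ^ i)

theorem oddCoeff_of_even {s i : ℕ} (hi : Even i) : oddCoeff s i = 0 := by
  simp [oddCoeff, hi.neg_one_pow]

theorem factorial_mul_geoT {m : ℤ} (hm : 2 ≤ |m|) {a : ℕ} (ha : 0 < a) (s : ℕ) :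
    (s.factorial : ℝ) * (geoT m a ^ (s + 1) + geoU m a ^ (s + 1) - 1)
      = ∑ i ∈ Finset.range (s + 1), (oddCoeff s i : ℝ) * powSum i (((m : ℝ)⁻¹) ^ a) := by
  have hx1 : |((m : ℝ)⁻¹) ^ a| < 1 :=
    (abs_inv_pow_le hm a).trans_lt (pow_lt_one₀ (by norm_num) (by norm_num) ha.ne')
  have h1 := (hasSum_geoT hm ha s).mul_left (s.factorial : ℝ)
  have h2 : HasSum (fun K : ℕ => ∑ i ∈ Finset.range (s + 1),
      (oddCoeff s i : ℝ) * ((K : ℝ) ^ i * (((m : ℝ)⁻¹) ^ a) ^ K))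
      (∑ i ∈ Finset.range (s + 1), (oddCoeff s i : ℝ) * powSum i (((m : ℝ)⁻¹) ^ a)) :=
    hasSum_sum fun i _ => (summable_powSum i hx1).hasSum.mul_left _
  refine h1.unique (h2.congr_fun fun K => ?_)
  have h3 := congrArg (fun t : ℚ => (t : ℝ)) (risingPoly_odd_part s K)
  rw [← mul_assoc]
  have h4 : (s.factorial : ℝ) * (if K = 0 then 0 else
        (((K + s).choose s : ℝ) + (-1) ^ (s + 1) * ((K - 1).choose s : ℝ)))
      = ∑ i ∈ Finset.range (s + 1), (oddCoeff s i : ℝ) * (K : ℝ) ^ i := by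
    unfold oddCoeff
    push_cast at h3 ⊢
    rw [h3]
    congr 1
    split_ifs <;> push_cast <;> rfl
  rw [h4, Finset.sum_mul]
  exact Finset.sum_congr rfl fun i _ => by ring

theorem factorial_mul_formPeriod {m : ℤ} (hm : 2 ≤ |m|) (s : ℕ) :
    (s.factorial : ℝ) * formPeriod m (s + 1)
      = ∑ i ∈ Finset.range (s + 1), (oddCoeff s i : ℝ) * realBeta (m : ℝ)⁻¹ i := by
  have hs : ∀ i, Summable fun h : ℕ =>
      (oddCoeff s i : ℝ) * ((-1 : ℝ) ^ h * powSum i (((m : ℝ)⁻¹) ^ (2 * h + 1))) := by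
    intro i
    -- The alternating series of `powSum 0` diverges, since its values tend to 1; its coefficient is
    -- zero because 0 is even.
    rcases Nat.eq_zero_or_pos i with rfl | hi
    · simp [oddCoeff_of_even]
    · exact (summable_powSum_alternating hm hi).mul_left _
  unfold formPeriod
  rw [← tsum_mul_left]
  calc _ = ∑' h : ℕ, ∑ i ∈ Finset.range (s + 1),
        (oddCoeff s i : ℝ) * ((-1 : ℝ) ^ h * powSum i (((m : ℝ)⁻¹) ^ (2 * h + 1))) := by
        refine tsum_congr fun h => ?_
        rw [mul_left_comm, factorial_mul_geoT hm (by omega), Finset.mul_sum]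
        exact Finset.sum_congr rfl fun i _ => by ring
    _ = _ := by
        rw [Summable.tsum_finsetSum fun i _ => hs i]
        refine Finset.sum_congr rfl fun i _ => ?_
        rw [tsum_mul_left]
        rcases Nat.eq_zero_or_pos i with rfl | hi
        · simp [oddCoeff_of_even]
        · rw [realBeta_eq hm hi]

/-! ### The spaces spanned by beta values -/

/-- The real counterpart of `qBetaSpace`. -/
noncomputable def realBetaSpace (q : ℝ) (A : ℕ) : Submodule ℚ ℝ :=
  Submodule.span ℚ (insert 1 ((fun s => realBeta q (s - 1)) '' {s | Even s ∧ 2 ≤ s ∧ s ≤ A - 1}))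

theorem formPeriod_mem {m : ℤ} (hm : 2 ≤ |m|) {A s : ℕ} (hA : Odd A) (hs : 1 ≤ s) (hsA : s ≤ A) :
    formPeriod m s ∈ realBetaSpace (m : ℝ)⁻¹ A := by
  obtain ⟨s, rfl⟩ := Nat.exists_eq_add_of_le' hs
  have h := factorial_mul_formPeriod hm s
  have hf : (s.factorial : ℝ) ≠ 0 := by exact_mod_cast s.factorial_ne_zero
  have h1 : formPeriod m (s + 1) = ((s.factorial : ℚ)⁻¹) • ∑ i ∈ Finset.range (s + 1),
      (oddCoeff s i) • realBeta (m : ℝ)⁻¹ i := by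
    simp only [Rat.smul_def]
    rw [← h]
    push_cast
    rw [inv_mul_cancel_left₀ hf]
  rw [h1]
  refine Submodule.smul_mem _ _ (Submodule.sum_mem _ fun i hi => ?_)
  rcases Nat.even_or_odd i with he | ho
  · rw [oddCoeff_of_even he, zero_smul]
    exact Submodule.zero_mem _
  · refine Submodule.smul_mem _ _ (Submodule.subset_span (Set.mem_insert_of_mem _ ?_))
    have hi' := Finset.mem_range.mp hi
    refine ⟨i + 1, ⟨ho.add_one, ?_, ?_⟩, by simp⟩
    · have := ho.pos; omega
    -- i + 1 ≤ A with i + 1 even and A odd gives i + 1 ≤ A - 1.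
    · obtain ⟨k, rfl⟩ := hA
      obtain ⟨l, rfl⟩ := ho
      omega

theorem qBetaSpace_eq_map (q : ℝ) (A : ℕ) :
    qBetaSpace (q : ℂ) A
      = (realBetaSpace q A).map (Complex.ofRealAm.toLinearMap.restrictScalars ℚ) := by
  unfold qBetaSpace realBetaSpace
  rw [Submodule.map_span, Set.image_insert_eq, Set.image_image]
  have h : qBeta (q : ℂ) '' {s | Even s ∧ 2 ≤ s ∧ s ≤ A - 1}
      = (fun s => (realBeta q (s - 1) : ℂ)) '' {s | Even s ∧ 2 ≤ s ∧ s ≤ A - 1} := by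
    refine Set.image_congr fun s hs => ?_
    obtain ⟨-, h2, -⟩ := hs
    have := qBeta_ofReal q (i := s - 1) (by omega)
    rwa [Nat.sub_add_cancel (by omega)] at this
  rw [h]
  simp

theorem finrank_qBetaSpace (q : ℝ) (A : ℕ) :
    Module.finrank ℚ (qBetaSpace (q : ℂ) A) = Module.finrank ℚ (realBetaSpace q A) := by
  rw [qBetaSpace_eq_map]
  refine (LinearEquiv.finrank_eq (Submodule.equivMapOfInjective _ ?_ _)).symm
  intro x y h
  simpa using h

theorem finiteDimensional_realBetaSpace (q : ℝ) (A : ℕ) :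
    FiniteDimensional ℚ (realBetaSpace q A) := by
  refine FiniteDimensional.span_of_finite ℚ (Set.Finite.insert _ (Set.Finite.image _ ?_))
  exact (Set.finite_Iic (A - 1)).subset fun s hs => hs.2.2

/-! ### Growth of the common denominator -/

theorem tendsto_div_sq_of_abs_sub_le {f g : ℕ → ℝ} {C l : ℝ}
    (h : ∀ᶠ N : ℕ in atTop, |f N - g N| ≤ C * (N + 1))
    (hg : Tendsto (fun N : ℕ => g N / (N : ℝ) ^ 2) atTop (𝓝 l)) :
    Tendsto (fun N : ℕ => f N / (N : ℝ) ^ 2) atTop (𝓝 l) := by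
  have h0 : Tendsto (fun N : ℕ => (2 * |C|) * (1 / (N : ℝ))) atTop (𝓝 (2 * |C| * 0)) :=
    tendsto_one_div_atTop_nhds_zero_nat.const_mul _
  rw [mul_zero] at h0
  have h1 : Tendsto (fun N : ℕ => f N / (N : ℝ) ^ 2 - g N / (N : ℝ) ^ 2) atTop (𝓝 0) := by
    refine squeeze_zero_norm' ?_ h0
    filter_upwards [eventually_gt_atTop 0, h] with N hN hfg
    have hN' : (0 : ℝ) < N := by exact_mod_cast hN
    have hN1 : (1 : ℝ) ≤ N := by exact_mod_cast hN
    rw [← sub_div, Real.norm_eq_abs, abs_div,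
      abs_of_pos (by positivity : (0 : ℝ) < (N : ℝ) ^ 2), div_le_iff₀ (by positivity)]
    have e : 2 * |C| * (1 / (N : ℝ)) * (N : ℝ) ^ 2 = |C| * (2 * N) := by field_simp
    rw [e]
    refine hfg.trans ?_
    calc C * ((N : ℝ) + 1) ≤ |C| * (N + 1) := by gcongr; exact le_abs_self C
      _ ≤ |C| * (2 * N) := by gcongr; linarith
  have := h1.add hg
  simpa using this

theorem tendsto_quadratic_div_sq (a b c : ℝ) :
    Tendsto (fun N : ℕ => (a * (N : ℝ) ^ 2 + b * N + c) / (N : ℝ) ^ 2) atTop (𝓝 a) := by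
  refine tendsto_div_sq_of_abs_sub_le (g := fun N => a * (N : ℝ) ^ 2) (C := |b| + |c|)
    (Eventually.of_forall fun N => ?_) ?_
  · have : a * (N : ℝ) ^ 2 + b * N + c - a * (N : ℝ) ^ 2 = b * N + c := by ring
    rw [this]
    refine (abs_add_le _ _).trans ?_
    rw [abs_mul, abs_of_nonneg (Nat.cast_nonneg N : (0 : ℝ) ≤ N)]
    have : (0 : ℝ) ≤ N := Nat.cast_nonneg N
    nlinarith [abs_nonneg b, abs_nonneg c]
  · refine tendsto_const_nhds.congr' ?_
    filter_upwards [eventually_gt_atTop 0] with N hN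
    have : (N : ℝ) ≠ 0 := by positivity
    field_simp

theorem abs_log_prod_pow_sub_one_le {m : ℤ} (hm : 2 ≤ |m|) (s : Finset ℕ) (f : ℕ → ℕ)
    (hf : ∀ i ∈ s, f i ≠ 0) :
    |Real.log |((∏ i ∈ s, (m ^ f i - 1) : ℤ) : ℝ)|
      - ((∑ i ∈ s, f i : ℕ) : ℝ) * (Real.log |(m : ℝ)|)| ≤ s.card := by
  rw [Int.cast_prod, Finset.abs_prod, Real.log_prod, Nat.cast_sum, Finset.sum_mul,
    ← Finset.sum_sub_distrib]
  · refine (Finset.abs_sum_le_sum_abs _ _).trans ?_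
    refine (Finset.sum_le_card_nsmul _ _ 1 fun i hi => ?_).trans (by simp)
    refine (abs_log_pow_sub_one_sub_le hm (hf i hi)).trans ?_
    have : (1 / 2 : ℝ) ^ f i ≤ 1 / 2 := pow_le_of_le_one (by norm_num) (by norm_num) (hf i hi)
    linarith
  · intro i hi
    rw [abs_ne_zero, Int.cast_ne_zero]
    exact pow_sub_one_ne_zero hm (hf i hi)

theorem tendsto_log_evenProd {m : ℤ} (hm : 2 ≤ |m|) :
    Tendsto (fun N : ℕ => Real.log |((evenProd m (2 * N) : ℤ) : ℝ)| / (N : ℝ) ^ 2) atTop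
      (𝓝 (4 * Real.log |(m : ℝ)|)) := by
  refine tendsto_div_sq_of_abs_sub_le (C := 2) (Eventually.of_forall fun N => ?_)
    (tendsto_quadratic_div_sq (4 * Real.log |(m : ℝ)|) (2 * Real.log |(m : ℝ)|) 0)
  have h := abs_log_prod_pow_sub_one_le hm (Finset.range (2 * N)) (fun i => 2 * i + 2)
    (fun i _ => by omega)
  rw [sum_two_mul_add_two, Finset.card_range] at h
  push_cast at h
  have e : 4 * Real.log |(m : ℝ)| * (N : ℝ) ^ 2 + 2 * Real.log |(m : ℝ)| * N + 0
      = ((2 * (N : ℝ)) ^ 2 + 2 * N) * Real.log |(m : ℝ)| := by ring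
  rw [e, evenProd]
  push_cast
  linarith

theorem tendsto_log_oddPartProd {m : ℤ} (hm : 2 ≤ |m|) :
    Tendsto (fun N : ℕ => Real.log |((oddPartProd m (2 * N) : ℤ) : ℝ)| / (N : ℝ) ^ 2) atTop
      (𝓝 (4 / 3 * Real.log |(m : ℝ)|)) := by
  set lm := Real.log |(m : ℝ)| with hlm
  have hlm0 : 0 ≤ lm := Real.log_nonneg (by linarith [two_le_abs_cast hm])
  refine tendsto_div_sq_of_abs_sub_le (C := 2 + 2 * lm) (Eventually.of_forall fun N => ?_)
    (tendsto_quadratic_div_sq (4 / 3 * lm) 0 0)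
  have h := abs_log_prod_pow_sub_one_le hm (Finset.Ioc 0 (2 * N)) (fun j => ordCompl[2] j)
    (fun j hj => (Nat.ordCompl_pos 2 (Finset.mem_Ioc.mp hj).1.ne').ne')
  rw [← oddPartProd_eq, ← hlm, Nat.card_Ioc, Nat.sub_zero] at h
  obtain ⟨h1, h2⟩ := sum_ordCompl_two_bounds (2 * N)
  generalize (∑ j ∈ Finset.Ioc 0 (2 * N), ordCompl[2] j) = S at *
  have h1' : ((2 * N : ℕ) : ℝ) ^ 2 ≤ 3 * S := by exact_mod_cast h1
  have h2' : 3 * (S : ℝ) ≤ ((2 * N : ℕ) : ℝ) ^ 2 + 3 * (2 * N : ℕ) := by exact_mod_cast h2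
  push_cast at h h1' h2'
  have hN : (0 : ℝ) ≤ N := Nat.cast_nonneg N
  have h3 : 4 / 3 * (N : ℝ) ^ 2 * lm ≤ S * lm := by gcongr; linarith
  have h4 : S * lm ≤ (4 / 3 * (N : ℝ) ^ 2 + 2 * N) * lm := by gcongr; linarith
  rw [abs_le] at h ⊢
  constructor <;> nlinarith

theorem tendsto_log_cycProd {m : ℤ} (hm : 2 ≤ |m|) :
    Tendsto (fun N : ℕ => Real.log |((cycProd m (2 * N) : ℤ) : ℝ)| / (N : ℝ) ^ 2) atTop
      (𝓝 (48 / Real.pi ^ 2 * Real.log |(m : ℝ)|)) := by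
  have h := tendsto_log_prod_cyclotomic hm (fun N => Finset.Ioc 0 N) (fun N => subset_rfl)
    tendsto_sum_totient
  have h4 : Tendsto (fun N : ℕ => 2 * (2 * N)) atTop atTop :=
    tendsto_atTop_mono (fun N => by simp only [id]; omega) tendsto_id
  -- The index d runs up to 2·(2N) = 4N, and (4N)² = 16N².
  have := (h.comp h4).const_mul 16
  refine (this.congr fun N => ?_).trans_eq (by congr 1; ring)
  simp only [Function.comp, cycProd, cyc]
  push_cast
  rw [show (2 * (2 * (N : ℝ))) ^ 2 = 16 * (N : ℝ) ^ 2 by ring, ← mul_div_assoc,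
    mul_div_mul_left _ _ (by norm_num)]

theorem tendsto_log_cycProdOdd {m : ℤ} (hm : 2 ≤ |m|) :
    Tendsto (fun N : ℕ => Real.log |((cycProdOdd m (2 * N) : ℤ) : ℝ)| / (N : ℝ) ^ 2) atTop
      (𝓝 (32 / Real.pi ^ 2 * Real.log |(m : ℝ)|)) := by
  have h := tendsto_log_prod_cyclotomic hm (fun N => (Finset.Ioc 0 N).filter Odd)
    (fun N => Finset.filter_subset _ _) tendsto_sum_totient_odd
  have h4 : Tendsto (fun N : ℕ => 2 * (2 * N)) atTop atTop :=
    tendsto_atTop_mono (fun N => by simp only [id]; omega) tendsto_id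
  have := (h.comp h4).const_mul 16
  refine (this.congr fun N => ?_).trans_eq (by congr 1; ring)
  simp only [Function.comp, cycProdOdd, cyc]
  push_cast
  rw [show (2 * (2 * (N : ℝ))) ^ 2 = 16 * (N : ℝ) ^ 2 by ring, ← mul_div_assoc,
    mul_div_mul_left _ _ (by norm_num)]

/-- The factor that makes the coefficients of the linear forms integral. -/
noncomputable def multiplier (m : ℤ) (r b N : ℕ) : ℝ :=
  ((evenProd m (2 * N) : ℤ) : ℝ) ^ poleOrder r b / ((oddPartProd m (2 * N) : ℤ) : ℝ) ^ (2 * r) *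
    (((cycProd m (2 * N) : ℤ) : ℝ) ^ (poleOrder r b - 1) * ((cycProdOdd m (2 * N) : ℤ) : ℝ))

theorem cycProd_ne_zero {m : ℤ} (hm : 2 ≤ |m|) (n : ℕ) : cycProd m n ≠ 0 :=
  Finset.prod_ne_zero_iff.mpr fun _ hd => cyclotomic_eval_ne_zero hm (Finset.mem_Ioc.mp hd).1

theorem cycProdOdd_ne_zero {m : ℤ} (hm : 2 ≤ |m|) (n : ℕ) : cycProdOdd m n ≠ 0 := fun h =>
  cycProd_ne_zero hm n (zero_dvd_iff.mp (h ▸ cycProdOdd_dvd_cycProd m n))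

theorem multiplier_ne_zero {m : ℤ} (hm : 2 ≤ |m|) (r b N : ℕ) : multiplier m r b N ≠ 0 := by
  unfold multiplier
  have h1 : ((evenProd m (2 * N) : ℤ) : ℝ) ≠ 0 := by exact_mod_cast evenProd_ne_zero hm _
  have h2 : ((oddPartProd m (2 * N) : ℤ) : ℝ) ≠ 0 := by exact_mod_cast oddPartProd_ne_zero hm _
  have h3 : ((cycProd m (2 * N) : ℤ) : ℝ) ≠ 0 := by exact_mod_cast cycProd_ne_zero hm _
  have h4 : ((cycProdOdd m (2 * N) : ℤ) : ℝ) ≠ 0 := by exact_mod_cast cycProdOdd_ne_zero hm _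
  positivity

theorem tendsto_log_multiplier {m : ℤ} (hm : 2 ≤ |m|) (r b : ℕ) :
    Tendsto (fun N : ℕ => Real.log |multiplier m r b N| / (N : ℝ) ^ 2) atTop
      (𝓝 ((4 * poleOrder r b - 8 * r / 3 + 48 / Real.pi ^ 2 * poleOrder r b - 16 / Real.pi ^ 2)
        * Real.log |(m : ℝ)|)) := by
  have h := (((tendsto_log_evenProd hm).const_mul (poleOrder r b : ℝ)).sub
    ((tendsto_log_oddPartProd hm).const_mul (2 * r : ℝ))).add
    (((tendsto_log_cycProd hm).const_mul ((poleOrder r b : ℝ) - 1)).add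
      (tendsto_log_cycProdOdd hm))
  refine (h.congr fun N => ?_).trans_eq (by congr 1; ring)
  have h1 : ((evenProd m (2 * N) : ℤ) : ℝ) ≠ 0 := by exact_mod_cast evenProd_ne_zero hm _
  have h2 : ((oddPartProd m (2 * N) : ℤ) : ℝ) ≠ 0 := by exact_mod_cast oddPartProd_ne_zero hm _
  have h3 : ((cycProd m (2 * N) : ℤ) : ℝ) ≠ 0 := by exact_mod_cast cycProd_ne_zero hm _
  have h4 : ((cycProdOdd m (2 * N) : ℤ) : ℝ) ≠ 0 := by exact_mod_cast cycProdOdd_ne_zero hm _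
  have hA : ((poleOrder r b - 1 : ℕ) : ℝ) = (poleOrder r b : ℝ) - 1 := by
    rw [Nat.cast_sub (by unfold poleOrder; omega)]; simp
  unfold multiplier
  rw [abs_mul, abs_div, abs_mul, abs_pow, abs_pow, abs_pow,
    Real.log_mul (by positivity) (by positivity), Real.log_div (by positivity) (by positivity),
    Real.log_mul (by positivity) (by positivity), Real.log_pow, Real.log_pow, Real.log_pow, hA]
  push_cast
  ring

/-! ### Integrality and size of the coefficients of the forms -/

/-- The integers, as a subring of the reals. -/
noncomputable def intRing : Subring ℝ := (Int.castRingHom ℝ).range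

theorem intCast_mem_intRing (z : ℤ) : (z : ℝ) ∈ intRing := ⟨z, rfl⟩

theorem mem_intRing {x : ℝ} : x ∈ intRing ↔ ∃ z : ℤ, (z : ℝ) = x := Iff.rfl

theorem mul_div_mem_intRing {D w : ℤ} (hw : w ≠ 0) (h : w ∣ D) (z : ℤ) :
    (D : ℝ) * ((z : ℝ) / w) ∈ intRing := exists_int_eq_mul_div hw h

theorem geoT_eq_div {m : ℤ} (hm : 2 ≤ |m|) {a : ℕ} (ha : 0 < a) :
    geoT m a = ((m ^ a : ℤ) : ℝ) / ((m ^ a - 1 : ℤ) : ℝ) := by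
  have h1 := one_sub_inv_pow_ge hm ha
  have h2 := one_sub_pow_ne_zero hm ha.ne'
  have h3 : (m : ℝ) ^ a ≠ 0 := pow_ne_zero _ (cast_ne_zero_of_two_le_abs hm)
  unfold geoT
  push_cast
  rw [inv_pow] at *
  have h5 : (1 : ℝ) - ((m : ℝ) ^ a)⁻¹ = ((m : ℝ) ^ a - 1) / (m : ℝ) ^ a := by field_simp
  rw [h5, one_div_div]

theorem geoU_eq_div (m : ℤ) (a : ℕ) :
    geoU m a = ((-1 : ℤ) : ℝ) / ((m ^ a - 1 : ℤ) : ℝ) := by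
  unfold geoU
  push_cast
  rw [neg_div, ← div_neg, neg_sub]

/-- One of the s denominators is cleared by the smaller product over odd d. This saves 16/π² in the
growth rate of the coefficients. -/
theorem cycProd_pow_mul_mem {m : ℤ} {n s : ℕ} (hs : 1 ≤ s) {x : ℝ}
    (h1 : ((cycProd m n : ℤ) : ℝ) * x ∈ intRing) (h2 : ((cycProdOdd m n : ℤ) : ℝ) * x ∈ intRing) :
    ((cycProd m n : ℤ) : ℝ) ^ (s - 1) * ((cycProdOdd m n : ℤ) : ℝ) * x ^ s ∈ intRing := by
  obtain ⟨t, rfl⟩ := Nat.exists_eq_add_of_le' hs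
  rw [Nat.add_sub_cancel]
  have := Subring.mul_mem _ (Subring.pow_mem _ h1 t) h2
  rw [mul_pow] at this
  convert this using 1
  ring

/-- Only exponents a = 2h + 1 < 4N occur, and since a is odd, m^a - 1 divides both `cycProd` and
`cycProdOdd`. -/
theorem cycProd_pow_mul_formTail_mem {m : ℤ} (hm : 2 ≤ |m|) {N j s : ℕ} (hj : j ≤ 2 * N)
    (hs : 1 ≤ s) :
    ((cycProd m (2 * N) : ℤ) : ℝ) ^ (s - 1) * ((cycProdOdd m (2 * N) : ℤ) : ℝ) *
      formTail m N j s ∈ intRing := by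
  have hodd : ∀ h, Odd (2 * h + 1) := fun h => odd_two_mul_add_one h
  have hsign : ∀ h, (-1 : ℝ) ^ h ∈ intRing := fun h =>
    Subring.pow_mem _ (Subring.neg_mem _ (Subring.one_mem _)) h
  have hD : ((cycProd m (2 * N) : ℤ) : ℝ) ^ (s - 1) * ((cycProdOdd m (2 * N) : ℤ) : ℝ) ∈ intRing :=
    Subring.mul_mem _ (Subring.pow_mem _ (intCast_mem_intRing _) _) (intCast_mem_intRing _)
  unfold formTail
  rw [mul_add, Finset.mul_sum, Finset.mul_sum]
  refine Subring.add_mem _ (Subring.sum_mem _ fun h hh => ?_) (Subring.sum_mem _ fun h hh => ?_)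
  · have hh' := Finset.mem_range.mp hh
    have hne := pow_sub_one_ne_zero hm (e := 2 * h + 1) (by omega)
    have h1 := cycProd_pow_mul_mem (m := m) (n := 2 * N) (x := geoT m (2 * h + 1)) hs
      (by rw [geoT_eq_div hm (by omega)]
          exact mul_div_mem_intRing hne (pow_sub_one_dvd_cycProd m (by omega) (by omega)) _)
      (by rw [geoT_eq_div hm (by omega)]
          exact mul_div_mem_intRing hne (pow_sub_one_dvd_cycProdOdd m (hodd h) (by omega)) _)
    have h2 := Subring.mul_mem _ (hsign h) (Subring.sub_mem _ h1 hD)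
    convert h2 using 1
    ring
  · have hh' := Finset.mem_range.mp hh
    have hne := pow_sub_one_ne_zero hm (e := 2 * h + 1) (by omega)
    have h1 := cycProd_pow_mul_mem (m := m) (n := 2 * N) (x := geoU m (2 * h + 1)) hs
      (by rw [geoU_eq_div]
          exact mul_div_mem_intRing hne (pow_sub_one_dvd_cycProd m (by omega) (by omega)) _)
      (by rw [geoU_eq_div]
          exact mul_div_mem_intRing hne (pow_sub_one_dvd_cycProdOdd m (hodd h) (by omega)) _)
    have h2 := Subring.mul_mem _ (hsign h) h1
    convert h2 using 1
    ring

/-- The k-th coefficient uses up only k of the A - 1 copies of `cycProd`; the factor that remains is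
exactly what clears `formTail` with s = A - k. -/
theorem multiplier_mul_coeff {m : ℤ} (hm : 2 ≤ |m|) (r b N : ℕ) {j k : ℕ} (hj : j ≤ 2 * N)
    (hk : k < poleOrder r b) :
    ∃ z : ℤ, multiplier m r b N * PowerSeries.coeff k (localSeries m r b N j)
      = z * (((cycProd m (2 * N) : ℤ) : ℝ) ^ (poleOrder r b - k - 1) *
          ((cycProdOdd m (2 * N) : ℤ) : ℝ)) := by
  obtain ⟨z, hz⟩ := (mem_integralSeries.mp (C_mul_localSeries_mem hm r b N j hj)) k
  refine ⟨z, ?_⟩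
  rw [hz, PowerSeries.coeff_C_mul, multiplier,
    show poleOrder r b - 1 = k + (poleOrder r b - k - 1) by omega, pow_add]
  ring

/-- The coefficients of the linear forms: `none` is for the constant term, and `some k` for the
coefficient of `formPeriod m (A - k)`. -/
noncomputable def formCoeff (m : ℤ) (r b N : ℕ) : Option (Fin (poleOrder r b)) → ℝ
  | none => -(multiplier m r b N * ∑ j ∈ Finset.range (2 * N + 1),
      ∑ k ∈ Finset.range (poleOrder r b), PowerSeries.coeff k (localSeries m r b N j) *
        ((-1) ^ j * formTail m N j (poleOrder r b - k)))
  | some k => multiplier m r b N * ∑ j ∈ Finset.range (2 * N + 1),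
      PowerSeries.coeff (k : ℕ) (localSeries m r b N j) * (-1) ^ j

/-- The numbers at which the linear forms are evaluated. -/
noncomputable def formPoint (m : ℤ) (r b : ℕ) : Option (Fin (poleOrder r b)) → ℝ
  | none => 1
  | some k => formPeriod m (poleOrder r b - k)

theorem formCoeff_mem {m : ℤ} (hm : 2 ≤ |m|) (r b N : ℕ) (i : Option (Fin (poleOrder r b))) :
    formCoeff m r b N i ∈ intRing := by
  have hsign : ∀ h, (-1 : ℝ) ^ h ∈ intRing := fun h =>
    Subring.pow_mem _ (Subring.neg_mem _ (Subring.one_mem _)) h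
  rcases i with _ | k
  · simp only [formCoeff]
    refine Subring.neg_mem _ ?_
    rw [Finset.mul_sum]
    refine Subring.sum_mem _ fun j hj => ?_
    rw [Finset.mul_sum]
    refine Subring.sum_mem _ fun k hk => ?_
    have hj' := Finset.mem_range.mp hj
    have hk' := Finset.mem_range.mp hk
    obtain ⟨z, hz⟩ := multiplier_mul_coeff hm r b N (j := j) (by omega) hk'
    have h1 := Subring.mul_mem _ (Subring.mul_mem _ (intCast_mem_intRing z) (hsign j))
      (cycProd_pow_mul_formTail_mem hm (N := N) (j := j) (s := poleOrder r b - k)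
        (by omega) (by omega))
    rw [← mul_assoc, hz]
    convert h1 using 1
    ring
  · simp only [formCoeff]
    rw [Finset.mul_sum]
    refine Subring.sum_mem _ fun j hj => ?_
    have hj' := Finset.mem_range.mp hj
    obtain ⟨z, hz⟩ := multiplier_mul_coeff hm r b N (j := j) (by omega) k.2
    rw [← mul_assoc, hz]
    exact Subring.mul_mem _ (Subring.mul_mem _ (intCast_mem_intRing z)
      (Subring.mul_mem _ (Subring.pow_mem _ (intCast_mem_intRing _) _) (intCast_mem_intRing _)))
      (hsign j)

theorem sum_formCoeff {m : ℤ} (hm : 2 ≤ |m|) {r : ℕ} (hr : 1 ≤ r) (b N : ℕ) :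
    ∑ i, formCoeff m r b N i * formPoint m r b i = multiplier m r b N * (2 * formSum m r b N) := by
  rw [Fintype.sum_option]
  simp only [formCoeff, formPoint]
  rw [two_mul_formSum hm hr, Fin.sum_univ_eq_sum_range (fun k => multiplier m r b N *
    (∑ j ∈ Finset.range (2 * N + 1), PowerSeries.coeff k (localSeries m r b N j) * (-1) ^ j) *
      formPeriod m (poleOrder r b - k))]
  have h1 : ∑ k ∈ Finset.range (poleOrder r b), multiplier m r b N *
      (∑ j ∈ Finset.range (2 * N + 1), PowerSeries.coeff k (localSeries m r b N j) * (-1) ^ j) *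
        formPeriod m (poleOrder r b - k)
      = multiplier m r b N * ∑ j ∈ Finset.range (2 * N + 1), ∑ k ∈ Finset.range (poleOrder r b),
        PowerSeries.coeff k (localSeries m r b N j) * (-1) ^ j *
          formPeriod m (poleOrder r b - k) := by
    rw [Finset.sum_comm, Finset.mul_sum]
    refine Finset.sum_congr rfl fun k _ => ?_
    rw [mul_assoc, Finset.sum_mul]
  rw [h1, mul_one, neg_add_eq_sub, ← mul_sub, ← Finset.sum_sub_distrib]
  congr 1
  refine Finset.sum_congr rfl fun j _ => ?_
  rw [← Finset.sum_sub_distrib]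
  exact Finset.sum_congr rfl fun k _ => by ring

theorem abs_formTail_le {m : ℤ} (hm : 2 ≤ |m|) {N j s : ℕ} (hj : j ≤ 2 * N) (hs : 1 ≤ s) :
    |formTail m N j s| ≤ 2 * N * (s * 2 ^ s * 2) := by
  have hB : (1 : ℝ) ≤ s * 2 ^ s * 2 := by
    have h1 : (1 : ℝ) ≤ s := by exact_mod_cast hs
    have h2 : (1 : ℝ) ≤ 2 ^ s := one_le_pow₀ (by norm_num)
    nlinarith
  have h1 : ∀ h ∈ Finset.range j, |(-1 : ℝ) ^ h * (geoT m (2 * h + 1) ^ s - 1)| ≤ s * 2 ^ s * 2 := by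
    intro h _
    rw [abs_mul, abs_pow, abs_neg, abs_one, one_pow, one_mul]
    refine (abs_geoT_pow_sub_one_le hm (by omega) s).trans ?_
    exact mul_le_of_le_one_right (by linarith) (pow_le_one₀ (by norm_num) (by norm_num))
  have h2 : ∀ h ∈ Finset.range (2 * N - j), |(-1 : ℝ) ^ h * geoU m (2 * h + 1) ^ s|
      ≤ s * 2 ^ s * 2 := by
    intro h _
    rw [abs_mul, abs_pow, abs_neg, abs_one, one_pow, one_mul, abs_pow]
    exact (pow_le_one₀ (abs_nonneg _) (abs_geoU_le_one hm (by omega))).trans hB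
  unfold formTail
  refine (abs_add_le _ _).trans ((add_le_add ((Finset.abs_sum_le_sum_abs _ _).trans
    (Finset.sum_le_card_nsmul _ _ _ h1)) ((Finset.abs_sum_le_sum_abs _ _).trans
    (Finset.sum_le_card_nsmul _ _ _ h2))).trans ?_)
  rw [Finset.card_range, Finset.card_range, nsmul_eq_mul, nsmul_eq_mul, ← add_mul, Nat.cast_sub hj]
  push_cast
  apply le_of_eq
  ring

theorem abs_formCoeff_le {m : ℤ} (hm : 2 ≤ |m|) (r b N : ℕ) {B : ℝ}
    (hB : ∀ j ≤ 2 * N, seriesNorm (poleOrder r b) (localSeries m r b N j) ≤ B)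
    (i : Option (Fin (poleOrder r b))) :
    |formCoeff m r b N i| ≤ |multiplier m r b N| * ((2 * N + 1) * B *
      (1 + 2 * N * (poleOrder r b * 2 ^ poleOrder r b * 2))) := by
  have hB0 : 0 ≤ B := (seriesNorm_nonneg _ _).trans (hB 0 (by omega))
  have habs : ∀ j : ℕ, |(-1 : ℝ) ^ j| = 1 := fun j => by rw [abs_pow, abs_neg, abs_one, one_pow]
  rcases i with _ | k
  · simp only [formCoeff]
    set A := poleOrder r b
    rw [abs_neg, abs_mul]
    refine mul_le_mul_of_nonneg_left ?_ (abs_nonneg _)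
    have h1 : ∀ j ∈ Finset.range (2 * N + 1), |∑ k ∈ Finset.range A,
        PowerSeries.coeff k (localSeries m r b N j) * ((-1) ^ j * formTail m N j (A - k))|
        ≤ B * (2 * N * (A * 2 ^ A * 2)) := by
      intro j hj
      have hj' := Finset.mem_range.mp hj
      refine (Finset.abs_sum_le_sum_abs _ _).trans ?_
      calc _ ≤ ∑ k ∈ Finset.range A, |PowerSeries.coeff k (localSeries m r b N j)| *
            (2 * N * (A * 2 ^ A * 2)) := by
            refine Finset.sum_le_sum fun k hk => ?_
            have hk' := Finset.mem_range.mp hk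
            rw [abs_mul, abs_mul, habs, one_mul]
            refine mul_le_mul_of_nonneg_left ?_ (abs_nonneg _)
            refine (abs_formTail_le hm (by omega) (by omega)).trans ?_
            have h3 : ((A - k : ℕ) : ℝ) ≤ A := by exact_mod_cast Nat.sub_le A k
            have h4 : (2 : ℝ) ^ (A - k) ≤ 2 ^ A :=
              pow_le_pow_right₀ (by norm_num) (Nat.sub_le A k)
            gcongr
        _ = seriesNorm A (localSeries m r b N j) * (2 * N * (A * 2 ^ A * 2)) := by
            rw [← Finset.sum_mul]; rfl
        _ ≤ _ := by gcongr; exact hB j (by omega)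
    refine ((Finset.abs_sum_le_sum_abs _ _).trans (Finset.sum_le_card_nsmul _ _ _ h1)).trans ?_
    rw [Finset.card_range, nsmul_eq_mul, ← mul_assoc]
    push_cast
    gcongr
    linarith
  · simp only [formCoeff]
    rw [abs_mul]
    refine mul_le_mul_of_nonneg_left ?_ (abs_nonneg _)
    have h1 : ∀ j ∈ Finset.range (2 * N + 1),
        |PowerSeries.coeff (k : ℕ) (localSeries m r b N j) * (-1) ^ j| ≤ B := by
      intro j hj
      have hj' := Finset.mem_range.mp hj
      rw [abs_mul, habs, mul_one]
      exact (abs_coeff_le_seriesNorm k.2 _).trans (hB j (by omega))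
    refine ((Finset.abs_sum_le_sum_abs _ _).trans (Finset.sum_le_card_nsmul _ _ _ h1)).trans ?_
    rw [Finset.card_range, nsmul_eq_mul]
    push_cast
    refine le_mul_of_one_le_right (by positivity) ?_
    have : (0 : ℝ) ≤ 2 * N * (poleOrder r b * 2 ^ poleOrder r b * 2) := by positivity
    linarith

/-- The exponential growth rate of the coefficients. -/
theorem eventually_abs_formCoeff_le {m : ℤ} (hm : 2 ≤ |m|) (r b : ℕ) {ε : ℝ} (hε : 0 < ε) :
    ∀ᶠ N : ℕ in atTop, ∀ i, |formCoeff m r b N i| ≤ Real.exp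
      (((2 * poleOrder r b + 8 * r ^ 2 + 16 * r / 3 + 48 / Real.pi ^ 2 * poleOrder r b
        - 16 / Real.pi ^ 2) * (Real.log |(m : ℝ)|) + ε) * (N : ℝ) ^ 2) := by
  set A := poleOrder r b with hA
  set lm := Real.log |(m : ℝ)| with hlm
  have hM0 : 0 < |(m : ℝ)| := by linarith [two_le_abs_cast hm]
  set C : ℝ := 2 ^ (3 * b + r + 1) * 3 ^ (4 * r + 1) * (2 * 2 ^ A) ^ (2 * A) * |(m : ℝ)| ^ 6 with hC
  have hC0 : 0 < C := by positivity
  set E : ℝ := (A : ℝ) * 2 ^ A * 2 with hE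
  have hE0 : 0 ≤ E := by positivity
  have hmul := (tendsto_log_multiplier hm r b).eventually (gt_mem_nhds
    (lt_add_of_pos_right _ (half_pos hε)))
  have hq := eventually_quadratic_lt (a := 0) (b := ε / 2)
    (c := Real.log C + 2 + 2 * E) (e := Real.log C) (half_pos hε)
  filter_upwards [hmul, hq, eventually_gt_atTop 0] with N h1 h2 hN i
  have hN' : (0 : ℝ) < (N : ℝ) ^ 2 := by positivity
  rw [div_lt_iff₀ hN'] at h1
  have hB : ∀ j ≤ 2 * N, seriesNorm A (localSeries m r b N j)
      ≤ C ^ (N + 1) * |(m : ℝ)| ^ ((8 * r ^ 2 + 8 * r) * N ^ 2) / |(m : ℝ)| ^ (2 * A * N ^ 2) := by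
    intro j hj
    rw [le_div_iff₀ (by positivity)]
    exact seriesNorm_localSeries_le hm r b N j hj
  refine (abs_formCoeff_le hm r b N hB i).trans ?_
  have hmp : 0 < |multiplier m r b N| := abs_pos.mpr (multiplier_ne_zero hm r b N)
  -- The factors polynomial in N are absorbed into exponentials by 1 + x ≤ e^x; everything of size
  -- exp(O(N)) then fits in ε/2 · N².
  have h5 : (2 * (N : ℝ) + 1) ≤ Real.exp (2 * N) := by
    have := Real.add_one_le_exp (2 * (N : ℝ)); linarith
  have h6 : (1 + 2 * (N : ℝ) * E) ≤ Real.exp (2 * N * E) := by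
    have := Real.add_one_le_exp (2 * (N : ℝ) * E); linarith
  have hpowM : ∀ k : ℕ, |(m : ℝ)| ^ k = Real.exp (k * lm) := fun k => by
    rw [hlm, Real.exp_nat_mul, Real.exp_log hM0]
  have hpowC : C ^ (N + 1) = Real.exp ((N + 1) * Real.log C) := by
    have := Real.exp_nat_mul (Real.log C) (N + 1)
    rw [Real.exp_log hC0] at this
    rw [← this]; push_cast; rfl
  calc _ ≤ Real.exp (((4 * A - 8 * r / 3 + 48 / Real.pi ^ 2 * A - 16 / Real.pi ^ 2) * lm + ε / 2)
          * (N : ℝ) ^ 2) * (Real.exp (2 * N) * (C ^ (N + 1) *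
            |(m : ℝ)| ^ ((8 * r ^ 2 + 8 * r) * N ^ 2) / |(m : ℝ)| ^ (2 * A * N ^ 2)) *
            Real.exp (2 * N * E)) := by
        have h7 : |multiplier m r b N| ≤ Real.exp (((4 * A - 8 * r / 3 + 48 / Real.pi ^ 2 * A
            - 16 / Real.pi ^ 2) * lm + ε / 2) * (N : ℝ) ^ 2) := by
          rw [← Real.log_le_iff_le_exp hmp]
          exact h1.le
        gcongr
    _ ≤ _ := by
        rw [hpowC, hpowM, hpowM, ← Real.exp_add, ← Real.exp_sub, ← Real.exp_add, ← Real.exp_add,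
          ← Real.exp_add]
        apply Real.exp_le_exp.mpr
        push_cast
        linarith

/-! ### Size of the alternating sum -/

theorem one_sub_sum_abs_le_prod {ι : Type*} (s : Finset ι) (u : ι → ℝ) (hu : ∀ i ∈ s, |u i| ≤ 1) :
    1 - ∑ i ∈ s, |u i| ≤ ∏ i ∈ s, |1 - u i| := by
  classical
  induction s using Finset.induction_on with
  | empty => simp
  | insert i s hi ih =>
    rw [Finset.sum_insert hi, Finset.prod_insert hi]
    have h1 := ih fun k hk => hu k (Finset.mem_insert_of_mem hk)
    have h2 := hu i (Finset.mem_insert_self _ _)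
    have h3 : 1 - |u i| ≤ |1 - u i| := by
      have := abs_sub_abs_le_abs_sub 1 (u i)
      rwa [abs_one] at this
    have h4 : 0 ≤ ∏ k ∈ s, |1 - u k| := Finset.prod_nonneg fun _ _ => abs_nonneg _
    have h5 : 0 ≤ ∑ k ∈ s, |u k| := Finset.sum_nonneg fun _ _ => abs_nonneg _
    have h6 : (1 - |u i|) * (1 - ∑ k ∈ s, |u k|) ≤ (1 - |u i|) * ∏ k ∈ s, |1 - u k| :=
      mul_le_mul_of_nonneg_left h1 (by linarith)
    have h7 : (1 - |u i|) * ∏ k ∈ s, |1 - u k| ≤ |1 - u i| * ∏ k ∈ s, |1 - u k| :=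
      mul_le_mul_of_nonneg_right h3 h4
    nlinarith [mul_nonneg (abs_nonneg (u i)) h5]

theorem prod_abs_one_sub_le_exp {ι : Type*} (s : Finset ι) (u : ι → ℝ) :
    ∏ i ∈ s, |1 - u i| ≤ Real.exp (∑ i ∈ s, |u i|) := by
  rw [Real.exp_sum]
  refine Finset.prod_le_prod (fun _ _ => abs_nonneg _) fun i _ => ?_
  have h1 := abs_sub 1 (u i)
  rw [abs_one] at h1
  have h2 := Real.add_one_le_exp |u i|
  linarith

/-- The |u_i| sum to at most 2/3, so the product is at least 1 - 2/3 and at most exp(2/3) < 3,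
whatever its length. -/
theorem prod_abs_one_sub_bounds (R : ℕ) (u : ℕ → ℝ)
    (hu : ∀ i < R, |u i| ≤ 1 / 2 * (1 / 4) ^ i) :
    1 / 3 ≤ ∏ i ∈ Finset.range R, |1 - u i| ∧ ∏ i ∈ Finset.range R, |1 - u i| ≤ 3 := by
  have h1 : ∑ i ∈ Finset.range R, |u i| ≤ 2 / 3 := by
    calc _ ≤ ∑ i ∈ Finset.range R, 1 / 2 * (1 / 4 : ℝ) ^ i :=
          Finset.sum_le_sum fun i hi => hu i (Finset.mem_range.mp hi)
      _ = 1 / 2 * ((1 - (1 / 4 : ℝ) ^ R) / (3 / 4)) := by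
          rw [← Finset.mul_sum, geom_sum_eq (by norm_num)]
          ring
      _ ≤ 2 / 3 := by
          have : (0 : ℝ) ≤ (1 / 4) ^ R := by positivity
          linarith
  constructor
  · have := one_sub_sum_abs_le_prod (Finset.range R) u fun i hi => by
      refine (hu i (Finset.mem_range.mp hi)).trans ?_
      have : (1 / 4 : ℝ) ^ i ≤ 1 := pow_le_one₀ (by norm_num) (by norm_num)
      linarith
    linarith
  · refine (prod_abs_one_sub_le_exp _ _).trans ?_
    have h2 : Real.exp (∑ i ∈ Finset.range R, |u i|) ≤ Real.exp 1 :=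
      Real.exp_le_exp.mpr (by linarith)
    have := Real.exp_one_lt_d9
    linarith

theorem abs_pow_sub_inv_pow {m : ℤ} (hm : 2 ≤ |m|) (a l : ℕ) :
    |(m : ℝ) ^ a - ((m : ℝ)⁻¹) ^ l| = |(m : ℝ)| ^ a * |1 - ((m : ℝ)⁻¹) ^ (l + a)| := by
  rw [← abs_pow, ← abs_mul, mul_sub, mul_one, pow_add, mul_left_comm, ← mul_pow,
    mul_inv_cancel₀ (cast_ne_zero_of_two_le_abs hm), one_pow, mul_one]

/-- These points are zeros of the first numerator product. The alternating sum thus starts at h =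
2rN, which is the source of its smallness. -/
theorem formFun_eq_zero {m : ℤ} (hm : 2 ≤ |m|) (r b N : ℕ) {h : ℕ} (hh : h < r * (2 * N)) :
    formFun m r b N (((m : ℝ)⁻¹) ^ (2 * h + 1)) = 0 := by
  have h0 : ∏ i ∈ Finset.range (r * (2 * N)),
      (1 - (m : ℝ) ^ (2 * i + 1) * ((m : ℝ)⁻¹) ^ (2 * h + 1)) = 0 := by
    refine Finset.prod_eq_zero (Finset.mem_range.mpr hh) ?_
    rw [← mul_pow, mul_inv_cancel₀ (cast_ne_zero_of_two_le_abs hm), one_pow, sub_self]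
  unfold formFun formNum
  simp only [Polynomial.eval_mul, Polynomial.eval_C, Polynomial.eval_pow, Polynomial.eval_X,
    Polynomial.eval_sub, Polynomial.eval_prod, Polynomial.eval_one, h0, mul_zero, zero_mul,
    zero_div]

/-- The order of magnitude of the values of `formFun`, up to bounded factors. -/
noncomputable def formSize (m : ℤ) (r b N : ℕ) : ℝ :=
  |(m : ℝ)| ^ (poleOrder r b * N ^ 2 + 4 * N + (4 * r ^ 2 + 8 * r) * N ^ 2) /
    |(m : ℝ)| ^ (poleOrder r b * (2 * N * (2 * N + 1)))

theorem formSize_pos {m : ℤ} (hm : 2 ≤ |m|) (r b N : ℕ) : 0 < formSize m r b N := by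
  have := two_le_abs_cast hm
  unfold formSize
  positivity

/-- Extract from each factor its dominant power of m. The rest are products of |1 - q^e| with
growing e: the lone factor lies in [1/2, 2] and each of the three products in [1/3, 3], whence 18 =
2·3·3 and 3^A. The index g counts from the first term not forced to vanish. -/
theorem abs_formFun_bounds {m : ℤ} (hm : 2 ≤ |m|) (r b N g : ℕ) :
    formSize m r b N * |(m : ℝ)|⁻¹ ^ ((2 * (g + r * (2 * N)) + 1) * zeroOrder r b N)
        * (1 / (18 * 3 ^ poleOrder r b))
      ≤ |formFun m r b N (((m : ℝ)⁻¹) ^ (2 * (g + r * (2 * N)) + 1))| ∧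
    |formFun m r b N (((m : ℝ)⁻¹) ^ (2 * (g + r * (2 * N)) + 1))|
      ≤ formSize m r b N * |(m : ℝ)|⁻¹ ^ ((2 * (g + r * (2 * N)) + 1) * zeroOrder r b N)
        * (18 * 3 ^ poleOrder r b) := by
  have hm0 := cast_ne_zero_of_two_le_abs hm
  have hM2 := two_le_abs_cast hm
  set A := poleOrder r b with hA
  set R := r * (2 * N) with hR
  set l := 2 * (g + R) + 1 with hl
  set q := (m : ℝ)⁻¹ with hq
  set M := |(m : ℝ)| with hM
  have hM0 : 0 < M := by linarith
  have hqle : ∀ e k : ℕ, 2 * k + 1 ≤ e → |q ^ e| ≤ 1 / 2 * (1 / 4) ^ k := by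
    intro e k hek
    refine (abs_inv_pow_le hm e).trans ?_
    calc (1 / 2 : ℝ) ^ e ≤ (1 / 2) ^ (2 * k + 1) :=
          pow_le_pow_of_le_one (by norm_num) (by norm_num) hek
      _ = 1 / 2 * (1 / 4) ^ k := by rw [pow_succ, pow_mul]; norm_num; ring
  set f1 : ℝ := |1 - q ^ (l + 2 * N)| with hf1
  set f2 : ℝ := ∏ i ∈ Finset.range R, |1 - q ^ (2 * (i + 1 + g))| with hf2
  set f3 : ℝ := ∏ i ∈ Finset.range R, |1 - q ^ (l + (2 * i + (2 * (2 * N) + 1)))| with hf3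
  set f4 : ℝ := ∏ j ∈ Finset.range (2 * N + 1), |1 - q ^ (l + 2 * j)| with hf4
  have b1 : 1 / 2 ≤ f1 ∧ f1 ≤ 2 := by
    have h1 := hqle (l + 2 * N) 0 (by omega)
    rw [pow_zero, mul_one, abs_le] at h1
    rw [hf1, abs_of_pos (by linarith)]
    constructor <;> linarith
  have b2 : 1 / 3 ≤ f2 ∧ f2 ≤ 3 :=
    prod_abs_one_sub_bounds R _ fun i _ => hqle _ i (by omega)
  have b3 : 1 / 3 ≤ f3 ∧ f3 ≤ 3 :=
    prod_abs_one_sub_bounds R _ fun i _ => hqle _ i (by omega)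
  have b4 : 1 / 3 ≤ f4 ∧ f4 ≤ 3 :=
    prod_abs_one_sub_bounds (2 * N + 1) _ fun i _ => hqle _ i (by omega)
  have e2 : ∏ i ∈ Finset.range R, |1 - (m : ℝ) ^ (2 * i + 1) * q ^ l| = f2 := by
    rw [hf2, ← Finset.prod_range_reflect (fun i => |1 - q ^ (2 * (i + 1 + g))|)]
    refine Finset.prod_congr rfl fun i hi => ?_
    have hi' := Finset.mem_range.mp hi
    have e : l = (2 * i + 1) + 2 * (R - 1 - i + 1 + g) := by omega
    rw [e, pow_add q, ← mul_assoc, ← mul_pow, mul_inv_cancel₀ hm0, one_pow, one_mul]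
  have e3 : ∏ i ∈ Finset.range R, |(m : ℝ) ^ (4 * N + 2 * i + 1) - q ^ l|
      = M ^ ((4 * r ^ 2 + 8 * r) * N ^ 2) * f3 := by
    have hexp : (4 * r ^ 2 + 8 * r) * N ^ 2
        = ∑ i ∈ Finset.range R, (2 * i + (2 * (2 * N) + 1)) := by
      rw [sum_two_mul_add, hR]; ring
    rw [hexp, ← Finset.prod_pow_eq_pow_sum, hf3, ← Finset.prod_mul_distrib]
    refine Finset.prod_congr rfl fun i _ => ?_
    rw [show 4 * N + 2 * i + 1 = 2 * i + (2 * (2 * N) + 1) by ring, abs_pow_sub_inv_pow hm]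
  have e4 : ∏ j ∈ Finset.range (2 * N + 1), |(m : ℝ) ^ (2 * j) - q ^ l|
      = M ^ (2 * N * (2 * N + 1)) * f4 := by
    have hexp : 2 * N * (2 * N + 1) = ∑ j ∈ Finset.range (2 * N + 1), 2 * j := by
      rw [← Finset.mul_sum, mul_comm 2 (Finset.sum _ _), Finset.sum_range_id_mul_two,
        Nat.add_sub_cancel, mul_comm]
    rw [hexp, ← Finset.prod_pow_eq_pow_sum, hf4, ← Finset.prod_mul_distrib]
    exact Finset.prod_congr rfl fun j _ => abs_pow_sub_inv_pow hm _ _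
  have hval : |formFun m r b N (q ^ l)|
      = formSize m r b N * M⁻¹ ^ (l * zeroOrder r b N) * (f1 * f2 * f3 / f4 ^ A) := by
    unfold formFun formNum formSize
    simp only [Polynomial.eval_mul, Polynomial.eval_C, Polynomial.eval_pow, Polynomial.eval_X,
      Polynomial.eval_sub, Polynomial.eval_prod, Polynomial.eval_one]
    rw [Finset.prod_pow, abs_div, abs_mul, abs_mul, abs_mul, abs_mul, Finset.abs_prod,
      Finset.abs_prod, abs_pow (∏ j ∈ _, _), Finset.abs_prod, e2, e3, e4, abs_pow_sub_inv_pow hm,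
      abs_pow, abs_pow (q ^ l), abs_pow q, hq, abs_inv, ← hq, ← hM, ← hA, mul_pow (M ^ _) f4,
      ← pow_mul M _ A, ← pow_mul M⁻¹, mul_comm (2 * N * (2 * N + 1)) A, ← hf1, pow_add M, pow_add M,
      pow_add M (A * N ^ 2) (4 * N), show 4 * N = 2 * N + 2 * N by ring, pow_add M (2 * N)]
    ring
  rw [hval]
  have hS := formSize_pos hm r b N
  have hP : 0 < formSize m r b N * M⁻¹ ^ (l * zeroOrder r b N) := by positivity
  have h4pos : 0 < f4 := by linarith
  have h4A : (1 / 3) ^ A ≤ f4 ^ A := pow_le_pow_left₀ (by norm_num) b4.1 A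
  have h4A' : f4 ^ A ≤ 3 ^ A := pow_le_pow_left₀ h4pos.le b4.2 A
  constructor
  · refine mul_le_mul_of_nonneg_left ?_ hP.le
    rw [div_le_div_iff₀ (by positivity) (by positivity)]
    have h5 : 1 / 2 * (1 / 3) * (1 / 3) ≤ f1 * f2 * f3 := by
      have := b1.1; have := b2.1; have := b3.1
      gcongr
    nlinarith [pow_pos (by norm_num : (0 : ℝ) < 3) A]
  · refine mul_le_mul_of_nonneg_left ?_ hP.le
    rw [div_le_iff₀ (by positivity)]
    have h5 : f1 * f2 * f3 ≤ 2 * 3 * 3 := by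
      have := b1; have := b2; have := b3
      gcongr <;> linarith
    have h6 : (3 : ℝ) ^ A * (1 / 3) ^ A = 1 := by rw [← mul_pow]; norm_num
    have h7 : (1 : ℝ) ≤ 3 ^ A * f4 ^ A := by
      rw [← h6]; gcongr
    nlinarith

/-- Once x is small, the geometric majorant of the tail is at most half of the first term. -/
theorem abs_tsum_bounds_of_geometric {u : ℕ → ℝ} {a c C x : ℝ} (ha : 0 ≤ a) (hC : 0 ≤ C)
    (hx : 0 ≤ x) (hx2 : x ≤ 1 / 2) (hxc : 4 * C * x ≤ c) (h0 : a * c ≤ |u 0|)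
    (hu : ∀ g, |u g| ≤ a * C * x ^ g) :
    Summable u ∧ a * c / 2 ≤ |∑' g, u g| ∧ |∑' g, u g| ≤ 2 * (a * C) := by
  have hgeo : Summable fun g : ℕ => a * C * x ^ g :=
    (summable_geometric_of_lt_one hx (by linarith)).mul_left _
  have hs : Summable u := Summable.of_norm_bounded hgeo hu
  have hinv : (1 - x)⁻¹ ≤ 2 := by
    rw [inv_le_comm₀ (by linarith) (by norm_num)]
    linarith
  have haC : 0 ≤ a * C := mul_nonneg ha hC
  have htail : |∑' g, u (g + 1)| ≤ a * C * x * 2 := by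
    have h1 : HasSum (fun g : ℕ => a * C * x ^ (g + 1)) (a * C * x * (1 - x)⁻¹) := by
      have := (hasSum_geometric_of_lt_one hx (by linarith)).mul_left (a * C * x)
      simpa only [pow_succ', mul_assoc] using this
    exact (tsum_of_norm_bounded (f := fun g => u (g + 1)) h1 fun g => hu (g + 1)).trans
      (mul_le_mul_of_nonneg_left hinv (by positivity))
  have hsplit : ∑' g, u g = u 0 + ∑' g, u (g + 1) := hs.tsum_eq_zero_add
  refine ⟨hs, ?_, ?_⟩
  · have h2 := abs_sub_abs_le_abs_add (u 0) (∑' g, u (g + 1))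
    have h3 : a * (4 * C * x) ≤ a * c := mul_le_mul_of_nonneg_left hxc ha
    rw [hsplit]
    linarith
  · have h1 := hasSum_geometric_of_lt_one hx (by linarith)
    refine (tsum_of_norm_bounded (f := u) (h1.mul_left (a * C)) hu).trans ?_
    rw [mul_comm 2]
    exact mul_le_mul_of_nonneg_left hinv haC

/-- The majorants of successive terms have ratio |m|^(-2e) ≤ 2^(-N), where e = `zeroOrder r b N`;
`hx` says that N is large enough for the term h = 2rN to dominate. -/
theorem formSum_bounds {m : ℤ} (hm : 2 ≤ |m|) {r b N : ℕ} (hN : 1 ≤ N)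
    (hx : 4 * (18 * 3 ^ poleOrder r b) * (1 / 2 : ℝ) ^ N ≤ 1 / (18 * 3 ^ poleOrder r b)) :
    formSize m r b N * |(m : ℝ)|⁻¹ ^ ((2 * (r * (2 * N)) + 1) * zeroOrder r b N)
        * (1 / (18 * 3 ^ poleOrder r b)) ≤ |2 * formSum m r b N| ∧
    |2 * formSum m r b N|
      ≤ formSize m r b N * |(m : ℝ)|⁻¹ ^ ((2 * (r * (2 * N)) + 1) * zeroOrder r b N)
        * (4 * (18 * 3 ^ poleOrder r b)) := by
  have hM2 := two_le_abs_cast hm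
  have hS := formSize_pos hm r b N
  set R := r * (2 * N) with hR
  set e := zeroOrder r b N with he
  set C : ℝ := 18 * 3 ^ poleOrder r b with hC
  set M := |(m : ℝ)| with hM
  have hM0 : 0 < M := by linarith
  set a := formSize m r b N * M⁻¹ ^ ((2 * R + 1) * e) with ha
  have ha0 : 0 < a := by positivity
  have hC0 : 0 < C := by positivity
  have heN : N ≤ e := by
    simp only [he, zeroOrder]
    nlinarith
  have hMi : M⁻¹ ≤ 1 / 2 := by
    rw [inv_le_comm₀ hM0 (by norm_num)]
    linarith
  have hxe : M⁻¹ ^ (2 * e) ≤ (1 / 2) ^ N := by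
    calc M⁻¹ ^ (2 * e) ≤ (1 / 2) ^ (2 * e) := pow_le_pow_left₀ (by positivity) hMi _
      _ ≤ (1 / 2) ^ N := pow_le_pow_of_le_one (by norm_num) (by norm_num) (by omega)
  set F : ℕ → ℝ := fun h => (-1) ^ h * formFun m r b N (((m : ℝ)⁻¹) ^ (2 * h + 1)) with hF
  have habs : ∀ h, |F h| = |formFun m r b N (((m : ℝ)⁻¹) ^ (2 * h + 1))| := fun h => by
    simp only [hF]
    rw [abs_mul, abs_pow, abs_neg, abs_one, one_pow, one_mul]
  have hb := abs_tsum_bounds_of_geometric (u := fun g => F (g + R)) (a := a) (c := 1 / C) (C := C)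
    (x := M⁻¹ ^ (2 * e)) ha0.le hC0.le (by positivity)
    (hxe.trans (pow_le_of_le_one (by norm_num) (by norm_num) (by omega)))
    ((mul_le_mul_of_nonneg_left hxe (by positivity)).trans hx)
    (by
      have := (abs_formFun_bounds hm r b N 0).1
      rw [habs]
      simpa only [zero_add, ← hR, ← hM, ← hC, ← he, ← ha] using this)
    (fun g => by
      have := (abs_formFun_bounds hm r b N g).2
      rw [habs]
      refine this.trans (le_of_eq ?_)
      rw [ha, ← pow_mul, ← hR, ← hM, ← hC, ← he,
        show (2 * (g + R) + 1) * e = (2 * R + 1) * e + 2 * e * g by ring, pow_add]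
      ring)
  have hsum : formSum m r b N = ∑' g, F (g + R) := by
    have hs : Summable F := (summable_nat_add_iff R).mp hb.1
    have h0 : ∑ h ∈ Finset.range R, F h = 0 := Finset.sum_eq_zero fun h hh => by
      simp only [hF]
      rw [formFun_eq_zero hm r b N (Finset.mem_range.mp hh), mul_zero]
    have := hs.sum_add_tsum_nat_add R
    rw [h0, zero_add] at this
    exact this.symm
  rw [abs_mul, abs_two, hsum]
  constructor <;> linarith [hb.2.1, hb.2.2]

/-- The size of the dominant term, with 2b + 1 = A - 2r: the high-order zero at 0 contributes
-4r(A-2r), the prefactor and denominator together -3A, and the second numerator product 4r² + 8r. -/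
theorem tendsto_log_formSum {m : ℤ} (hm : 2 ≤ |m|) (r b : ℕ) :
    Tendsto (fun N : ℕ => Real.log |2 * formSum m r b N| / (N : ℝ) ^ 2) atTop
      (𝓝 ((-3 * poleOrder r b - 4 * r * poleOrder r b + 12 * r ^ 2 + 8 * r)
        * Real.log |(m : ℝ)|)) := by
  have hM2 := two_le_abs_cast hm
  set A := poleOrder r b with hA
  have hAr : (A : ℝ) = 2 * (r + b) + 1 := by
    rw [hA, poleOrder]
    push_cast
    ring
  set M := |(m : ℝ)| with hM
  have hM0 : 0 < M := by linarith
  set C : ℝ := 18 * 3 ^ A with hC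
  have hC1 : 1 ≤ C := by
    have : (1 : ℝ) ≤ 3 ^ A := one_le_pow₀ (by norm_num)
    linarith
  have hlim : Tendsto (fun N : ℕ => 4 * C * (1 / 2 : ℝ) ^ N) atTop (𝓝 (4 * C * 0)) :=
    (tendsto_pow_atTop_nhds_zero_of_lt_one (by norm_num) (by norm_num)).const_mul _
  rw [mul_zero] at hlim
  have hev : ∀ᶠ N : ℕ in atTop, 4 * C * (1 / 2 : ℝ) ^ N ≤ 1 / C :=
    (hlim.eventually_lt_const (by positivity : 0 < 1 / C)).mono fun _ h => h.le
  set g : ℕ → ℝ := fun N =>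
    Real.log (formSize m r b N * M⁻¹ ^ ((2 * (r * (2 * N)) + 1) * zeroOrder r b N)) with hg
  refine tendsto_div_sq_of_abs_sub_le (g := g) (C := Real.log (4 * C)) ?_ ?_
  · filter_upwards [hev, eventually_ge_atTop 1] with N hN hN1
    obtain ⟨h1, h2⟩ := formSum_bounds hm hN1 hN
    have hS := formSize_pos hm r b N
    set a := formSize m r b N * M⁻¹ ^ ((2 * (r * (2 * N)) + 1) * zeroOrder r b N) with ha
    have ha0 : 0 < a := by positivity
    have hlow : 0 < a * (1 / C) := by positivity
    have l1 := Real.log_le_log hlow h1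
    have l2 := Real.log_le_log (hlow.trans_le h1) h2
    rw [← hA, ← hC, Real.log_mul ha0.ne' (by positivity)] at l2
    rw [Real.log_mul ha0.ne' (by positivity), Real.log_div one_ne_zero (by positivity),
      Real.log_one] at l1
    have l3 : Real.log C ≤ Real.log (4 * C) := Real.log_le_log (by positivity) (by linarith)
    have l4 : 0 ≤ Real.log C := Real.log_nonneg hC1
    have l5 : Real.log (4 * C) ≤ Real.log (4 * C) * (N + 1) :=
      le_mul_of_one_le_right (l4.trans l3) (by linarith [(Nat.cast_nonneg N : (0 : ℝ) ≤ N)])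
    simp only [hg]
    rw [← ha, abs_le]
    constructor <;> linarith
  · set lm := Real.log M with hlm
    refine (tendsto_quadratic_div_sq ((-3 * A - 4 * r * A + 12 * r ^ 2 + 8 * r) * lm)
      ((4 - 2 * A - (2 * b + 1) - 4 * r * (r + b)) * lm) (-(r + b) * lm)).congr fun N => ?_
    congr 1
    simp only [hg, formSize, ← hM, ← hA]
    rw [Real.log_mul (by positivity) (by positivity), Real.log_div (by positivity) (by positivity),
      Real.log_pow, Real.log_pow, Real.log_pow, Real.log_inv, ← hlm, zeroOrder]
    push_cast
    rw [hAr]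
    ring

theorem tendsto_log_form {m : ℤ} (hm : 2 ≤ |m|) (r b : ℕ) :
    Tendsto (fun N : ℕ => Real.log |multiplier m r b N * (2 * formSum m r b N)| / (N : ℝ) ^ 2) atTop
      (𝓝 ((poleOrder r b - 4 * r * poleOrder r b + 12 * r ^ 2 + 16 * r / 3
        + 48 / Real.pi ^ 2 * poleOrder r b - 16 / Real.pi ^ 2) * Real.log |(m : ℝ)|)) := by
  have h := (tendsto_log_multiplier hm r b).add (tendsto_log_formSum hm r b)
  have hne : ∀ᶠ N : ℕ in atTop, 2 * formSum m r b N ≠ 0 := by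
    have hlim : Tendsto (fun N : ℕ => 4 * (18 * 3 ^ poleOrder r b) * (1 / 2 : ℝ) ^ N) atTop
        (𝓝 (4 * (18 * 3 ^ poleOrder r b) * 0)) :=
      (tendsto_pow_atTop_nhds_zero_of_lt_one (by norm_num) (by norm_num)).const_mul _
    rw [mul_zero] at hlim
    filter_upwards [hlim.eventually_lt_const
      (by positivity : (0 : ℝ) < 1 / (18 * 3 ^ poleOrder r b)), eventually_ge_atTop 1] with N hN hN1
    have h1 := (formSum_bounds hm hN1 hN.le).1
    have hS := formSize_pos hm r b N
    have hM2 := two_le_abs_cast hm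
    exact abs_pos.mp (lt_of_lt_of_le (by positivity) h1)
  have e : (4 * poleOrder r b - 8 * r / 3 + 48 / Real.pi ^ 2 * poleOrder r b - 16 / Real.pi ^ 2)
      * Real.log |(m : ℝ)| + (-3 * poleOrder r b - 4 * r * poleOrder r b + 12 * r ^ 2 + 8 * r)
        * Real.log |(m : ℝ)| = (poleOrder r b - 4 * r * poleOrder r b + 12 * r ^ 2 + 16 * r / 3
        + 48 / Real.pi ^ 2 * poleOrder r b - 16 / Real.pi ^ 2) * Real.log |(m : ℝ)| := by ring
  rw [e] at h
  refine h.congr' ?_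
  filter_upwards [hne] with N hN
  rw [abs_mul (multiplier m r b N), Real.log_mul (abs_pos.mpr (multiplier_ne_zero hm r b N)).ne' (abs_pos.mpr hN).ne',
    add_div]

/-! ### The lower bound for the dimension -/

theorem sixteen_div_pi_sq_lt : 16 / Real.pi ^ 2 < 16 / 3 := by
  have := Real.pi_gt_three
  exact div_lt_div_of_pos_left (by norm_num) (by norm_num) (by nlinarith)

theorem le_boundTerm_denom {r : ℕ} (hr : 1 ≤ r) (A : ℕ) :
    (48 / Real.pi ^ 2 + 2) * A + 8 * r ^ 2
      ≤ (48 / Real.pi ^ 2 + 2) * A + 8 * r ^ 2 - 16 / Real.pi ^ 2 + 16 * r / 3 := by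
  have h1 : (1 : ℝ) ≤ r := by exact_mod_cast hr
  linarith [sixteen_div_pi_sq_lt]

theorem one_le_finrank_realBetaSpace (q : ℝ) (A : ℕ) :
    1 ≤ Module.finrank ℚ (realBetaSpace q A) := by
  have := finiteDimensional_realBetaSpace q A
  have h1 : (1 : ℝ) ∈ realBetaSpace q A := Submodule.subset_span (Set.mem_insert _ _)
  have : Nontrivial (realBetaSpace q A) :=
    ⟨⟨⟨1, h1⟩, 0, fun h => one_ne_zero (congrArg Subtype.val h)⟩⟩
  exact Module.finrank_pos

theorem boundTerm_le_finrank {m : ℤ} (hm : 2 ≤ |m|) {r : ℕ} (hr : 1 ≤ r) (b : ℕ) :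
    boundTerm r (poleOrder r b)
      ≤ Module.finrank ℚ (realBetaSpace (m : ℝ)⁻¹ (poleOrder r b)) := by
  have hD := le_boundTerm_denom hr (poleOrder r b)
  have hfd := finiteDimensional_realBetaSpace (m : ℝ)⁻¹ (poleOrder r b)
  have hform := tendsto_log_form hm r b
  have hcoef := fun ε => eventually_abs_formCoeff_le hm r b (ε := ε)
  have hodd : Odd (poleOrder r b) := ⟨r + b, rfl⟩
  unfold boundTerm
  have hlm : 0 < Real.log |(m : ℝ)| := Real.log_pos (by linarith [two_le_abs_cast hm])
  have hr1 : (1 : ℝ) ≤ r := by exact_mod_cast hr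
  have hpos : 0 ≤ (48 / Real.pi ^ 2 + 2) * (poleOrder r b : ℝ) := by positivity
  set γ : ℝ := (48 / Real.pi ^ 2 + 2) * poleOrder r b + 8 * r ^ 2 - 16 / Real.pi ^ 2 + 16 * r / 3
    with hγ
  have hγ0 : 0 < γ := by nlinarith
  set α : ℝ := 4 * r * poleOrder r b + poleOrder r b - 4 * r ^ 2 - γ with hα
  -- The criterion needs forms tending to 0. If α ≤ 0 the claimed bound is at most 1, and the space
  -- contains 1.
  rcases le_or_gt α 0 with hα0 | hα0
  · have h1 : (1 : ℝ) ≤ Module.finrank ℚ (realBetaSpace (m : ℝ)⁻¹ (poleOrder r b)) := by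
      exact_mod_cast one_le_finrank_realBetaSpace _ _
    refine le_trans ?_ h1
    rw [div_le_one hγ0]
    linarith
  · choose p hp using fun N i => mem_intRing.mp (formCoeff_mem hm r b N i)
    have h := finrank_ge_of_small_forms (realBetaSpace (m : ℝ)⁻¹ (poleOrder r b)) (formPoint m r b)
      (fun i => by
        rcases i with _ | k
        · exact Submodule.subset_span (Set.mem_insert _ _)
        · have hk := k.2
          exact formPeriod_mem hm hodd (by omega) (by omega))
      p (mul_pos hα0 hlm) (mul_pos hγ0 hlm)
      (by
        simp only [hp, sum_formCoeff hm hr]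
        refine hform.trans_eq ?_
        congr 1
        rw [hα, hγ]
        ring)
      (fun ε hε => by
        filter_upwards [hcoef ε hε] with N hN i
        rw [hp]
        refine (hN i).trans (le_of_eq ?_)
        rw [hγ]
        congr 3
        ring)
    rw [mul_div_mul_right _ _ hlm.ne'] at h
    refine le_trans (le_of_eq ?_) h
    rw [eq_comm, one_add_div hγ0.ne']
    congr 1
    rw [hα]
    ring

theorem bound_le_finrank {q : ℂ} (hq : q ≠ 0) {m : ℤ} (h1 : m ≠ -1) (h2 : m ≠ 1)
    (hqm : 1 / q = (m : ℂ)) {A : ℕ} (hA : 3 ≤ A) (hodd : Odd A) :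
    bound A ≤ (Module.finrank ℚ (qBetaSpace q A) : ℝ) := by
  have h0 : m ≠ 0 := by
    rintro rfl
    rw [Int.cast_zero, div_eq_zero_iff] at hqm
    simp_all
  have hm : 2 ≤ |m| := by
    rw [le_abs]
    omega
  have hqr : q = (((m : ℝ)⁻¹ : ℝ) : ℂ) := by
    rw [one_div] at hqm
    push_cast
    rw [← hqm, inv_inv]
  obtain ⟨r, ⟨hr, hrA⟩, hb⟩ := (bound_isGreatest hA).1
  have hrA' : 2 * r < A := by
    have : (2 * r : ℝ) < A := by linarith
    exact_mod_cast this
  obtain ⟨c, hc⟩ := hodd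
  -- With A = 2c + 1, the condition r < A/2 says r ≤ c, so A is `poleOrder r b` with b = c - r.
  obtain ⟨b, rfl⟩ := Nat.exists_eq_add_of_le (show r ≤ c by omega)
  rw [← hb, hqr, finrank_qBetaSpace, hc]
  exact boundTerm_le_finrank hm hr b

/-! ### Asymptotics of the bound -/

theorem bound_le {A : ℕ} (hA : 3 ≤ A) :
    bound A ≤ Real.sqrt A / Real.sqrt (2 * (48 / Real.pi ^ 2 + 2)) + 1 := by
  obtain ⟨r, ⟨hr, -⟩, hb⟩ := (bound_isGreatest hA).1
  rw [← hb]
  have hD := le_boundTerm_denom hr A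
  simp only [boundTerm]
  have hr1 : (1 : ℝ) ≤ r := by exact_mod_cast hr
  have hA3 : (3 : ℝ) ≤ A := by exact_mod_cast hA
  set D := (48 / Real.pi ^ 2 + 2) * (A : ℝ) + 8 * r ^ 2 - 16 / Real.pi ^ 2 + 16 * r / 3
  set c := 48 / Real.pi ^ 2 + 2 with hc
  have hc1 : 2 ≤ c := by
    have : (0 : ℝ) ≤ 48 / Real.pi ^ 2 := by positivity
    linarith
  set s := Real.sqrt A with hs
  set k := Real.sqrt (2 * c) with hk
  have hs2 : s ^ 2 = A := Real.sq_sqrt (by linarith)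
  have hk2 : k ^ 2 = 2 * c := Real.sq_sqrt (by linarith)
  have hs0 : 0 < s := Real.sqrt_pos.mpr (by linarith)
  have hk0 : 0 < k := Real.sqrt_pos.mpr (by linarith)
  -- From (k√A - 4r)² ≥ 0 and k² = 2c, one gets cA + 8r² ≥ 4rk√A. The remaining part of D is
  -- nonnegative since r ≥ 1.
  have hamgm : 4 * r * k * s ≤ D := by nlinarith [sq_nonneg (k * s - 4 * r)]
  have hAD : (A : ℝ) ≤ D := by nlinarith
  have hD0 : 0 < D := by linarith
  rw [div_le_iff₀ hD0, add_mul, one_mul]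
  have h1 : 4 * r * (A : ℝ) ≤ s / k * D := by
    calc 4 * r * (A : ℝ) = s / k * (4 * r * k * s) := by
          rw [← hs2]; field_simp
      _ ≤ _ := mul_le_mul_of_nonneg_left hamgm (by positivity)
  nlinarith [sq_nonneg (r : ℝ)]

/-- The witness is r = ⌈t√A⌉, so t ≤ r/√A < t + 1/√A; the lower estimate serves the main term of the
numerator and the upper one all other occurrences of r. `htA` ensures r < A/2, and `hnum` lets the
denominator be enlarged. -/
theorem le_bound {A : ℕ} (hA : 3 ≤ A) {t : ℝ} (ht : 0 < t)
    (htA : 2 * t + 2 ≤ Real.sqrt A) (hnum : 0 ≤ 4 * t - 4 * (Real.sqrt A)⁻¹ *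
      (t + (Real.sqrt A)⁻¹) ^ 2 + (Real.sqrt A)⁻¹) :
    (4 * t - 4 * (Real.sqrt A)⁻¹ * (t + (Real.sqrt A)⁻¹) ^ 2 + (Real.sqrt A)⁻¹) /
      (48 / Real.pi ^ 2 + 2 + 8 * (t + (Real.sqrt A)⁻¹) ^ 2
        + 16 / 3 * (Real.sqrt A)⁻¹ * (t + (Real.sqrt A)⁻¹)) ≤ bound A / Real.sqrt A := by
  set s := Real.sqrt A with hs
  have hs2 : (A : ℝ) = s ^ 2 := (Real.sq_sqrt (Nat.cast_nonneg A)).symm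
  have hs0 : 0 < s := by linarith
  have hr1 : t * s ≤ ⌈t * s⌉₊ := Nat.le_ceil _
  have hr2 : (⌈t * s⌉₊ : ℝ) < t * s + 1 := Nat.ceil_lt_add_one (by positivity)
  have hr : 1 ≤ ⌈t * s⌉₊ := Nat.one_le_ceil_iff.mpr (by positivity)
  generalize ⌈t * s⌉₊ = r at *
  have hmem : boundTerm r A ≤ bound A :=
    (bound_isGreatest hA).2 ⟨r, ⟨hr, by rw [hs2]; nlinarith⟩, rfl⟩
  rw [le_div_iff₀ hs0]
  refine le_trans ?_ hmem
  have hD := le_boundTerm_denom hr A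
  have hsq : (r : ℝ) ^ 2 ≤ (t * s + 1) ^ 2 := by gcongr
  have hpi : 0 < 16 / Real.pi ^ 2 := by positivity
  have hcpos : 0 < 48 / Real.pi ^ 2 := by positivity
  unfold boundTerm
  rw [hs2] at hD ⊢
  set c := 48 / Real.pi ^ 2 + 2 with hc
  have e1 : s ^ 3 * (4 * t - 4 * s⁻¹ * (t + s⁻¹) ^ 2 + s⁻¹)
      = 4 * (t * s) * s ^ 2 + s ^ 2 - 4 * (t * s + 1) ^ 2 := by
    field_simp
    ring
  have e2 : s ^ 2 * (c + 8 * (t + s⁻¹) ^ 2 + 16 / 3 * s⁻¹ * (t + s⁻¹))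
      = c * s ^ 2 + 8 * (t * s + 1) ^ 2 + 16 * (t * s + 1) / 3 := by
    field_simp
  have e3 : (4 * t - 4 * s⁻¹ * (t + s⁻¹) ^ 2 + s⁻¹) /
      (c + 8 * (t + s⁻¹) ^ 2 + 16 / 3 * s⁻¹ * (t + s⁻¹)) * s
      = (s ^ 3 * (4 * t - 4 * s⁻¹ * (t + s⁻¹) ^ 2 + s⁻¹)) /
        (s ^ 2 * (c + 8 * (t + s⁻¹) ^ 2 + 16 / 3 * s⁻¹ * (t + s⁻¹))) := by
    have : c + 8 * (t + s⁻¹) ^ 2 + 16 / 3 * s⁻¹ * (t + s⁻¹) ≠ 0 := by positivity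
    generalize c + 8 * (t + s⁻¹) ^ 2 + 16 / 3 * s⁻¹ * (t + s⁻¹) = d at *
    generalize 4 * t - 4 * s⁻¹ * (t + s⁻¹) ^ 2 + s⁻¹ = n
    field_simp
  have hn : 0 ≤ s ^ 3 * (4 * t - 4 * s⁻¹ * (t + s⁻¹) ^ 2 + s⁻¹) := by positivity
  rw [e3]
  rw [e1] at hn ⊢
  rw [e2]
  have hcs : 0 < c * s ^ 2 := by positivity
  have hnum' : 4 * (t * s) * s ^ 2 + s ^ 2 - 4 * (t * s + 1) ^ 2
      ≤ 4 * r * s ^ 2 + s ^ 2 - 4 * r ^ 2 := by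
    have : 4 * (t * s) * s ^ 2 ≤ 4 * r * s ^ 2 := by gcongr
    linarith
  refine div_le_div₀ (hn.trans hnum') hnum' ?_ ?_
  · nlinarith [sq_nonneg (r : ℝ)]
  · linarith

theorem bound_isEquivalent :
    Asymptotics.IsEquivalent atTop bound
      (fun A : ℕ => Real.pi / (2 * Real.sqrt (Real.pi ^ 2 + 24)) * Real.sqrt (A : ℝ)) := by
  have hpi := Real.pi_pos
  have hcpos : 0 < 48 / Real.pi ^ 2 + 2 := by positivity
  have hK : Real.pi / (2 * Real.sqrt (Real.pi ^ 2 + 24))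
      = 1 / Real.sqrt (2 * (48 / Real.pi ^ 2 + 2)) := by
    have : 2 * (48 / Real.pi ^ 2 + 2) = (2 / Real.pi) ^ 2 * (Real.pi ^ 2 + 24) := by
      field_simp
      ring
    rw [this, Real.sqrt_mul (by positivity), Real.sqrt_sq (by positivity)]
    field_simp
  rw [hK]
  set k := Real.sqrt (2 * (48 / Real.pi ^ 2 + 2)) with hk
  have hk0 : 0 < k := Real.sqrt_pos.mpr (by positivity)
  have hk2 : k ^ 2 = 2 * (48 / Real.pi ^ 2 + 2) := Real.sq_sqrt (by positivity)
  have hsqrt : Tendsto (fun A : ℕ => Real.sqrt (A : ℝ)) atTop atTop :=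
    Real.tendsto_sqrt_atTop.comp tendsto_natCast_atTop_atTop
  have hinv : Tendsto (fun A : ℕ => (Real.sqrt (A : ℝ))⁻¹) atTop (𝓝 0) :=
    tendsto_inv_atTop_zero.comp hsqrt
  have hpos : ∀ᶠ A : ℕ in atTop, 0 < Real.sqrt (A : ℝ) := hsqrt.eventually_gt_atTop 0
  have hlim : Tendsto (fun A : ℕ => bound A / Real.sqrt (A : ℝ)) atTop (𝓝 (1 / k)) := by
    -- The maximum of 4t/(c + 8t²), c = 48/π² + 2, is at t² = c/8 = k²/16; its value 1/k matches the
    -- upper bound.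
    set t := k / 4 with ht
    have ht0 : 0 < t := by positivity
    have hn : Tendsto (fun A : ℕ => 4 * t - 4 * (Real.sqrt (A : ℝ))⁻¹ *
        (t + (Real.sqrt (A : ℝ))⁻¹) ^ 2 + (Real.sqrt (A : ℝ))⁻¹) atTop
        (𝓝 (4 * t - 4 * 0 * (t + 0) ^ 2 + 0)) :=
      (((hinv.const_mul 4).mul ((hinv.const_add t).pow 2)).const_sub (4 * t)).add hinv
    have hd : Tendsto (fun A : ℕ => 48 / Real.pi ^ 2 + 2 + 8 * (t + (Real.sqrt (A : ℝ))⁻¹) ^ 2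
        + 16 / 3 * (Real.sqrt (A : ℝ))⁻¹ * (t + (Real.sqrt (A : ℝ))⁻¹)) atTop
        (𝓝 (48 / Real.pi ^ 2 + 2 + 8 * (t + 0) ^ 2 + 16 / 3 * 0 * (t + 0))) :=
      ((((hinv.const_add t).pow 2).const_mul 8).const_add (48 / Real.pi ^ 2 + 2)).add
        ((hinv.const_mul (16 / 3)).mul (hinv.const_add t))
    have hlow := hn.div hd (by positivity)
    have e : (4 * t - 4 * 0 * (t + 0) ^ 2 + 0) /
        (48 / Real.pi ^ 2 + 2 + 8 * (t + 0) ^ 2 + 16 / 3 * 0 * (t + 0)) = 1 / k := by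
      have h2 : 48 / Real.pi ^ 2 + 2 + 8 * (t + 0) ^ 2 + 16 / 3 * 0 * (t + 0) = k ^ 2 := by
        rw [ht, hk2]
        linear_combination (1 / 2) * hk2
      rw [h2, ht]
      field_simp
      ring
    rw [e] at hlow
    have hup : Tendsto (fun A : ℕ => 1 / k + (Real.sqrt (A : ℝ))⁻¹) atTop (𝓝 (1 / k + 0)) :=
      hinv.const_add _
    rw [add_zero] at hup
    refine tendsto_of_tendsto_of_tendsto_of_le_of_le' hlow hup ?_ ?_
    · filter_upwards [hsqrt.eventually_ge_atTop (2 * t + 2), eventually_ge_atTop 3,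
        hn.eventually_const_lt (u := 0) (by simpa using ht0)] with A h1 h2 h3
      exact le_bound h2 ht0 h1 h3.le
    · filter_upwards [hpos, eventually_ge_atTop 3] with A h1 h2
      rw [div_le_iff₀ h1, add_mul, inv_mul_cancel₀ h1.ne', one_div_mul_eq_div]
      exact bound_le h2
  refine Asymptotics.isEquivalent_of_tendsto_one ?_
  have h1 := hlim.mul_const k
  rw [one_div_mul_cancel hk0.ne'] at h1
  refine h1.congr fun A => ?_
  simp only [Pi.div_apply]
  field_simp

theorem theorem1p1 :
    (∀ (q : ℂ), q ≠ 0 → (∃ m : ℤ, m ≠ -1 ∧ m ≠ 1 ∧ 1 / q = (m : ℂ)) →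
      ∀ (A : ℕ), 3 ≤ A → Odd A →
        bound A ≤ (Module.finrank ℚ (qBetaSpace q A) : ℝ)) ∧
    Asymptotics.IsEquivalent Filter.atTop bound
      (fun A : ℕ => Real.pi / (2 * Real.sqrt (Real.pi ^ 2 + 24)) * Real.sqrt (A : ℝ)) :=
  ⟨fun _ hq ⟨_, h1, h2, hqm⟩ _ hA hodd => bound_le_finrank hq h1 h2 hqm hA hodd,
    bound_isEquivalent⟩
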